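/- Let $\Omega>0$ and let $p,q\in C^2(\mathbb R)$ be complex-valued and $\Omega$-periodic. Put $$J=\begin{pmatrix} i&0\\0&-i\end{pmatrix},\qquad Q(x)=\begin{pmatrix}0&-iq(x)\\ ip(x)&0\end{pmatrix},\qquad L=J\frac{d}{dx}+Q .$$ For $E\in\mathbb C$ let $T(E)$ be the restriction of $y\mapsto y(\cdot+\Omega)$ to the space of solutions $y:\mathbb R\to\mathbb C^2$ of $Ly=Ey$, and let $s(E)$ be the order of vanishing at $E$ of the entire function $(\operatorname{tr}T(\cdot))^2-4$. For $x\in\mathbb R$ let $\delta(E,x)\in\{0,1,2,\dots,\infty\}$ be the algebraic multiplicity of $E$ as an eigenvalue of the Dirichlet problem $Ly=Ey$, $y_1(x)=y_1(x+\Omega)=0$ on $[x,x+\Omega]$ (that is, the dimension of the generalized eigenspace; $\delta(E,x)=0$ if $E$ is not an eigenvalue). Put $\delta_i(E)=\min_{x\in\mathbb R}\delta(E,x)$ and $\delta_m(E,x)=\delta(E,x)-\delta_i(E)$; the number of movable Dirichlet eigenvalues at $x$ is $\sum_{E\in\mathbb C}\delta_m(E,x)$. Let $D$ be an entire function that vanishes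 at each $E\in\mathbb C$ exactly to the order $\delta_i(E)$ (for instance the Hadamard product $e^{d_0E}E^{\delta_i(0)}\prod_{\lambda\ne0}\big[(1-E/\lambda)e^{E/\lambda}\big]^{\delta_i(\lambda)}$ with some $d_0\in\mathbb C$), and suppose that $$U(E)=\frac{(\operatorname{tr}T(E))^2-4}{D(E)^2}$$ is a polynomial in $E$ (in particular all $\delta_i(E)$ are finite, so that $q\not\equiv0$). Let $\mathcal E_2=\{E\in\mathbb C: s(E)-2\delta_i(E)>0\}$ and let $\mathcal S(L)$ be the conditional stability set of $L$, i.e. the set of all $E\in\mathbb C$ for which $Ly=Ey$ has a nonzero solution bounded on $\mathbb R$. Define $n$ by $\deg U=2n+2$. Then: (i) $n$ is a nonnegative integer; in particular $\deg U$ is even. (ii) For every $x\in\mathbb R$ with $q(x)\neq0$ the number of movable Dirichlet eigenvalues at $x$, counted with algebraic multiplicity, equals $n$. (iii) $\mathcal S(L)$ is the union of finitely many regular analytic arcs, any two of which have at most finitely many points in common. Here a regular analytic arc is the image of a closed, possibly unbounded, interval $I\subset\mathbb R$ with more than one point under a proper injective real-analytic map $I\to\mathbb C$ with nowhere vanishing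 derivative. (iv) $p,q\in C^\infty(\mathbb R)$. (v) The set $\mathcal E_2$ is finite, and there is a differential expression $P_{n+1}=\sum_{j=0}^{n+1}B_j(x)\frac{d^j}{dx^j}$ with $2\times2$ matrix-valued $C^\infty$ coefficients $B_j$ and leading coefficient $B_{n+1}=J^{n+2}$ that commutes with $L$ and satisfies $$P_{n+1}^2=-\prod_{E\in\mathcal E_2}(L-E)^{s(E)-2\delta_i(E)} .$$ -/

import Mathlib

open Set Filter Topology Polynomial
open scoped ContDiff

namespace AKNS

/-- Functions of a real variable with values in `ℂ²`. -/
abbrev VecFun : Type := ℝ → Fin 2 → ℂ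

/-- The constant matrix `J = diag(i, -i)`. -/
def J : Matrix (Fin 2) (Fin 2) ℂ := !![Complex.I, 0; 0, -Complex.I]

/-- The matrix potential `Q(x)` with rows `(0, -i q(x))` and `(i p(x), 0)`. -/
def Q (p q : ℝ → ℂ) (x : ℝ) : Matrix (Fin 2) (Fin 2) ℂ :=
  !![0, -Complex.I * q x; Complex.I * p x, 0]

/-- The differential expression `L = J d/dx + Q`. -/
noncomputable def L (p q : ℝ → ℂ) (y : VecFun) : VecFun :=
  fun x => J.mulVec (deriv y x) + (Q p q x).mulVec (y x)

/-- The space `V(E)` of all solutions on `ℝ` of `L y = E y`. -/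
def solutionSpace (p q : ℝ → ℂ) (E : ℂ) : Submodule ℂ VecFun where
  carrier := {y | Differentiable ℝ y ∧ L p q y = E • y}
  zero_mem' := by
    refine ⟨differentiable_const (0 : Fin 2 → ℂ), ?_⟩
    funext x
    have h : deriv (0 : VecFun) x = 0 := deriv_const x (0 : Fin 2 → ℂ)
    simp [L, h]
  add_mem' := by
    rintro a b ⟨ha, ha'⟩ ⟨hb, hb'⟩
    refine ⟨ha.add hb, ?_⟩
    have h1 : L p q (a + b) = L p q a + L p q b := by
      funext x
      have h : deriv (a + b) x = deriv a x + deriv b x := deriv_add (ha x) (hb x)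
      simp only [L, h, Pi.add_apply, Matrix.mulVec_add]
      abel
    rw [h1, ha', hb', smul_add]
  smul_mem' := by
    rintro c a ⟨ha, ha'⟩
    refine ⟨ha.const_smul c, ?_⟩
    have h1 : L p q (c • a) = c • L p q a := by
      funext x
      have h : deriv (c • a) x = c • deriv a x := deriv_const_smul c (ha x)
      simp only [L, h, Pi.smul_apply, Matrix.mulVec_smul, smul_add]
    rw [h1, ha', smul_comm]

/-- Translation by the period maps solutions to solutions. -/
theorem translate_mem {p q : ℝ → ℂ} {Ω : ℝ} (hp : Function.Periodic p Ω)
    (hq : Function.Periodic q Ω) (E : ℂ) {y : VecFun} (hy : y ∈ solutionSpace p q E) :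
    (fun x => y (x + Ω)) ∈ solutionSpace p q E := by
  obtain ⟨h1, h2⟩ := hy
  refine ⟨h1.comp (differentiable_id.add_const Ω), ?_⟩
  funext x
  have h := congrFun h2 (x + Ω)
  have hd : deriv (fun x => y (x + Ω)) x = deriv y (x + Ω) := deriv_comp_add_const y Ω x
  simp only [L, Q, hp x, hq x, Pi.smul_apply] at h
  simp only [L, Q, hd, Pi.smul_apply]
  exact h

/-- The Floquet operator `T(E)`: the restriction of `y ↦ y(· + Ω)` to `V(E)`. -/
def floquetOperator {p q : ℝ → ℂ} {Ω : ℝ} (hp : Function.Periodic p Ω)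
    (hq : Function.Periodic q Ω) (E : ℂ) :
    solutionSpace p q E →ₗ[ℂ] solutionSpace p q E where
  toFun y := ⟨fun x => (y : VecFun) (x + Ω), translate_mem hp hq E y.2⟩
  map_add' _ _ := rfl
  map_smul' _ _ := rfl

/-- The function `(tr T(E))² - 4`. -/
noncomputable def discr {p q : ℝ → ℂ} {Ω : ℝ} (hp : Function.Periodic p Ω)
    (hq : Function.Periodic q Ω) (E : ℂ) : ℂ :=
  (LinearMap.trace ℂ (solutionSpace p q E) (floquetOperator hp hq E)) ^ 2 - 4

/-- `s(E)`, the order of vanishing at `E` of `(tr T(·))² - 4`. -/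
noncomputable def sOrder {p q : ℝ → ℂ} {Ω : ℝ} (hp : Function.Periodic p Ω)
    (hq : Function.Periodic q Ω) (E : ℂ) : ℕ∞ :=
  analyticOrderAt (discr hp hq) E

/-- The conditional stability set: all `E` for which `L y = E y` has a bounded nonzero solution. -/
def stabilitySet (p q : ℝ → ℂ) : Set ℂ :=
  {E | ∃ y ∈ solutionSpace p q E, y ≠ 0 ∧ ∃ C : ℝ, ∀ x, ‖y x‖ ≤ C}

/-- `ker (H_D - E)^k` for the Dirichlet operator `H_D`, which acts as `L` on functions `y` on
`[x₀, x₀ + Ω]` with `y₁(x₀) = y₁(x₀ + Ω) = 0`. A function on the interval is represented by its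
extension by zero. For continuous `p, q` all elements of these kernels are continuously
differentiable on the interval, so that classical derivatives suffice. -/
def dirichletKer (p q : ℝ → ℂ) (Ω : ℝ) (E : ℂ) (x₀ : ℝ) : ℕ → Submodule ℂ VecFun
  | 0 => ⊥
  | k + 1 =>
    { carrier := {y | (∀ x, x ∉ Icc x₀ (x₀ + Ω) → y x = 0) ∧ y x₀ 0 = 0 ∧ y (x₀ + Ω) 0 = 0 ∧
        ∃ y' : VecFun, ∃ z ∈ dirichletKer p q Ω E x₀ k, ∀ x ∈ Icc x₀ (x₀ + Ω),
          HasDerivWithinAt y (y' x) (Icc x₀ (x₀ + Ω)) x ∧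
          (J.mulVec (y' x) + (Q p q x).mulVec (y x)) - E • y x = z x}
      zero_mem' := by
        refine ⟨fun _ _ => rfl, rfl, rfl, 0, 0, Submodule.zero_mem _, fun x _ => ⟨?_, ?_⟩⟩
        · exact hasDerivWithinAt_const x _ (0 : Fin 2 → ℂ)
        · simp
      add_mem' := by
        rintro a b ⟨ha, ha0, ha1, a', za, hza, hA⟩ ⟨hb, hb0, hb1, b', zb, hzb, hB⟩
        refine ⟨fun x hx => by simp [ha x hx, hb x hx], by simp [ha0, hb0], by simp [ha1, hb1],
          a' + b', za + zb, Submodule.add_mem _ hza hzb, fun x hx => ⟨?_, ?_⟩⟩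
        · exact (hA x hx).1.add (hB x hx).1
        · rw [Pi.add_apply za zb, ← (hA x hx).2, ← (hB x hx).2]
          simp only [Pi.add_apply, Matrix.mulVec_add, smul_add]
          abel
      smul_mem' := by
        rintro c a ⟨ha, ha0, ha1, a', za, hza, hA⟩
        refine ⟨fun x hx => by simp [ha x hx], by simp [ha0], by simp [ha1],
          c • a', c • za, Submodule.smul_mem _ c hza, fun x hx => ⟨?_, ?_⟩⟩
        · exact (hA x hx).1.const_smul c
        · rw [Pi.smul_apply c za, ← (hA x hx).2]
          simp only [Pi.smul_apply, Matrix.mulVec_smul, smul_add, smul_sub]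
          rw [smul_comm E c (a x)] }

/-- `δ(E, x)`, the algebraic multiplicity of `E` as a Dirichlet eigenvalue for `[x, x + Ω]`:
the dimension of the generalized eigenspace (zero if `E` is not an eigenvalue). -/
noncomputable def delta (p q : ℝ → ℂ) (Ω : ℝ) (E : ℂ) (x : ℝ) : ℕ∞ :=
  Cardinal.toENat (Module.rank ℂ (⨆ k, dirichletKer p q Ω E x k : Submodule ℂ VecFun))

/-- `δ_i(E)`, the immovable part of the multiplicity: the minimum of `δ(E, x)` over all `x`. -/
noncomputable def deltaImm (p q : ℝ → ℂ) (Ω : ℝ) (E : ℂ) : ℕ∞ :=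
  ⨅ x : ℝ, delta p q Ω E x

/-- `δ_m(E, x) = δ(E, x) - δ_i(E)`, the movable part of the multiplicity. -/
noncomputable def deltaMov (p q : ℝ → ℂ) (Ω : ℝ) (E : ℂ) (x : ℝ) : ℕ∞ :=
  delta p q Ω E x - deltaImm p q Ω E

/-- `D` is an entire function whose zeros are exactly the immovable Dirichlet eigenvalues,
counted with multiplicity `δ_i`. The Hadamard product `exp(d₀ E)` times the canonical product of
genus one over these points is such a function, for every choice of the constant `d₀`. -/
def IsImmovableFactor (p q : ℝ → ℂ) (Ω : ℝ) (D : ℂ → ℂ) : Prop :=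
  Differentiable ℂ D ∧ ∀ E : ℂ, analyticOrderAt D E = deltaImm p q Ω E

/-- A regular analytic arc: the image of a closed, possibly unbounded, interval with more than one
point under a proper injective real-analytic map with nowhere vanishing derivative. -/
def IsRegularAnalyticArc (A : Set ℂ) : Prop :=
  ∃ (I : Set ℝ) (γ : ℝ → ℂ), I.OrdConnected ∧ IsClosed I ∧ I.Nontrivial ∧
    AnalyticOnNhd ℝ γ I ∧ (∀ t ∈ I, deriv γ t ≠ 0) ∧ InjOn γ I ∧
    Tendsto γ (cocompact ℝ ⊓ 𝓟 I) (cocompact ℂ) ∧ A = γ '' I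

/-- The set of all `E` with `s(E) - 2 δ_i(E) > 0`. -/
def branchSet {p q : ℝ → ℂ} {Ω : ℝ} (hp : Function.Periodic p Ω)
    (hq : Function.Periodic q Ω) : Set ℂ :=
  {E | 2 * deltaImm p q Ω E < sOrder hp hq E}

/-- The polynomial `R(X) = ∏ (X - E)^(s(E) - 2 δ_i(E))`, the product taken over `branchSet`. -/
noncomputable def curvePoly {p q : ℝ → ℂ} {Ω : ℝ} (hp : Function.Periodic p Ω)
    (hq : Function.Periodic q Ω) : ℂ[X] :=
  ∏ᶠ E ∈ branchSet hp hq,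
    (X - C E) ^ ((sOrder hp hq E).toNat - 2 * (deltaImm p q Ω E).toNat)

/-- For a polynomial `R = ∑ rₖ Xᵏ`, the expression `R(L) = ∑ rₖ Lᵏ` applied to `y`. -/
noncomputable def polyL (p q : ℝ → ℂ) (R : ℂ[X]) (y : VecFun) : VecFun :=
  R.sum fun k r => r • (L p q)^[k] y

/-- The differential expression `∑_{j ≤ N} B_j(x) (d/dx)^j` with matrix coefficients. -/
noncomputable def diffExpr (N : ℕ) (B : ℕ → ℝ → Matrix (Fin 2) (Fin 2) ℂ) (y : VecFun) :
    VecFun :=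
  fun x => ∑ j ∈ Finset.range (N + 1), (B j x).mulVec (iteratedDeriv j y x)

end AKNS

/-!
The equation `L y = E y` is the system `y' = A y` with `A = !![-iE, q; p, iE]`. Let `Y(E, x)` be its
fundamental matrix and `M(E, x)` the monodromy matrix based at `x`. With `F = M₀₁`,
`G = (M₀₀ - M₁₁) / 2`, `H = M₁₀` one has `(tr T)² - 4 = 4 (G² + F H)`, and `M` satisfies the Lax
equation `M' = [A, M]` in `x`. All assertions follow from the fact that the traceless part of `M` is
`D` times a matrix whose entries are polynomials in `E`.

**Polynomial monodromy.** The algebraic multiplicity `δ(E, x)` of a Dirichlet eigenvalue is the order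
of vanishing of `F(·, x)` at `E` (`IsFundamental.delta_eq`): the Taylor coefficients in `E` of the
solution that starts in the direction `(0, 1)` at `x` form a Jordan chain. Hence `D` divides `F` for
every `x`, and, by the Lax equation, it divides `G` and `H` as well
(`IsFundamental.le_analyticOrderAt_monodromy`). Successive approximation gives `M = O(exp(|Im E| Ω))`
and `tr T = 2 cos(Ω E) + O(exp(|Im E| Ω) / |E|)` (`IsFundamental.exists_monodromy_asymptotics`). On a
sequence of circles `U D² = (tr T)² - 4` is bounded below by a multiple of `exp(2 |Im E| Ω)`, so that
`|F / D|²`, `|G / D|²` and `|H / D|²` are there bounded by a multiple of `|U|`. By Cauchy's estimates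
these entire functions are polynomials of degree at most `deg U / 2`
(`exists_polynomial_of_mul_eq`). Comparing leading coefficients in the Lax equation shows that `G / D`
has degree exactly `n + 1 = deg U / 2` with a constant leading coefficient `g`, while the degree `n`
coefficients of `F / D` and `H / D` are `i g q` and `i g p`
(`IsFundamental.exists_isPolynomialMonodromy`, `IsPolynomialMonodromy.coeff_F_eq`). So `F / D` has
exactly `n` zeros where `q ≠ 0`, and these are the movable Dirichlet eigenvalues.

**Smoothness and the commuting expression.** The coefficients of the polynomials `F / D`, `G / D`,
`H / D` solve an autonomous polynomial system of differential equations, hence are smooth, and `p` and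
`q` are among them (`IsPolynomialMonodromy.contDiff_coeff`). If `∑ₖ Mₖ(x) Eᵏ` denotes the traceless
part of `M` divided by `D`, then `y ↦ ∑ₖ Mₖ Lᵏ y` commutes with `L` because of the Lax equation, and
its square is `U(L) / 4` because the matrix squares to the scalar `U / 4`
(`IsPolynomialMonodromy.monodromyExpr_L`, `IsPolynomialMonodromy.monodromyExpr_monodromyExpr`). The
constant `i / g` normalizes the leading coefficient.

**The stability set.** By Floquet theory it is the set where `τ = tr T` takes values in `[-2, 2]`
(`IsFundamental.mem_stabilitySet_iff`). Near each of its points `τ` is a power of a local coordinate,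
so that the set is a finite union of arcs on which `τ` is a parameter
(`exists_isLevelArc_nhds`). At infinity, `τ' = D V` with a polynomial `V`, and `V² / U → -Ω²`. On half
planes far to the right and to the left, `τ = 2 cos W` with `W' = √(-V² / U)` close to `Ω`, so that `W`
is injective and the stability set consists of one tail on each side, the preimage under `W` of a
half-line (`exists_eq_two_mul_cos`, `exists_isTail`). The remaining part is compact and is covered by
finitely many level arcs; cut at the values of `τ` at all of their ends, two of them coincide or have
finite intersection, since away from critical points an arc is determined by one of its points and the
value of `τ` (`exists_regularAnalyticArcs`).
-/

namespace AKNS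

/-! ### Linear differential equations depending on a complex parameter -/

section Volterra

variable {F : Type*} [NormedAddCommGroup F] [NormedSpace ℂ F]

theorem continuous_apply_iccExtend {B : ℝ → F →L[ℂ] F} (hB : Continuous B) {a b : ℝ}
    (h : a ≤ b) (f : C(Icc a b, F)) : Continuous fun t => B t (IccExtend h f t) :=
  hB.clm_apply f.continuous.Icc_extend'

/-- The Volterra integral operator `f ↦ (x ↦ ∫ t in x₀..x, B t (f t))` on the continuous functions
on `[a, b]`. -/
noncomputable def volterra (B : ℝ → F →L[ℂ] F) (hB : Continuous B) {a b : ℝ} (h : a ≤ b)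
    (x₀ : ℝ) : C(Icc a b, F) →L[ℂ] C(Icc a b, F) :=
  LinearMap.mkContinuousOfExistsBound
    { toFun := fun f => ⟨fun x => ∫ t in x₀..(x : ℝ), B t (IccExtend h f t),
        (intervalIntegral.continuous_primitive
          (fun _ _ => (continuous_apply_iccExtend hB h f).intervalIntegrable _ _) x₀).comp
          continuous_subtype_val⟩
      map_add' := fun f g => by
        ext x
        simp only [ContinuousMap.coe_mk, ContinuousMap.add_apply]
        rw [← intervalIntegral.integral_add
          ((continuous_apply_iccExtend hB h f).intervalIntegrable _ _)
          ((continuous_apply_iccExtend hB h g).intervalIntegrable _ _)]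
        simp [IccExtend]
      map_smul' := fun c f => by
        ext x
        simp only [ContinuousMap.coe_mk, ContinuousMap.smul_apply, RingHom.id_apply]
        rw [← intervalIntegral.integral_smul]
        simp [IccExtend] }
    (by
      obtain ⟨C, hC⟩ := (isCompact_uIcc (a := min a x₀) (b := max b x₀)).exists_bound_of_continuousOn
        hB.continuousOn
      refine ⟨max C 0 * (max b x₀ - min a x₀), fun f => ?_⟩
      have h0 : (0 : ℝ) ≤ max b x₀ - min a x₀ := by
        have := le_max_right b x₀
        have := min_le_right a x₀
        linarith
      refine (ContinuousMap.norm_le _ (by positivity)).2 fun x => ?_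
      have h1 : ‖∫ t in x₀..(x : ℝ), B t (IccExtend h f t)‖ ≤
          (max C 0 * ‖f‖) * |(x : ℝ) - x₀| := by
        refine intervalIntegral.norm_integral_le_of_norm_le_const fun t ht => ?_
        refine (ContinuousLinearMap.le_opNorm _ _).trans ?_
        refine mul_le_mul ((hC t ?_).trans (le_max_left _ _)) (f.norm_coe_le_norm _)
          (norm_nonneg _) (le_max_right _ _)
        have hx := x.2
        rw [uIcc_of_le (by linarith)]
        rcases le_total x₀ (x : ℝ) with h' | h'
        · rw [uIoc_of_le h'] at ht
          exact ⟨(min_le_right _ _).trans ht.1.le, (ht.2.trans hx.2).trans (le_max_left _ _)⟩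
        · rw [uIoc_of_ge h'] at ht
          exact ⟨(min_le_left _ _).trans (hx.1.trans ht.1.le), ht.2.trans (le_max_right _ _)⟩
      have h2 : |(x : ℝ) - x₀| ≤ max b x₀ - min a x₀ := by
        have := x.2.1
        have := x.2.2
        rw [abs_le]
        constructor <;>
        linarith [le_max_right b x₀, min_le_right a x₀, le_max_left b x₀, min_le_left a x₀]
      calc _ ≤ (max C 0 * ‖f‖) * |(x : ℝ) - x₀| := h1
        _ ≤ (max C 0 * ‖f‖) * (max b x₀ - min a x₀) := by gcongr
        _ = _ := by ring)

theorem volterra_apply (B : ℝ → F →L[ℂ] F) (hB : Continuous B) {a b : ℝ} (h : a ≤ b)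
    (x₀ : ℝ) (f : C(Icc a b, F)) (x : Icc a b) :
    volterra B hB h x₀ f x = ∫ t in x₀..(x : ℝ), B t (IccExtend h f t) := rfl

/-- The `n`-th power of a Volterra operator is bounded by `Cⁿ / n!`. -/
theorem exists_volterra_pow_bound (B : ℝ → F →L[ℂ] F) (hB : Continuous B) {a b : ℝ} (h : a ≤ b)
    {x₀ : ℝ} (hx₀ : x₀ ∈ Icc a b) :
    ∃ C, 0 ≤ C ∧ ∀ n (f : C(Icc a b, F)) (x : Icc a b),
      ‖(volterra B hB h x₀ ^ n) f x‖ ≤ (C * |(x : ℝ) - x₀|) ^ n / n.factorial * ‖f‖ := by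
  obtain ⟨C, hC⟩ := (isCompact_Icc (a := a) (b := b)).exists_bound_of_continuousOn hB.continuousOn
  refine ⟨max C 0, le_max_right _ _, fun n f => ?_⟩
  induction n with
  | zero => intro x; simpa using f.norm_coe_le_norm x
  | succ n ih =>
    intro x
    rw [pow_succ', mul_apply_eq_comp, volterra_apply]
    set g := (volterra B hB h x₀ ^ n) f
    have hsub : uIoc x₀ (x : ℝ) ⊆ Icc a b :=
      uIoc_subset_uIcc.trans (ordConnected_Icc.uIcc_subset hx₀ x.2)
    have hb : ∀ t ∈ uIoc x₀ (x : ℝ), ‖B t (IccExtend h g t)‖ ≤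
        max C 0 ^ (n + 1) / n.factorial * ‖f‖ * |t - x₀| ^ n := by
      intro t ht
      have ht' := hsub ht
      rw [IccExtend_of_mem h g ht']
      refine (ContinuousLinearMap.le_opNorm _ _).trans ?_
      refine (mul_le_mul ((hC t ht').trans (le_max_left _ 0)) (ih ⟨t, ht'⟩)
        (norm_nonneg _) (le_max_right _ _)).trans (le_of_eq ?_)
      simp only [mul_pow]
      ring
    refine (intervalIntegral.norm_integral_le_integral_norm_uIoc).trans ?_
    refine (MeasureTheory.setIntegral_mono_on ?_ ?_ measurableSet_uIoc hb).trans ?_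
    · exact ((continuous_apply_iccExtend hB h g).norm.intervalIntegrable _ _).def'
    · exact (Continuous.intervalIntegrable (by fun_prop) _ _).def'
    · rw [MeasureTheory.integral_const_mul, integral_pow_abs_sub_uIoc, Nat.factorial_succ]
      refine le_of_eq ?_
      push_cast
      have : (n.factorial : ℝ) ≠ 0 := by positivity
      have : (n : ℝ) + 1 ≠ 0 := by positivity
      field_simp
      ring

/-- The pencil of coefficients `A₀(t) + E A₁`. -/
def pencil (A₀ : ℝ → F →L[ℂ] F) (A₁ : F →L[ℂ] F) (E : ℂ) (t : ℝ) : F →L[ℂ] F := A₀ t + E • A₁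

theorem continuous_pencil {A₀ : ℝ → F →L[ℂ] F} (h0 : Continuous A₀) (A₁ : F →L[ℂ] F) (E : ℂ) :
    Continuous (pencil A₀ A₁ E) := h0.add continuous_const

theorem volterra_pencil {A₀ : ℝ → F →L[ℂ] F} (h0 : Continuous A₀) (A₁ : F →L[ℂ] F) (E : ℂ)
    {a b : ℝ} (h : a ≤ b) (x₀ : ℝ) :
    volterra (pencil A₀ A₁ E) (continuous_pencil h0 A₁ E) h x₀ =
      volterra A₀ h0 h x₀ + E • volterra (fun _ => A₁) continuous_const h x₀ := by
  ext f x
  simp only [add_apply, ContinuousMap.add_apply, volterra_apply,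
    smul_apply, ContinuousMap.smul_apply]
  rw [← intervalIntegral.integral_smul, ← intervalIntegral.integral_add]
  · simp [pencil]
  · exact (continuous_apply_iccExtend h0 h f).intervalIntegrable _ _
  · exact ((continuous_apply_iccExtend continuous_const h f).const_smul E).intervalIntegrable _ _

variable [CompleteSpace F]

theorem isUnit_one_sub_volterra (B : ℝ → F →L[ℂ] F) (hB : Continuous B) {a b : ℝ} (h : a ≤ b)
    {x₀ : ℝ} (hx₀ : x₀ ∈ Icc a b) : IsUnit (1 - volterra B hB h x₀) := by
  obtain ⟨C, hC0, hC⟩ := exists_volterra_pow_bound B hB h hx₀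
  set K := volterra B hB h x₀
  obtain ⟨n, hn⟩ : ∃ n : ℕ, (C * (b - a)) ^ n / n.factorial < 1 / 2 :=
    ((FloorSemiring.tendsto_pow_div_factorial_atTop (C * (b - a))).eventually
      (gt_mem_nhds (by norm_num))).exists
  have hK : ‖K ^ n‖ < 1 := by
    refine lt_of_le_of_lt (ContinuousLinearMap.opNorm_le_bound _ (by norm_num : (0 : ℝ) ≤ 1 / 2)
      fun f => (ContinuousMap.norm_le _ (by positivity)).2 fun x => (hC n f x).trans ?_)
      (by norm_num : (1 / 2 : ℝ) < 1)
    refine mul_le_mul_of_nonneg_right (le_trans ?_ hn.le) (norm_nonneg _)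
    have : |(x : ℝ) - x₀| ≤ b - a := by
      have := x.2.1
      have := x.2.2
      rw [abs_le]
      constructor <;> linarith [hx₀.1, hx₀.2]
    gcongr
  have hu := isUnit_one_sub_of_norm_lt_one (x := K ^ n) hK
  rw [← mul_neg_geom_sum K n] at hu
  have hc : Commute (1 - K) (∑ i ∈ Finset.range n, K ^ i) := by
    refine Commute.sum_right _ _ _ fun i _ => ?_
    exact (Commute.one_left _).sub_left (Commute.pow_right rfl i)
  exact (hc.isUnit_mul_iff.1 hu).1

theorem differentiable_inverse_one_sub_pencil {R : Type*} [NormedRing R] [NormedAlgebra ℂ R]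
    [CompleteSpace R] (a b : R) (h : ∀ E : ℂ, IsUnit (1 - (a + E • b))) :
    Differentiable ℂ fun E : ℂ => Ring.inverse (1 - (a + E • b)) := fun E =>
  (differentiableAt_inverse (𝕜 := ℂ) (h E)).comp E
    ((differentiableAt_const _).sub
      ((differentiableAt_const _).add (differentiableAt_id.smul_const _)))

/-- The solution of a Volterra equation depends holomorphically on the spectral parameter. -/
theorem exists_volterra_solution {A₀ : ℝ → F →L[ℂ] F} (h0 : Continuous A₀) (A₁ : F →L[ℂ] F)
    {a b : ℝ} (h : a ≤ b) {x₀ : ℝ} (hx₀ : x₀ ∈ Icc a b) (g : C(Icc a b, F)) :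
    ∃ Y : ℂ → C(Icc a b, F), Differentiable ℂ Y ∧ ∀ E (u : C(Icc a b, F)),
      u = g + volterra (pencil A₀ A₁ E) (continuous_pencil h0 A₁ E) h x₀ u ↔ u = Y E := by
  let K : ℂ → (C(Icc a b, F) →L[ℂ] C(Icc a b, F)) := fun E =>
    1 - volterra (pencil A₀ A₁ E) (continuous_pencil h0 A₁ E) h x₀
  have hK : ∀ E, IsUnit (K E) := fun E => isUnit_one_sub_volterra _ _ h hx₀
  have hd : Differentiable ℂ fun E => Ring.inverse (K E) := by
    have h1 : K = fun E => 1 - (volterra A₀ h0 h x₀ +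
        E • volterra (fun _ => A₁) continuous_const h x₀) :=
      funext fun E => by rw [← volterra_pencil h0 A₁ E h x₀]
    rw [h1] at hK ⊢
    exact differentiable_inverse_one_sub_pencil (volterra A₀ h0 h x₀)
      (volterra (fun _ => A₁) continuous_const h x₀) hK
  refine ⟨fun E => Ring.inverse (K E) g, ?_, fun E u => ?_⟩
  · intro E
    exact (hd E).clm_apply (differentiableAt_const g)
  · have e : (u = g + volterra (pencil A₀ A₁ E) (continuous_pencil h0 A₁ E) h x₀ u) ↔
        K E u = g := by
      simp only [K, sub_apply, one_apply_eq_self]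
      rw [sub_eq_iff_eq_add]
    rw [e]
    constructor
    · rintro rfl
      change u = Ring.inverse (K E) (K E u)
      rw [← mul_apply_eq_comp, Ring.inverse_mul_cancel _ (hK E)]
      rfl
    · rintro rfl
      change K E (Ring.inverse (K E) g) = g
      rw [← mul_apply_eq_comp, Ring.mul_inverse_cancel _ (hK E)]
      rfl

/-- The solution of the initial value problem `y' = (A₀ + E A₁) y + f`, `y x₀ = v`, exists on the
whole line and is, at each point, an entire function of `E`. -/
theorem exists_entire_solution {A₀ : ℝ → F →L[ℂ] F} (h0 : Continuous A₀) (A₁ : F →L[ℂ] F)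
    {f : ℝ → F} (hf : Continuous f) (x₀ : ℝ) (v : F) :
    ∃ y : ℂ → ℝ → F, (∀ E x, HasDerivAt (y E) (A₀ x (y E x) + E • A₁ (y E x) + f x) x) ∧
      (∀ E, y E x₀ = v) ∧ ∀ x, Differentiable ℂ fun E => y E x := by
  have hle : ∀ T : ℝ, 0 ≤ T → x₀ - T ≤ x₀ + T := fun T hT => by linarith
  have hmem : ∀ T : ℝ, 0 ≤ T → x₀ ∈ Icc (x₀ - T) (x₀ + T) := fun T hT => by
    constructor <;> linarith
  let g₀ : ℝ → F := fun x => v + ∫ t in x₀..x, f t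
  have hg₀ : Continuous g₀ := continuous_const.add
    (intervalIntegral.continuous_primitive (fun _ _ => hf.intervalIntegrable _ _) x₀)
  let g : ∀ T : ℝ, C(Icc (x₀ - T) (x₀ + T), F) := fun T => ⟨fun x => g₀ x, by fun_prop⟩
  have key := fun (T : ℝ) (hT : 0 ≤ T) =>
    exists_volterra_solution h0 A₁ (hle T hT) (hmem T hT) (g T)
  choose Y hYd hY using key
  have hsol : ∀ T (hT : 0 ≤ T) E (x : Icc (x₀ - T) (x₀ + T)), Y T hT E x =
      g₀ x + ∫ t in x₀..(x : ℝ), pencil A₀ A₁ E t (IccExtend (hle T hT) (Y T hT E) t) := by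
    intro T hT E x
    exact congrArg (fun u => u x) ((hY T hT E (Y T hT E)).2 rfl)
  -- The solutions on nested intervals agree, so that they define one function on the line.
  have hcompat : ∀ S T (hS : 0 ≤ S) (hT : 0 ≤ T), S ≤ T → ∀ E x (hx : x ∈ Icc (x₀ - S) (x₀ + S)),
      IccExtend (hle S hS) (Y S hS E) x = IccExtend (hle T hT) (Y T hT E) x := by
    intro S T hS hT hST E x hx
    let u : C(Icc (x₀ - S) (x₀ + S), F) :=
      ⟨fun x => IccExtend (hle T hT) (Y T hT E) x, by
        have := (Y T hT E).continuous.Icc_extend' (h := hle T hT)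
        fun_prop⟩
    have hsub : Icc (x₀ - S) (x₀ + S) ⊆ Icc (x₀ - T) (x₀ + T) :=
      Icc_subset_Icc (by linarith) (by linarith)
    have hu : u = Y S hS E := by
      refine (hY S hS E u).1 ?_
      ext z
      change IccExtend (hle T hT) (Y T hT E) (z : ℝ) = _
      rw [IccExtend_of_mem _ _ (hsub z.2), hsol T hT E, ContinuousMap.add_apply, volterra_apply]
      congr 1
      refine intervalIntegral.integral_congr fun t ht => ?_
      have ht' := ordConnected_Icc.uIcc_subset (hmem S hS) z.2 ht
      change _ = pencil A₀ A₁ E t (IccExtend (hle S hS) u t)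
      rw [IccExtend_of_mem (hle S hS) _ ht']
      rfl
    rw [IccExtend_of_mem (hle S hS) _ hx, ← hu]
    rfl
  have hnn : ∀ x : ℝ, 0 ≤ |x - x₀| := fun x => abs_nonneg _
  have hmem' : ∀ x : ℝ, x ∈ Icc (x₀ - |x - x₀|) (x₀ + |x - x₀|) := fun x => by
    constructor
    · linarith [neg_abs_le (x - x₀)]
    · linarith [le_abs_self (x - x₀)]
  let y : ℂ → ℝ → F := fun E x => IccExtend (hle _ (hnn x)) (Y _ (hnn x) E) x
  have hy : ∀ T (hT : 0 ≤ T) E x, x ∈ Icc (x₀ - T) (x₀ + T) →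
      y E x = IccExtend (hle T hT) (Y T hT E) x := by
    intro T hT E x hx
    refine hcompat _ T (hnn x) hT ?_ E x (hmem' x)
    rw [abs_le]
    constructor <;> linarith [hx.1, hx.2]
  refine ⟨y, fun E x => ?_, fun E => ?_, fun x => ?_⟩
  · set T := |x - x₀| + 1
    have hT : 0 ≤ T := by positivity
    have hcont := continuous_apply_iccExtend (continuous_pencil h0 A₁ E) (hle T hT) (Y T hT E)
    have hxT : x ∈ Ioo (x₀ - T) (x₀ + T) := by
      constructor
      · simp only [T]; linarith [neg_abs_le (x - x₀)]
      · simp only [T]; linarith [le_abs_self (x - x₀)]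
    have hev : y E =ᶠ[𝓝 x] fun z => g₀ z +
        ∫ t in x₀..z, pencil A₀ A₁ E t (IccExtend (hle T hT) (Y T hT E) t) := by
      filter_upwards [Ioo_mem_nhds hxT.1 hxT.2] with z hz
      have hz' := Ioo_subset_Icc_self hz
      rw [hy T hT E z hz', IccExtend_of_mem _ _ hz', hsol T hT E ⟨z, hz'⟩]
    refine HasDerivAt.congr_of_eventuallyEq ?_ hev
    have h1 : HasDerivAt g₀ (f x) x :=
      (intervalIntegral.integral_hasDerivAt_right (hf.intervalIntegrable _ _)
        (hf.stronglyMeasurableAtFilter _ _) hf.continuousAt).const_add v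
    have h2 := intervalIntegral.integral_hasDerivAt_right (hcont.intervalIntegrable x₀ x)
        (hcont.stronglyMeasurableAtFilter _ _) hcont.continuousAt
    refine (h1.add h2).congr_deriv ?_
    rw [← hy T hT E x (Ioo_subset_Icc_self hxT)]
    simp [pencil]
    abel
  · have hx : x₀ ∈ Icc (x₀ - 0) (x₀ + 0) := by simp
    rw [hy 0 le_rfl E x₀ hx, IccExtend_of_mem _ _ hx, hsol 0 le_rfl E ⟨x₀, hx⟩]
    simp [g₀]
  · have : (fun E => y E x) = fun E => Y _ (hnn x) E ⟨x, hmem' x⟩ := by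
      funext E
      exact IccExtend_of_mem _ _ (hmem' x)
    rw [this]
    exact fun E => DifferentiableAt.comp E
      (ContinuousMap.evalCLM ℂ (⟨x, hmem' x⟩ : Icc (x₀ - |x - x₀|) (x₀ + |x - x₀|))
        : C(Icc (x₀ - |x - x₀|) (x₀ + |x - x₀|), F) →L[ℂ] F).differentiableAt
      (hYd _ (hnn x) E)

end Volterra

/-! ### The fundamental matrix and the monodromy matrix -/

/-- The coefficient matrix of the first order system `y' = A y` equivalent to `L y = E y`. -/
def coeffMat (p q : ℝ → ℂ) (E : ℂ) (x : ℝ) : Matrix (Fin 2) (Fin 2) ℂ :=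
  !![-Complex.I * E, q x; p x, Complex.I * E]

theorem exists_entire_solution_system {p q : ℝ → ℂ} (hp : Continuous p) (hq : Continuous q)
    {f : ℝ → Fin 2 → ℂ} (hf : Continuous f) (x₀ : ℝ) (v : Fin 2 → ℂ) :
    ∃ y : ℂ → ℝ → Fin 2 → ℂ,
      (∀ E x, HasDerivAt (y E) ((coeffMat p q E x).mulVec (y E x) + f x) x) ∧
      (∀ E, y E x₀ = v) ∧ ∀ x, Differentiable ℂ fun E => y E x := by
  let c : Matrix (Fin 2) (Fin 2) ℂ → ((Fin 2 → ℂ) →L[ℂ] (Fin 2 → ℂ)) :=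
    fun M => M.mulVecLin.toContinuousLinearMap
  obtain ⟨y, h1, h2, h3⟩ := exists_entire_solution
    (A₀ := fun x => q x • c !![0, 1; 0, 0] + p x • c !![0, 0; 1, 0])
    ((hq.smul continuous_const).add (hp.smul continuous_const))
    (c !![-Complex.I, 0; 0, Complex.I]) hf x₀ v
  refine ⟨y, fun E x => (h1 E x).congr_deriv ?_, h2, h3⟩
  congr 1
  ext i
  fin_cases i <;>
  simp [c, coeffMat, Matrix.mulVec, dotProduct, Fin.sum_univ_two] <;> ring

/-- `Y E x` is the fundamental matrix of `y' = A y` with `Y E 0 = 1`. -/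
structure IsFundamental (p q : ℝ → ℂ) (Y : ℂ → ℝ → Matrix (Fin 2) (Fin 2) ℂ) : Prop where
  hasDerivAt : ∀ E x i j, HasDerivAt (fun x => Y E x i j) ((coeffMat p q E x * Y E x) i j) x
  init : ∀ E, Y E 0 = 1
  entire : ∀ x i j, Differentiable ℂ fun E => Y E x i j

theorem exists_isFundamental {p q : ℝ → ℂ} (hp : Continuous p) (hq : Continuous q) :
    ∃ Y, IsFundamental p q Y := by
  have h := fun j : Fin 2 => exists_entire_solution_system hp hq
    (continuous_const (y := (0 : Fin 2 → ℂ))) 0 (fun i => (1 : Matrix (Fin 2) (Fin 2) ℂ) i j)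
  choose y h1 h2 h3 using h
  refine ⟨fun E x => Matrix.of fun i j => y j E x i, fun E x i j => ?_, fun E => ?_,
    fun x i j => ?_⟩
  · have := hasDerivAt_pi.1 (h1 j E x) i
    fin_cases i <;> simpa [Matrix.mul_apply, Matrix.mulVec, dotProduct] using this
  · ext i j
    simp [h2]
  · exact differentiable_pi.1 (h3 j x) i

namespace IsFundamental

variable {p q : ℝ → ℂ} {Y : ℂ → ℝ → Matrix (Fin 2) (Fin 2) ℂ} (hY : IsFundamental p q Y)
include hY

theorem d0 (E : ℂ) (x : ℝ) (j : Fin 2) : HasDerivAt (fun x => Y E x 0 j)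
    (-Complex.I * E * Y E x 0 j + q x * Y E x 1 j) x := by
  simpa [coeffMat, Matrix.mul_apply, Fin.sum_univ_two] using hY.hasDerivAt E x 0 j

theorem d1 (E : ℂ) (x : ℝ) (j : Fin 2) : HasDerivAt (fun x => Y E x 1 j)
    (p x * Y E x 0 j + Complex.I * E * Y E x 1 j) x := by
  simpa [coeffMat, Matrix.mul_apply, Fin.sum_univ_two] using hY.hasDerivAt E x 1 j

/-- The coefficient matrix has trace zero, so the Wronskian is constant. -/
theorem wronskian (E : ℂ) (x : ℝ) : Y E x 0 0 * Y E x 1 1 - Y E x 0 1 * Y E x 1 0 = 1 := by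
  have hd : ∀ x, HasDerivAt (fun x => Y E x 0 0 * Y E x 1 1 - Y E x 0 1 * Y E x 1 0) 0 x := by
    intro x
    refine (((hY.d0 E x 0).mul (hY.d1 E x 1)).sub ((hY.d0 E x 1).mul (hY.d1 E x 0))).congr_deriv ?_
    ring
  have := is_const_of_deriv_eq_zero (fun x => (hd x).differentiableAt) (fun x => (hd x).deriv) x 0
  simpa [hY.init] using this

theorem det (E : ℂ) (x : ℝ) : (Y E x).det = 1 := by
  rw [Matrix.det_fin_two]
  exact hY.wronskian E x

theorem mul_adjugate (E : ℂ) (x : ℝ) : Y E x * (Y E x).adjugate = 1 := by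
  rw [Matrix.mul_adjugate, hY.det, one_smul]

theorem adjugate_mul (E : ℂ) (x : ℝ) : (Y E x).adjugate * Y E x = 1 := by
  rw [Matrix.adjugate_mul, hY.det, one_smul]

/-- Solutions are determined by one value, on the line or on an interval. -/
theorem eq_mulVec_of_convex {E : ℂ} {u : ℝ → Fin 2 → ℂ} {s : Set ℝ} (hs : Convex ℝ s)
    (hu : ∀ x ∈ s, HasDerivWithinAt u ((coeffMat p q E x).mulVec (u x)) s x) {x x₀ : ℝ}
    (hx : x ∈ s) (hx₀ : x₀ ∈ s) :
    u x = (Y E x).mulVec ((Y E x₀).adjugate.mulVec (u x₀)) := by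
  have hu0 : ∀ x ∈ s, HasDerivWithinAt (fun x => u x 0)
      (-Complex.I * E * u x 0 + q x * u x 1) s x := fun x hx => by
    have := hasDerivWithinAt_pi.1 (hu x hx) 0
    simpa [coeffMat, Matrix.mulVec, dotProduct, Fin.sum_univ_two] using this
  have hu1 : ∀ x ∈ s, HasDerivWithinAt (fun x => u x 1)
      (p x * u x 0 + Complex.I * E * u x 1) s x := fun x hx => by
    have := hasDerivWithinAt_pi.1 (hu x hx) 1
    simpa [coeffMat, Matrix.mulVec, dotProduct, Fin.sum_univ_two] using this
  have hconst : ∀ f : ℝ → ℂ, (∀ x ∈ s, HasDerivWithinAt f 0 s x) → f x = f x₀ := fun f hf => by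
    have := hs.norm_image_sub_le_of_norm_hasDerivWithin_le (C := 0) hf (fun x _ => by simp) hx₀ hx
    rw [zero_mul] at this
    exact sub_eq_zero.1 (norm_le_zero_iff.1 this)
  have hc : (Y E x).adjugate.mulVec (u x) = (Y E x₀).adjugate.mulVec (u x₀) := by
    have e0 := hconst (fun x => Y E x 1 1 * u x 0 - Y E x 0 1 * u x 1) fun x hx => by
      refine (((hY.d1 E x 1).hasDerivWithinAt.mul (hu0 x hx)).sub
        ((hY.d0 E x 1).hasDerivWithinAt.mul (hu1 x hx))).congr_deriv ?_
      ring
    have e1 := hconst (fun x => Y E x 0 0 * u x 1 - Y E x 1 0 * u x 0) fun x hx => by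
      refine (((hY.d0 E x 0).hasDerivWithinAt.mul (hu1 x hx)).sub
        ((hY.d1 E x 0).hasDerivWithinAt.mul (hu0 x hx))).congr_deriv ?_
      ring
    ext i
    fin_cases i
    · simp only [Matrix.adjugate_fin_two, Matrix.mulVec, dotProduct, Fin.sum_univ_two]
      simp only [Fin.zero_eta, Matrix.of_apply, Matrix.cons_val_zero, Matrix.cons_val_one,
        Matrix.cons_val', Matrix.cons_val_fin_one]
      linear_combination e0
    · simp only [Matrix.adjugate_fin_two, Matrix.mulVec, dotProduct, Fin.sum_univ_two]
      simp only [Fin.mk_one, Matrix.of_apply, Matrix.cons_val_zero, Matrix.cons_val_one,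
        Matrix.cons_val', Matrix.cons_val_fin_one]
      linear_combination e1
  rw [← hc, Matrix.mulVec_mulVec, hY.mul_adjugate, Matrix.one_mulVec]

theorem eq_mulVec {E : ℂ} {u : ℝ → Fin 2 → ℂ}
    (hu : ∀ x, HasDerivAt u ((coeffMat p q E x).mulVec (u x)) x) (x x₀ : ℝ) :
    u x = (Y E x).mulVec ((Y E x₀).adjugate.mulVec (u x₀)) :=
  hY.eq_mulVec_of_convex convex_univ (fun x _ => (hu x).hasDerivWithinAt) (mem_univ x)
    (mem_univ x₀)

theorem hasDerivAt_mulVec (E : ℂ) (v : Fin 2 → ℂ) (x : ℝ) :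
    HasDerivAt (fun x => (Y E x).mulVec v) ((coeffMat p q E x).mulVec ((Y E x).mulVec v)) x := by
  rw [hasDerivAt_pi, Matrix.mulVec_mulVec]
  intro i
  simp only [Matrix.mulVec, dotProduct, Fin.sum_univ_two]
  exact ((hY.hasDerivAt E x i 0).mul_const _).add ((hY.hasDerivAt E x i 1).mul_const _)

theorem add_period {Ω : ℝ} (hp : Function.Periodic p Ω) (hq : Function.Periodic q Ω) (E : ℂ)
    (x : ℝ) : Y E (x + Ω) = Y E x * Y E Ω := by
  have h : ∀ v, (Y E (x + Ω)).mulVec v = (Y E x * Y E Ω).mulVec v := by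
    intro v
    have hd : ∀ x, HasDerivAt (fun x => (Y E (x + Ω)).mulVec v)
        ((coeffMat p q E x).mulVec ((Y E (x + Ω)).mulVec v)) x := by
      intro x
      have := (hY.hasDerivAt_mulVec E v (x + Ω)).comp_add_const x Ω
      simpa [coeffMat, hp x, hq x] using this
    have := hY.eq_mulVec hd x 0
    rwa [zero_add, hY.init, Matrix.adjugate_one, Matrix.one_mulVec, Matrix.mulVec_mulVec] at this
  exact Matrix.ext_of_mulVec_single fun i => h _

end IsFundamental

/-- Membership in the solution space, as a first order system. -/
theorem mem_solutionSpace_iff {p q : ℝ → ℂ} {E : ℂ} {y : VecFun} :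
    y ∈ solutionSpace p q E ↔ ∀ x, HasDerivAt y ((coeffMat p q E x).mulVec (y x)) x := by
  have hI : Complex.I * Complex.I = -1 := Complex.I_mul_I
  constructor
  · rintro ⟨h1, h2⟩ x
    have hd := (h1 x).hasDerivAt
    refine hd.congr_deriv ?_
    have h := congrFun h2 x
    have h0 := congrFun h 0
    have h1 := congrFun h 1
    simp only [L, J, Q, Matrix.mulVec, dotProduct, Fin.sum_univ_two, Pi.add_apply,
      Matrix.of_apply, Matrix.cons_val_zero, Matrix.cons_val_one, Matrix.cons_val',
      Matrix.cons_val_fin_one, Pi.smul_apply, smul_eq_mul] at h0 h1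
    ext i
    fin_cases i
    · simp [coeffMat, Matrix.mulVec, dotProduct, Fin.sum_univ_two]
      linear_combination -Complex.I * h0 + (deriv y x 0 - q x * y x 1) * hI
    · simp [coeffMat, Matrix.mulVec, dotProduct, Fin.sum_univ_two]
      linear_combination Complex.I * h1 + (deriv y x 1 - p x * y x 0) * hI
  · intro h
    refine ⟨fun x => (h x).differentiableAt, ?_⟩
    funext x
    simp only [L, (h x).deriv]
    ext i
    fin_cases i
    · simp [coeffMat, J, Q, dotProduct, Fin.sum_univ_two]
      linear_combination -(E * y x 0) * hI
    · simp [coeffMat, J, Q, dotProduct, Fin.sum_univ_two]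
      linear_combination -(E * y x 1) * hI

/-- The monodromy matrix with base point `x`: it maps `y x` to `y (x + Ω)` for each solution. -/
noncomputable def monodromy (Y : ℂ → ℝ → Matrix (Fin 2) (Fin 2) ℂ) (Ω : ℝ) (E : ℂ) (x : ℝ) :
    Matrix (Fin 2) (Fin 2) ℂ :=
  Y E x * Y E Ω * (Y E x).adjugate

namespace IsFundamental

variable {p q : ℝ → ℂ} {Y : ℂ → ℝ → Matrix (Fin 2) (Fin 2) ℂ} (hY : IsFundamental p q Y)
include hY

theorem mulVec_mem_solutionSpace (E : ℂ) (v : Fin 2 → ℂ) :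
    (fun x => (Y E x).mulVec v) ∈ solutionSpace p q E :=
  mem_solutionSpace_iff.2 (hY.hasDerivAt_mulVec E v)

/-- A solution is determined by its value at the origin. -/
noncomputable def solutionEquiv (E : ℂ) : (Fin 2 → ℂ) ≃ₗ[ℂ] solutionSpace p q E where
  toFun v := ⟨fun x => (Y E x).mulVec v, hY.mulVec_mem_solutionSpace E v⟩
  map_add' u v := by
    ext1; funext x; exact Matrix.mulVec_add (Y E x) u v
  map_smul' c v := by
    ext1; funext x; exact Matrix.mulVec_smul (Y E x) c v
  invFun y := (y : VecFun) 0
  left_inv v := by simp [hY.init]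
  right_inv y := by
    ext1; funext x
    have := hY.eq_mulVec (mem_solutionSpace_iff.1 y.2) x 0
    simpa [hY.init] using this.symm

theorem trace_floquetOperator {Ω : ℝ} (hp : Function.Periodic p Ω) (hq : Function.Periodic q Ω)
    (E : ℂ) :
    LinearMap.trace ℂ (solutionSpace p q E) (floquetOperator hp hq E) = (Y E Ω).trace := by
  have h : floquetOperator hp hq E = (hY.solutionEquiv E).conj (Matrix.toLin' (Y E Ω)) := by
    ext1 y
    obtain ⟨v, rfl⟩ := (hY.solutionEquiv E).surjective y
    rw [LinearEquiv.conj_apply_apply, LinearEquiv.symm_apply_apply]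
    ext1; funext x
    change (Y E (x + Ω)).mulVec v = (Y E x).mulVec (Matrix.toLin' (Y E Ω) v)
    rw [hY.add_period hp hq, Matrix.toLin'_apply, Matrix.mulVec_mulVec]
  rw [h, LinearMap.trace_conj', Matrix.trace_toLin'_eq]

theorem monodromy_eq {Ω : ℝ} (hp : Function.Periodic p Ω) (hq : Function.Periodic q Ω)
    (E : ℂ) (x : ℝ) : monodromy Y Ω E x = Y E (x + Ω) * (Y E x).adjugate := by
  rw [monodromy, hY.add_period hp hq]

theorem trace_monodromy {Ω : ℝ} (E : ℂ) (x : ℝ) :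
    monodromy Y Ω E x 0 0 + monodromy Y Ω E x 1 1 = (Y E Ω).trace := by
  rw [← Matrix.trace_fin_two, monodromy, Matrix.trace_mul_cycle, hY.adjugate_mul, one_mul]

theorem det_monodromy {Ω : ℝ} (E : ℂ) (x : ℝ) : (monodromy Y Ω E x).det = 1 := by
  rw [monodromy, Matrix.det_mul, Matrix.det_mul, Matrix.det_adjugate, hY.det, hY.det]
  simp

theorem discr_eq {Ω : ℝ} (hp : Function.Periodic p Ω) (hq : Function.Periodic q Ω) (E : ℂ)
    (x : ℝ) : discr hp hq E =
      4 * (((monodromy Y Ω E x 0 0 - monodromy Y Ω E x 1 1) / 2) ^ 2 +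
        monodromy Y Ω E x 0 1 * monodromy Y Ω E x 1 0) := by
  have h := hY.det_monodromy (Ω := Ω) E x
  rw [Matrix.det_fin_two] at h
  rw [discr, hY.trace_floquetOperator hp hq, ← hY.trace_monodromy E x]
  linear_combination (4 : ℂ) * h

theorem monodromy_entire (Ω x : ℝ) (i j : Fin 2) :
    Differentiable ℂ fun E => monodromy Y Ω E x i j := by
  have h := hY.entire
  simp only [monodromy, Matrix.adjugate_fin_two, Matrix.mul_apply, Fin.sum_univ_two]
  have h00 := h x 0 0
  have h01 := h x 0 1
  have h10 := h x 1 0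
  have h11 := h x 1 1
  have k00 := h Ω 0 0
  have k01 := h Ω 0 1
  have k10 := h Ω 1 0
  have k11 := h Ω 1 1
  fin_cases i <;> fin_cases j <;> simp <;> fun_prop

theorem trace_entire (Ω : ℝ) : Differentiable ℂ fun E => (Y E Ω).trace := by
  simp only [Matrix.trace_fin_two]
  exact (hY.entire _ _ _).add (hY.entire _ _ _)

/-- The three functions `F, G, H` built from the monodromy matrix satisfy the system
`F' = -2iEF - 2qG`, `G' = qH - pF`, `H' = 2iEH + 2pG`. -/
theorem hasDerivAt_monodromyF (Ω : ℝ) (E : ℂ) (x : ℝ) :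
    HasDerivAt (fun x => monodromy Y Ω E x 0 1)
      (-2 * Complex.I * E * monodromy Y Ω E x 0 1 -
        2 * q x * ((monodromy Y Ω E x 0 0 - monodromy Y Ω E x 1 1) / 2)) x := by
  have a := hY.d0 E x 0
  have b := hY.d0 E x 1
  simp only [monodromy, Matrix.adjugate_fin_two, Matrix.mul_apply, Fin.sum_univ_two]
  simp
  refine (((((a.mul_const (Y E Ω 0 0)).add (b.mul_const (Y E Ω 1 0))).mul b).neg).add
    (((a.mul_const (Y E Ω 0 1)).add (b.mul_const (Y E Ω 1 1))).mul a)).congr_deriv ?_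
  simp only [Pi.add_apply]
  ring

theorem hasDerivAt_monodromyH (Ω : ℝ) (E : ℂ) (x : ℝ) :
    HasDerivAt (fun x => monodromy Y Ω E x 1 0)
      (2 * Complex.I * E * monodromy Y Ω E x 1 0 +
        2 * p x * ((monodromy Y Ω E x 0 0 - monodromy Y Ω E x 1 1) / 2)) x := by
  have a := hY.d1 E x 0
  have b := hY.d1 E x 1
  simp only [monodromy, Matrix.adjugate_fin_two, Matrix.mul_apply, Fin.sum_univ_two]
  simp
  refine ((((a.mul_const (Y E Ω 0 0)).add (b.mul_const (Y E Ω 1 0))).mul b).add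
    ((((a.mul_const (Y E Ω 0 1)).add (b.mul_const (Y E Ω 1 1))).mul a).neg)).congr_deriv ?_
  simp only [Pi.add_apply]
  ring

theorem hasDerivAt_monodromyG (Ω : ℝ) (E : ℂ) (x : ℝ) :
    HasDerivAt (fun x => (monodromy Y Ω E x 0 0 - monodromy Y Ω E x 1 1) / 2)
      (q x * monodromy Y Ω E x 1 0 - p x * monodromy Y Ω E x 0 1) x := by
  have a := hY.d0 E x 0
  have b := hY.d0 E x 1
  have c := hY.d1 E x 0
  have d := hY.d1 E x 1
  simp only [monodromy, Matrix.adjugate_fin_two, Matrix.mul_apply, Fin.sum_univ_two]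
  simp
  refine ((((((a.mul_const (Y E Ω 0 0)).add (b.mul_const (Y E Ω 1 0))).mul d).add
    ((((a.mul_const (Y E Ω 0 1)).add (b.mul_const (Y E Ω 1 1))).mul c).neg)).sub
    (((((c.mul_const (Y E Ω 0 0)).add (d.mul_const (Y E Ω 1 0))).mul b).neg).add
    (((c.mul_const (Y E Ω 0 1)).add (d.mul_const (Y E Ω 1 1))).mul a))).div_const 2).congr_deriv ?_
  simp only [Pi.add_apply]
  ring

end IsFundamental

/-! ### Floquet theory of the conditional stability set -/

theorem eq_zero_of_forall_pow_mul_le {r a C : ℝ} (hr : 1 < r) (ha : 0 ≤ a)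
    (h : ∀ n : ℕ, r ^ n * a ≤ C) : a = 0 := by
  by_contra hne
  have hpos : 0 < a := lt_of_le_of_ne ha (Ne.symm hne)
  obtain ⟨n, hn⟩ := pow_unbounded_of_one_lt (C / a) hr
  have := h n
  rw [div_lt_iff₀ hpos] at hn
  linarith

theorem exists_norm_eq_one_of_mem_Icc {t : ℝ} (ht : t ∈ Icc (-2 : ℝ) 2) :
    ∃ μ : ℂ, ‖μ‖ = 1 ∧ μ ^ 2 - t * μ + 1 = 0 := by
  have h0 : 0 ≤ 1 - t ^ 2 / 4 := by nlinarith [ht.1, ht.2]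
  set s := Real.sqrt (1 - t ^ 2 / 4)
  have hs : s ^ 2 = 1 - t ^ 2 / 4 := Real.sq_sqrt h0
  refine ⟨⟨t / 2, s⟩, ?_, ?_⟩
  · have : ‖(⟨t / 2, s⟩ : ℂ)‖ ^ 2 = 1 := by
      rw [Complex.sq_norm, Complex.normSq_mk]
      nlinarith
    nlinarith [norm_nonneg (⟨t / 2, s⟩ : ℂ)]
  · apply Complex.ext
    · simp [pow_two]; nlinarith
    · simp [pow_two]; ring

theorem exists_root_one_le_norm (τ : ℂ) : ∃ μ : ℂ, 1 ≤ ‖μ‖ ∧ μ ^ 2 - τ * μ + 1 = 0 := by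
  obtain ⟨s, hs⟩ := IsAlgClosed.exists_pow_nat_eq (τ ^ 2 - 4) (n := 2) (by norm_num)
  have h1 : ((τ + s) / 2) ^ 2 - τ * ((τ + s) / 2) + 1 = 0 := by linear_combination hs / 4
  have h2 : ((τ - s) / 2) ^ 2 - τ * ((τ - s) / 2) + 1 = 0 := by linear_combination hs / 4
  have h3 : ((τ + s) / 2) * ((τ - s) / 2) = 1 := by linear_combination -hs / 4
  by_cases h : 1 ≤ ‖(τ + s) / 2‖
  · exact ⟨_, h, h1⟩
  · refine ⟨_, ?_, h2⟩
    have h4 : ‖(τ + s) / 2‖ * ‖(τ - s) / 2‖ = 1 := by rw [← norm_mul, h3, norm_one]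
    push Not at h
    nlinarith [norm_nonneg ((τ - s) / 2), norm_nonneg ((τ + s) / 2)]

/-- Floquet theory: a nonzero bounded solution exists if and only if a Floquet multiplier has modulus
one. As the two multipliers have product one, this means that their sum lies in `[-2, 2]`. -/
theorem IsFundamental.mem_stabilitySet_iff {p q : ℝ → ℂ} {Y : ℂ → ℝ → Matrix (Fin 2) (Fin 2) ℂ}
    (hY : IsFundamental p q Y) {Ω : ℝ} (hΩ : 0 < Ω) (hp : Function.Periodic p Ω)
    (hq : Function.Periodic q Ω) {E : ℂ} :
    E ∈ stabilitySet p q ↔ ∃ t ∈ Icc (-2 : ℝ) 2, (Y E Ω).trace = t := by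
  have hdet := hY.wronskian E Ω
  constructor
  · rintro ⟨y, hy, hne, C, hC⟩
    have hsys : ∀ x, y (x + Ω + Ω) - (Y E Ω).trace • y (x + Ω) + y x = 0 := by
      intro x
      have e : ∀ x, y x = (Y E x).mulVec (y 0) := fun x => by
        have := hY.eq_mulVec (mem_solutionSpace_iff.1 hy) x 0
        simpa [hY.init] using this
      rw [e (x + Ω + Ω), e (x + Ω), e x, hY.add_period hp hq, hY.add_period hp hq,
        Matrix.mul_assoc, ← Matrix.mulVec_mulVec, ← Matrix.mulVec_mulVec _ (Y E x) (Y E Ω),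
        ← Matrix.mulVec_smul, ← Matrix.mulVec_sub, ← Matrix.mulVec_add]
      have : (Y E Ω * Y E Ω).mulVec (y 0) - (Y E Ω).trace • (Y E Ω).mulVec (y 0) + y 0 = 0 := by
        ext i
        fin_cases i
        · simp [Matrix.trace_fin_two, Matrix.mul_apply, Fin.sum_univ_two]
          linear_combination -(y 0 0) * hdet
        · simp [Matrix.trace_fin_two, Matrix.mul_apply, Fin.sum_univ_two]
          linear_combination -(y 0 1) * hdet
      rw [this, Matrix.mulVec_zero]
    obtain ⟨μ, hμ1, hμ⟩ := exists_root_one_le_norm (Y E Ω).trace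
    have hμ0 : μ ≠ 0 := by
      rintro rfl
      norm_num at hμ1
    have hτ : (Y E Ω).trace = μ + μ⁻¹ := by
      field_simp
      linear_combination -hμ
    rcases hμ1.eq_or_lt with h1 | h1
    · have hconj : μ⁻¹ = (starRingEnd ℂ) μ := by
        rw [Complex.inv_def, Complex.normSq_eq_norm_sq, ← h1]
        simp
      refine ⟨2 * μ.re, ?_, ?_⟩
      · have := abs_le.1 (Complex.abs_re_le_norm μ)
        constructor <;> linarith [this.1, this.2]
      · rw [hτ, hconj, Complex.add_conj]
    · exfalso
      -- A bounded solution has no component along the growing or the decaying Floquet solution.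
      have hw : ∀ x, y (x + Ω) = μ⁻¹ • y x := by
        intro x
        have hrec : ∀ n : ℕ, y (x + n * Ω + Ω) - μ⁻¹ • y (x + n * Ω) =
            μ ^ n • (y (x + Ω) - μ⁻¹ • y x) := by
          intro n
          induction n with
          | zero => simp
          | succ n ih =>
            have e1 : x + ((n + 1 : ℕ) : ℝ) * Ω = x + n * Ω + Ω := by push_cast; ring
            have h := hsys (x + n * Ω)
            rw [hτ] at h
            have h' : y (x + n * Ω + Ω + Ω) =
                (μ + μ⁻¹) • y (x + n * Ω + Ω) - y (x + n * Ω) := by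
              rw [← sub_eq_zero, ← h]
              abel
            rw [e1, pow_succ', mul_smul, ← ih, h', smul_sub, smul_smul, mul_inv_cancel₀ hμ0,
              add_smul, one_smul]
            abel
        have h0 : ‖y (x + Ω) - μ⁻¹ • y x‖ = 0 := by
          refine eq_zero_of_forall_pow_mul_le h1 (norm_nonneg _) (C := C + ‖μ⁻¹‖ * C) fun n => ?_
          rw [← norm_pow, ← norm_smul, ← hrec n]
          refine (norm_sub_le _ _).trans ?_
          rw [norm_smul]
          gcongr
          · exact hC _
          · exact hC _
        exact sub_eq_zero.1 (norm_eq_zero.1 h0)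
      refine hne (funext fun x => ?_)
      have hrec : ∀ n : ℕ, y (x - n * Ω) = μ ^ n • y x := by
        intro n
        induction n with
        | zero => simp
        | succ n ih =>
          have e1 : x - ((n + 1 : ℕ) : ℝ) * Ω + Ω = x - n * Ω := by push_cast; ring
          have h := hw (x - ((n + 1 : ℕ) : ℝ) * Ω)
          rw [e1, ih] at h
          rw [pow_succ', mul_smul, h, smul_smul, mul_inv_cancel₀ hμ0, one_smul]
      have h0 : ‖y x‖ = 0 := by
        refine eq_zero_of_forall_pow_mul_le h1 (norm_nonneg _) (C := C) fun n => ?_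
        rw [← norm_pow, ← norm_smul, ← hrec n]
        exact hC _
      simpa using h0
  · rintro ⟨t, ht, hτ⟩
    obtain ⟨μ, hμ1, hμ⟩ := exists_norm_eq_one_of_mem_Icc ht
    have hsing : (Y E Ω - μ • (1 : Matrix (Fin 2) (Fin 2) ℂ)).det = 0 := by
      rw [Matrix.trace_fin_two] at hτ
      rw [Matrix.det_fin_two]
      simp
      linear_combination hdet + hμ - μ * hτ
    obtain ⟨v, hv0, hv⟩ := Matrix.exists_mulVec_eq_zero_iff.2 hsing
    rw [Matrix.sub_mulVec, Matrix.smul_mulVec, Matrix.one_mulVec, sub_eq_zero] at hv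
    set y : VecFun := fun x => (Y E x).mulVec v
    have hy : y ∈ solutionSpace p q E := hY.mulVec_mem_solutionSpace E v
    refine ⟨y, hy, fun h => hv0 ?_, ?_⟩
    · have h' : (Y E 0).mulVec v = 0 := congrFun h 0
      rwa [hY.init, Matrix.one_mulVec] at h'
    · have hper : Function.Periodic (fun x => ‖y x‖) Ω := by
        intro x
        simp only [y]
        rw [hY.add_period hp hq, ← Matrix.mulVec_mulVec, hv, Matrix.mulVec_smul, norm_smul, hμ1,
          one_mul]
      obtain ⟨C, hC⟩ := (isCompact_Icc (a := (0 : ℝ)) (b := Ω)).exists_bound_of_continuousOn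
        hy.1.continuous.continuousOn
      refine ⟨C, fun x => ?_⟩
      obtain ⟨z, hz, hxz⟩ := hper.exists_mem_Ico₀ hΩ x
      have : ‖y x‖ = ‖y z‖ := hxz
      rw [this]
      exact hC z (Ico_subset_Icc_self hz)

/-! ### Asymptotics of the monodromy matrix for large spectral parameter -/

/-- A perturbed exponential: the variation of constants bound for `z' = c z + r`. -/
theorem norm_sub_exp_mul_le {z r : ℝ → ℂ} {c : ℂ} {a b m ρ : ℝ} (hab : a ≤ b)
    (hz : ∀ x ∈ Icc a b, HasDerivAt z (c * z x + r x) x) (hm : |c.re| ≤ m) (hρ : 0 ≤ ρ)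
    (hr : ∀ x ∈ Icc a b, ‖r x‖ ≤ ρ * Real.exp (m * (x - a))) :
    ‖z b - Complex.exp (c * (b - a)) * z a‖ ≤ ρ * (b - a) * Real.exp (m * (b - a)) := by
  set w : ℝ → ℂ := fun x => Complex.exp (-c * (x - a)) * z x
  have hw : ∀ x ∈ Icc a b, HasDerivAt w (Complex.exp (-c * (x - a)) * r x) x := by
    intro x hx
    have h1 : HasDerivAt (fun x : ℝ => -c * ((x : ℂ) - a)) (-c * 1) x :=
      ((Complex.ofRealCLM.hasDerivAt (x := x)).sub_const (a : ℂ)).const_mul (-c)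
    refine (h1.cexp.mul (hz x hx)).congr_deriv ?_
    ring
  have hb : ∀ x ∈ Icc a b, ‖Complex.exp (-c * (x - a)) * r x‖ ≤
      ρ * Real.exp ((m - c.re) * (b - a)) := by
    intro x hx
    have e1 : (-c * ((x : ℂ) - a)).re = -c.re * (x - a) := by
      rw [← Complex.ofReal_sub, Complex.mul_re]
      simp
    rw [norm_mul, Complex.norm_exp, e1]
    calc _ ≤ Real.exp (-c.re * (x - a)) * (ρ * Real.exp (m * (x - a))) := by
          gcongr
          exact hr x hx
      _ = ρ * Real.exp ((m - c.re) * (x - a)) := by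
          rw [mul_left_comm, ← Real.exp_add]
          ring_nf
      _ ≤ _ := by
          have : 0 ≤ m - c.re := by linarith [le_abs_self c.re]
          gcongr
          exact hx.2
  have hmv := (convex_Icc a b).norm_image_sub_le_of_norm_hasDerivWithin_le
    (fun x hx => (hw x hx).hasDerivWithinAt) hb (left_mem_Icc.2 hab) (right_mem_Icc.2 hab)
  have e2 : z b - Complex.exp (c * (b - a)) * z a =
      Complex.exp (c * (b - a)) * (w b - w a) := by
    simp only [w, sub_self, Complex.exp_zero, one_mul, mul_sub, ← mul_assoc]
    rw [← Complex.exp_add]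
    simp
  have e3 : (c * ((b : ℂ) - a)).re = c.re * (b - a) := by
    rw [← Complex.ofReal_sub, Complex.mul_re]
    simp
  rw [e2, norm_mul, Complex.norm_exp, e3]
  calc _ ≤ Real.exp (c.re * (b - a)) * (ρ * Real.exp ((m - c.re) * (b - a)) * ‖b - a‖) := by
        gcongr
    _ = ρ * (b - a) * (Real.exp (c.re * (b - a)) * Real.exp ((m - c.re) * (b - a))) := by
        rw [Real.norm_of_nonneg (by linarith)]
        ring
    _ = _ := by
        rw [← Real.exp_add]
        ring_nf

/-- Energy estimate for a diagonal system with a small perturbation. -/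
theorem norm_add_norm_le_of_hasDerivAt {z₀ z₁ r₀ r₁ : ℝ → ℂ} {c : ℂ} {a b m ε : ℝ}
    (h0 : ∀ x ∈ Icc a b, HasDerivAt z₀ (c * z₀ x + r₀ x) x)
    (h1 : ∀ x ∈ Icc a b, HasDerivAt z₁ (-c * z₁ x + r₁ x) x) (hm : |c.re| ≤ m)
    (hr0 : ∀ x ∈ Icc a b, ‖r₀ x‖ ≤ ε * (‖z₀ x‖ + ‖z₁ x‖))
    (hr1 : ∀ x ∈ Icc a b, ‖r₁ x‖ ≤ ε * (‖z₀ x‖ + ‖z₁ x‖)) (hε : 0 ≤ ε) :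
    ∀ x ∈ Icc a b, ‖z₀ x‖ + ‖z₁ x‖ ≤
      2 * (‖z₀ a‖ + ‖z₁ a‖) * Real.exp ((m + 2 * ε) * (x - a)) := by
  intro x hx
  set κ := 2 * (m + 2 * ε)
  have hd : ∀ x ∈ Icc a b, HasDerivAt
      (fun x => (‖z₀ x‖ ^ 2 + ‖z₁ x‖ ^ 2) * Real.exp (-κ * (x - a)))
      ((2 * inner ℝ (z₀ x) (c * z₀ x + r₀ x) + 2 * inner ℝ (z₁ x) (-c * z₁ x + r₁ x)) *
        Real.exp (-κ * (x - a)) +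
        (‖z₀ x‖ ^ 2 + ‖z₁ x‖ ^ 2) * (Real.exp (-κ * (x - a)) * (-κ))) x := by
    intro x hx
    have h2 : HasDerivAt (fun x : ℝ => -κ * (x - a)) (-κ) x := by
      simpa using ((hasDerivAt_id x).sub_const a).const_mul (-κ)
    exact (((h0 x hx).norm_sq).add ((h1 x hx).norm_sq)).mul h2.exp
  have hin : ∀ (z r c : ℂ), |c.re| ≤ m →
      2 * inner ℝ z (c * z + r) ≤ 2 * m * ‖z‖ ^ 2 + 2 * ‖z‖ * ‖r‖ := by
    intro z r c hc
    have e1 : inner ℝ z (c * z) = c.re * ‖z‖ ^ 2 := by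
      rw [Complex.inner, Complex.sq_norm, Complex.normSq_apply]
      simp
      ring
    rw [inner_add_right, e1]
    have := real_inner_le_norm z r
    have h3 : c.re * ‖z‖ ^ 2 ≤ m * ‖z‖ ^ 2 :=
      mul_le_mul_of_nonneg_right ((le_abs_self _).trans hc) (sq_nonneg _)
    nlinarith
  have hanti : AntitoneOn (fun x => (‖z₀ x‖ ^ 2 + ‖z₁ x‖ ^ 2) * Real.exp (-κ * (x - a)))
      (Icc a b) := by
    refine antitoneOn_of_deriv_nonpos (convex_Icc a b)
      (fun x hx => (hd x hx).continuousAt.continuousWithinAt)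
      (fun x hx => (hd x (interior_subset hx)).differentiableAt.differentiableWithinAt) ?_
    intro x hx
    have hx' := interior_subset hx
    rw [(hd x hx').deriv]
    have i0 := hin (z₀ x) (r₀ x) c hm
    have i1 := hin (z₁ x) (r₁ x) (-c) (by simpa using hm)
    have k0 := mul_le_mul_of_nonneg_left (hr0 x hx') (norm_nonneg (z₀ x))
    have k1 := mul_le_mul_of_nonneg_left (hr1 x hx') (norm_nonneg (z₁ x))
    have k2 : 0 ≤ ε * (‖z₀ x‖ - ‖z₁ x‖) ^ 2 := by positivity
    have key : (2 * inner ℝ (z₀ x) (c * z₀ x + r₀ x) + 2 * inner ℝ (z₁ x) (-c * z₁ x + r₁ x)) -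
        κ * (‖z₀ x‖ ^ 2 + ‖z₁ x‖ ^ 2) ≤ 0 := by
      simp only [κ]
      nlinarith
    have := mul_nonpos_of_nonpos_of_nonneg key (Real.exp_pos (-κ * (x - a))).le
    linarith
  have hle := hanti (left_mem_Icc.2 (hx.1.trans hx.2)) hx hx.1
  simp only [sub_self, mul_zero, Real.exp_zero, mul_one] at hle
  rw [neg_mul, Real.exp_neg, ← div_eq_mul_inv, div_le_iff₀ (Real.exp_pos _)] at hle
  have e2 : Real.exp (κ * (x - a)) = Real.exp ((m + 2 * ε) * (x - a)) ^ 2 := by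
    rw [← Real.exp_nat_mul]
    simp only [κ]
    push_cast
    ring_nf
  rw [e2] at hle
  set X := Real.exp ((m + 2 * ε) * (x - a))
  refine abs_le_of_sq_le_sq' ?_ (by positivity) |>.2
  have s1 : (‖z₀ x‖ + ‖z₁ x‖) ^ 2 ≤ 2 * (‖z₀ x‖ ^ 2 + ‖z₁ x‖ ^ 2) := by
    nlinarith [sq_nonneg (‖z₀ x‖ - ‖z₁ x‖)]
  have s2 : (‖z₀ a‖ ^ 2 + ‖z₁ a‖ ^ 2) * X ^ 2 ≤ (‖z₀ a‖ + ‖z₁ a‖) ^ 2 * X ^ 2 := by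
    refine mul_le_mul_of_nonneg_right ?_ (sq_nonneg _)
    nlinarith [mul_nonneg (norm_nonneg (z₀ a)) (norm_nonneg (z₁ a))]
  have s3 : 0 ≤ (‖z₀ a‖ + ‖z₁ a‖) ^ 2 * X ^ 2 := by positivity
  calc _ ≤ _ := s1
    _ ≤ 2 * ((‖z₀ a‖ + ‖z₁ a‖) ^ 2 * X ^ 2) := by linarith
    _ ≤ _ := by nlinarith

/-- Solutions of the first order system for large `E`. The gauge transformation
`z = (1 + K / E) y` with `K = (i / 2) !![0, q; -p, 0]` removes the off-diagonal terms up to an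
error of order `1 / E`. -/
theorem exists_solution_asymptotics {p q : ℝ → ℂ} (hpC : ContDiff ℝ 1 p) (hqC : ContDiff ℝ 1 q)
    {a b : ℝ} (hab : a ≤ b) :
    ∃ C R : ℝ, 0 < C ∧ 1 ≤ R ∧ ∀ E : ℂ, R ≤ ‖E‖ → ∀ y₀ y₁ : ℝ → ℂ,
      (∀ x, HasDerivAt y₀ (-Complex.I * E * y₀ x + q x * y₁ x) x) →
      (∀ x, HasDerivAt y₁ (p x * y₀ x + Complex.I * E * y₁ x) x) →
      ‖y₀ a‖ + ‖y₁ a‖ ≤ 1 →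
      ‖y₀ b - Complex.exp (-Complex.I * E * (b - a)) * y₀ a‖ ≤
        C / ‖E‖ * Real.exp (|E.im| * (b - a)) ∧
      ‖y₁ b - Complex.exp (Complex.I * E * (b - a)) * y₁ a‖ ≤
        C / ‖E‖ * Real.exp (|E.im| * (b - a)) := by
  have hp' : Continuous (deriv p) := hpC.continuous_deriv le_rfl
  have hq' : Continuous (deriv q) := hqC.continuous_deriv le_rfl
  have hpd : ∀ x, HasDerivAt p (deriv p x) x :=
    fun x => (hpC.differentiable one_ne_zero x).hasDerivAt
  have hqd : ∀ x, HasDerivAt q (deriv q x) x :=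
    fun x => (hqC.differentiable one_ne_zero x).hasDerivAt
  obtain ⟨B, hB⟩ := (isCompact_Icc (a := a) (b := b)).exists_bound_of_continuousOn
    (f := fun x => (‖p x‖ + ‖q x‖ + ‖deriv p x‖ + ‖deriv q x‖ + ‖p x‖ * ‖q x‖ : ℝ))
    (by have := hpC.continuous; have := hqC.continuous; fun_prop)
  have hBn : ∀ x ∈ Icc a b,
      ‖p x‖ + ‖q x‖ + ‖deriv p x‖ + ‖deriv q x‖ + ‖p x‖ * ‖q x‖ ≤ B := by
    intro x hx
    have := hB x hx
    rwa [Real.norm_of_nonneg (by positivity)] at this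
  have hB0 : 0 ≤ B := (norm_nonneg _).trans (hB a (left_mem_Icc.2 hab))
  set ℓ := b - a
  have hℓ : 0 ≤ ℓ := sub_nonneg.2 hab
  set C₁ := 4 * Real.exp (4 * B * ℓ)
  have hC₁ : 0 < C₁ := by positivity
  have hC₁1 : 1 ≤ C₁ := by
    have : 1 ≤ Real.exp (4 * B * ℓ) := Real.one_le_exp (by positivity)
    simp only [C₁]
    linarith
  refine ⟨2 * B * C₁ * ℓ + 4 * B * C₁ + 1, 2 * B + 1, by positivity, by linarith,
    fun E hE y₀ y₁ h0 h1 hinit => ?_⟩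
  have hE1 : 1 ≤ ‖E‖ := by linarith
  have hEpos : 0 < ‖E‖ := by linarith
  have hE0 : E ≠ 0 := norm_pos_iff.1 hEpos
  have hI : Complex.I * Complex.I = -1 := Complex.I_mul_I
  set z₀ : ℝ → ℂ := fun x => y₀ x + Complex.I / 2 / E * (q x * y₁ x)
  set z₁ : ℝ → ℂ := fun x => y₁ x - Complex.I / 2 / E * (p x * y₀ x)
  set r₀ : ℝ → ℂ := fun x => Complex.I / 2 / E * (deriv q x * y₁ x + q x * p x * y₀ x)
  set r₁ : ℝ → ℂ := fun x => -(Complex.I / 2 / E) * (deriv p x * y₀ x + p x * q x * y₁ x)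
  have hz0 : ∀ x, HasDerivAt z₀ (-Complex.I * E * z₀ x + r₀ x) x := by
    intro x
    refine ((h0 x).add (((hqd x).mul (h1 x)).const_mul (Complex.I / 2 / E))).congr_deriv ?_
    simp only [z₀, r₀]
    field_simp
    linear_combination (2 * q x * y₁ x * E) * hI
  have hz1 : ∀ x, HasDerivAt z₁ (-(-Complex.I * E) * z₁ x + r₁ x) x := by
    intro x
    refine ((h1 x).sub (((hpd x).mul (h0 x)).const_mul (Complex.I / 2 / E))).congr_deriv ?_
    simp only [z₁, r₁]
    field_simp
    linear_combination (2 * p x * y₀ x * E) * hI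
  have hIn : ‖Complex.I / 2 / E‖ = 1 / 2 / ‖E‖ := by simp
  set s : ℝ → ℝ := fun x => ‖y₀ x‖ + ‖y₁ x‖
  have hs0 : ∀ x, 0 ≤ s x := fun x => by positivity
  have hcorr : ∀ x ∈ Icc a b, ‖Complex.I / 2 / E * (q x * y₁ x)‖ ≤ 1 / 2 / ‖E‖ * (B * ‖y₁ x‖) ∧
      ‖Complex.I / 2 / E * (p x * y₀ x)‖ ≤ 1 / 2 / ‖E‖ * (B * ‖y₀ x‖) := by
    intro x hx
    have hb := hBn x hx
    have n1 := norm_nonneg (p x)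
    have n2 := norm_nonneg (q x)
    have n3 := norm_nonneg (deriv p x)
    have n4 := norm_nonneg (deriv q x)
    have n5 := mul_nonneg n1 n2
    constructor
    · rw [norm_mul, norm_mul, hIn]
      gcongr
      linarith
    · rw [norm_mul, norm_mul, hIn]
      gcongr
      linarith
  have hhalf : 1 / 2 / ‖E‖ * B ≤ 1 / 4 := by
    rw [div_mul_eq_mul_div, div_le_iff₀ hEpos]
    linarith
  have hyz : ∀ x ∈ Icc a b, s x ≤ 2 * (‖z₀ x‖ + ‖z₁ x‖) := by
    intro x hx
    obtain ⟨c0, c1⟩ := hcorr x hx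
    have t0 : ‖y₀ x‖ ≤ ‖z₀ x‖ + ‖Complex.I / 2 / E * (q x * y₁ x)‖ := by
      have : y₀ x = z₀ x - Complex.I / 2 / E * (q x * y₁ x) := by simp [z₀]
      conv_lhs => rw [this]
      exact norm_sub_le _ _
    have t1 : ‖y₁ x‖ ≤ ‖z₁ x‖ + ‖Complex.I / 2 / E * (p x * y₀ x)‖ := by
      have : y₁ x = z₁ x + Complex.I / 2 / E * (p x * y₀ x) := by simp [z₁]
      conv_lhs => rw [this]
      exact norm_add_le _ _
    have m0 := mul_le_mul_of_nonneg_right hhalf (norm_nonneg (y₀ x))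
    have m1 := mul_le_mul_of_nonneg_right hhalf (norm_nonneg (y₁ x))
    simp only [s]
    nlinarith [norm_nonneg (z₀ x), norm_nonneg (z₁ x)]
  have hzy : ‖z₀ a‖ + ‖z₁ a‖ ≤ 2 := by
    obtain ⟨c0, c1⟩ := hcorr a (left_mem_Icc.2 hab)
    have t0 : ‖z₀ a‖ ≤ ‖y₀ a‖ + ‖Complex.I / 2 / E * (q a * y₁ a)‖ := norm_add_le _ _
    have t1 : ‖z₁ a‖ ≤ ‖y₁ a‖ + ‖Complex.I / 2 / E * (p a * y₀ a)‖ := norm_sub_le _ _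
    have m0 := mul_le_mul_of_nonneg_right hhalf (norm_nonneg (y₀ a))
    have m1 := mul_le_mul_of_nonneg_right hhalf (norm_nonneg (y₁ a))
    nlinarith [norm_nonneg (y₀ a), norm_nonneg (y₁ a)]
  have hrs : ∀ x ∈ Icc a b, ‖r₀ x‖ ≤ 1 / 2 / ‖E‖ * (B * s x) ∧
      ‖r₁ x‖ ≤ 1 / 2 / ‖E‖ * (B * s x) := by
    intro x hx
    have hb := hBn x hx
    have n1 := norm_nonneg (p x)
    have n2 := norm_nonneg (q x)
    have n3 := norm_nonneg (deriv p x)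
    have n4 := norm_nonneg (deriv q x)
    have n5 := mul_nonneg n1 n2
    have n6 := norm_nonneg (y₀ x)
    have n7 := norm_nonneg (y₁ x)
    constructor
    · simp only [r₀]
      rw [norm_mul, hIn]
      gcongr
      refine (norm_add_le _ _).trans ?_
      rw [norm_mul, norm_mul, norm_mul]
      simp only [s]
      nlinarith
    · simp only [r₁]
      rw [norm_mul, norm_neg, hIn]
      gcongr
      refine (norm_add_le _ _).trans ?_
      rw [norm_mul, norm_mul, norm_mul]
      simp only [s]
      nlinarith
  have hre : |(-Complex.I * E).re| ≤ |E.im| := by simp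
  have hre' : |(-(-Complex.I * E)).re| ≤ |E.im| := by simp
  have hrz : ∀ x ∈ Icc a b, 1 / 2 / ‖E‖ * (B * s x) ≤ B / ‖E‖ * (‖z₀ x‖ + ‖z₁ x‖) := by
    intro x hx
    have := hyz x hx
    calc _ ≤ 1 / 2 / ‖E‖ * (B * (2 * (‖z₀ x‖ + ‖z₁ x‖))) := by gcongr
      _ = _ := by ring
  have hBE : B / ‖E‖ ≤ B := div_le_self hB0 hE1
  have hz : ∀ x ∈ Icc a b, ‖z₀ x‖ + ‖z₁ x‖ ≤ C₁ * Real.exp (|E.im| * (x - a)) := by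
    intro x hx
    refine (norm_add_norm_le_of_hasDerivAt (fun x _ => hz0 x) (fun x _ => hz1 x) hre
      (fun x hx => ((hrs x hx).1.trans (hrz x hx))) (fun x hx => ((hrs x hx).2.trans (hrz x hx)))
      (by positivity) x hx).trans ?_
    have hxa : 0 ≤ x - a := by linarith [hx.1]
    have e1 : (|E.im| + 2 * (B / ‖E‖)) * (x - a) ≤ 4 * B * ℓ + |E.im| * (x - a) := by
      have : B / ‖E‖ * (x - a) ≤ B * ℓ := by
        have : x - a ≤ ℓ := by simp only [ℓ]; linarith [hx.2]
        gcongr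
      nlinarith [mul_nonneg hB0 hℓ]
    calc _ ≤ 2 * 2 * Real.exp (4 * B * ℓ + |E.im| * (x - a)) := by gcongr
      _ = _ := by rw [Real.exp_add]; simp only [C₁]; ring
  have hr : ∀ x ∈ Icc a b, 1 / 2 / ‖E‖ * (B * s x) ≤
      B * C₁ / ‖E‖ * Real.exp (|E.im| * (x - a)) := by
    intro x hx
    refine (hrz x hx).trans ?_
    calc _ ≤ B / ‖E‖ * (C₁ * Real.exp (|E.im| * (x - a))) := by gcongr; exact hz x hx
      _ = _ := by ring
  have hρ : 0 ≤ B * C₁ / ‖E‖ := by positivity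
  have k0 := norm_sub_exp_mul_le hab (fun x _ => hz0 x) hre hρ
    (fun x hx => (hrs x hx).1.trans (hr x hx))
  have k1 := norm_sub_exp_mul_le hab (fun x _ => hz1 x) hre' hρ
    (fun x hx => (hrs x hx).2.trans (hr x hx))
  have hb : b ∈ Icc a b := right_mem_Icc.2 hab
  have ha : a ∈ Icc a b := left_mem_Icc.2 hab
  set X := Real.exp (|E.im| * ℓ)
  have hX1 : 1 ≤ X := Real.one_le_exp (by positivity)
  have hexp : ∀ c : ℂ, |c.re| ≤ |E.im| → ‖Complex.exp (c * ((b : ℂ) - a))‖ ≤ X := by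
    intro c hc
    rw [Complex.norm_exp, ← Complex.ofReal_sub, Complex.mul_re]
    simp only [Complex.ofReal_re, Complex.ofReal_im, mul_zero, sub_zero]
    exact Real.exp_le_exp.2 (mul_le_mul_of_nonneg_right ((le_abs_self _).trans hc) hℓ)
  have hsb : s b ≤ 2 * C₁ * X := by
    have := hz b hb
    have := hyz b hb
    nlinarith
  have hcb : ∀ u : ℂ, ‖u‖ ≤ 1 / 2 / ‖E‖ * (B * s b) → ‖u‖ ≤ B * C₁ / ‖E‖ * X := by
    intro u hu
    refine hu.trans ?_
    calc _ ≤ 1 / 2 / ‖E‖ * (B * (2 * C₁ * X)) := by gcongr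
      _ = _ := by ring
  have hca : ∀ c u : ℂ, |c.re| ≤ |E.im| → ‖u‖ ≤ 1 / 2 / ‖E‖ * (B * s a) →
      ‖Complex.exp (c * ((b : ℂ) - a)) * u‖ ≤ B * C₁ / ‖E‖ * X := by
    intro c u hc hu
    rw [norm_mul]
    have hsa : s a ≤ 1 := hinit
    calc _ ≤ X * (1 / 2 / ‖E‖ * (B * 1)) := by
          have := hexp c hc
          have hu' := hu.trans (show _ ≤ 1 / 2 / ‖E‖ * (B * 1) by gcongr)
          gcongr
      _ = B * (1 / 2) / ‖E‖ * X := by ring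
      _ ≤ _ := by gcongr; linarith
  have hfin : B * C₁ / ‖E‖ * ℓ * X + B * C₁ / ‖E‖ * X + B * C₁ / ‖E‖ * X ≤
      (2 * B * C₁ * ℓ + 4 * B * C₁ + 1) / ‖E‖ * X := by
    have : B * C₁ / ‖E‖ * ℓ * X + B * C₁ / ‖E‖ * X + B * C₁ / ‖E‖ * X =
      (B * C₁ * ℓ + 2 * B * C₁) / ‖E‖ * X := by ring
    rw [this]
    refine mul_le_mul_of_nonneg_right (div_le_div_of_nonneg_right ?_ hEpos.le) (by positivity)
    nlinarith [mul_nonneg (mul_nonneg hB0 hC₁.le) hℓ, mul_nonneg hB0 hC₁.le]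
  have hle1 : ∀ x, ‖y₁ x‖ ≤ s x := fun x => le_add_of_nonneg_left (norm_nonneg _)
  have hle0 : ∀ x, ‖y₀ x‖ ≤ s x := fun x => le_add_of_nonneg_right (norm_nonneg _)
  constructor
  · have e : y₀ b - Complex.exp (-Complex.I * E * (b - a)) * y₀ a =
        (z₀ b - Complex.exp (-Complex.I * E * (b - a)) * z₀ a) -
        Complex.I / 2 / E * (q b * y₁ b) + Complex.exp (-Complex.I * E * (b - a)) *
          (Complex.I / 2 / E * (q a * y₁ a)) := by
      simp only [z₀]; ring
    rw [e]
    refine (norm_add_le _ _).trans ((add_le_add ((norm_sub_le _ _).trans (add_le_add k0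
      (hcb _ ((hcorr b hb).1.trans ?_)))) (hca _ _ hre ((hcorr a ha).1.trans ?_))).trans hfin)
    · have := hle1 b; gcongr
    · have := hle1 a; gcongr
  · have e : y₁ b - Complex.exp (Complex.I * E * (b - a)) * y₁ a =
        (z₁ b - Complex.exp (-(-Complex.I * E) * (b - a)) * z₁ a) +
        Complex.I / 2 / E * (p b * y₀ b) - Complex.exp (-(-Complex.I * E) * (b - a)) *
          (Complex.I / 2 / E * (p a * y₀ a)) := by
      simp only [z₁, neg_mul, neg_neg]; ring
    rw [e]
    refine (norm_sub_le _ _).trans ((add_le_add ((norm_add_le _ _).trans (add_le_add k1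
      (hcb _ ((hcorr b hb).2.trans ?_)))) (hca _ _ hre' ((hcorr a ha).2.trans ?_))).trans hfin)
    · have := hle0 b; gcongr
    · have := hle0 a; gcongr

/-- The monodromy matrix has exponential type `Ω`, and its trace is `2 cos (E Ω)` up to a relative
error of order `1 / E`. -/
theorem IsFundamental.exists_monodromy_asymptotics {p q : ℝ → ℂ}
    {Y : ℂ → ℝ → Matrix (Fin 2) (Fin 2) ℂ} (hY : IsFundamental p q Y)
    (hpC : ContDiff ℝ 1 p) (hqC : ContDiff ℝ 1 q) {Ω : ℝ} (hΩ : 0 < Ω)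
    (hp : Function.Periodic p Ω) (hq : Function.Periodic q Ω) (x₀ : ℝ) :
    ∃ C R : ℝ, 0 < C ∧ 1 ≤ R ∧ ∀ E : ℂ, R ≤ ‖E‖ →
      (∀ i j, ‖monodromy Y Ω E x₀ i j‖ ≤ C * Real.exp (|E.im| * Ω)) ∧
      ‖(Y E Ω).trace - 2 * Complex.cos (E * Ω)‖ ≤ C / ‖E‖ * Real.exp (|E.im| * Ω) := by
  obtain ⟨C, R, hC, hR, h⟩ := exists_solution_asymptotics hpC hqC
    (le_add_of_nonneg_right hΩ.le : x₀ ≤ x₀ + Ω)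
  refine ⟨2 * C + 1, R, by positivity, hR, fun E hE => ?_⟩
  have hEpos : 0 < ‖E‖ := by linarith
  have hE1 : 1 ≤ ‖E‖ := by linarith
  have hcol : ∀ j : Fin 2, ∃ y₀ y₁ : ℝ → ℂ,
      (∀ x, HasDerivAt y₀ (-Complex.I * E * y₀ x + q x * y₁ x) x) ∧
      (∀ x, HasDerivAt y₁ (p x * y₀ x + Complex.I * E * y₁ x) x) ∧
      y₀ x₀ = (1 : Matrix (Fin 2) (Fin 2) ℂ) 0 j ∧ y₁ x₀ = (1 : Matrix (Fin 2) (Fin 2) ℂ) 1 j ∧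
      y₀ (x₀ + Ω) = monodromy Y Ω E x₀ 0 j ∧ y₁ (x₀ + Ω) = monodromy Y Ω E x₀ 1 j := by
    intro j
    refine ⟨fun x => (Y E x * (Y E x₀).adjugate) 0 j, fun x => (Y E x * (Y E x₀).adjugate) 1 j,
      fun x => ?_, fun x => ?_, ?_, ?_, ?_, ?_⟩
    · simp only [Matrix.mul_apply, Fin.sum_univ_two]
      refine (((hY.d0 E x 0).mul_const _).add ((hY.d0 E x 1).mul_const _)).congr_deriv ?_
      ring
    · simp only [Matrix.mul_apply, Fin.sum_univ_two]
      refine (((hY.d1 E x 0).mul_const _).add ((hY.d1 E x 1).mul_const _)).congr_deriv ?_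
      ring
    · simp only [hY.mul_adjugate]
    · simp only [hY.mul_adjugate]
    · rw [hY.monodromy_eq hp hq]
    · rw [hY.monodromy_eq hp hq]
  have hΩc : ((x₀ + Ω : ℝ) : ℂ) - x₀ = Ω := by push_cast; ring
  have hest : ∀ j : Fin 2,
      ‖monodromy Y Ω E x₀ 0 j - Complex.exp (-Complex.I * E * Ω) *
        (1 : Matrix (Fin 2) (Fin 2) ℂ) 0 j‖ ≤ C / ‖E‖ * Real.exp (|E.im| * Ω) ∧
      ‖monodromy Y Ω E x₀ 1 j - Complex.exp (Complex.I * E * Ω) *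
        (1 : Matrix (Fin 2) (Fin 2) ℂ) 1 j‖ ≤ C / ‖E‖ * Real.exp (|E.im| * Ω) := by
    intro j
    obtain ⟨y₀, y₁, h0, h1, i0, i1, e0, e1⟩ := hcol j
    have hcolumn : ∀ j : Fin 2, ‖(1 : Matrix (Fin 2) (Fin 2) ℂ) 0 j‖ +
        ‖(1 : Matrix (Fin 2) (Fin 2) ℂ) 1 j‖ ≤ 1 := by simp [Fin.forall_fin_two]
    have := h E hE y₀ y₁ h0 h1 (by rw [i0, i1]; exact hcolumn j)
    rwa [hΩc, i0, i1, e0, e1, add_sub_cancel_left] at this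
  have hCE : C / ‖E‖ ≤ C := div_le_self hC.le hE1
  have hexp : ∀ c : ℂ, |c.re| ≤ |E.im| → ‖Complex.exp (c * Ω)‖ ≤ Real.exp (|E.im| * Ω) := by
    intro c hc
    rw [Complex.norm_exp, Complex.re_mul_ofReal]
    exact Real.exp_le_exp.2 (mul_le_mul_of_nonneg_right ((le_abs_self _).trans hc) hΩ.le)
  set X := Real.exp (|E.im| * Ω)
  have hX : 0 < X := Real.exp_pos _
  have hone : ∀ i j : Fin 2, ‖(1 : Matrix (Fin 2) (Fin 2) ℂ) i j‖ ≤ 1 := by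
    intro i j
    fin_cases i <;> fin_cases j <;> simp
  have hgen : ∀ (m e o : ℂ), ‖m - e * o‖ ≤ C / ‖E‖ * X → ‖e‖ ≤ X → ‖o‖ ≤ 1 →
      ‖m‖ ≤ (2 * C + 1) * X := by
    intro m e o h1 h2 h3
    have e1 : m = (m - e * o) + e * o := by ring
    rw [e1]
    refine (norm_add_le _ _).trans ?_
    rw [norm_mul]
    have k1 : C / ‖E‖ * X ≤ C * X := by gcongr
    have k2 : ‖e‖ * ‖o‖ ≤ X * 1 := by gcongr
    have k3 := mul_nonneg hC.le hX.le
    linarith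
  refine ⟨fun i j => ?_, ?_⟩
  · fin_cases i
    · exact hgen _ _ _ (hest j).1 (hexp _ (by simp)) (hone _ _)
    · exact hgen _ _ _ (hest j).2 (hexp _ (by simp)) (hone _ _)
  · have h00 := (hest 0).1
    have h11 := (hest 1).2
    simp only [Matrix.one_apply_eq, mul_one] at h00 h11
    have e1 : (Y E Ω).trace - 2 * Complex.cos (E * Ω) =
        (monodromy Y Ω E x₀ 0 0 - Complex.exp (-Complex.I * E * Ω)) +
        (monodromy Y Ω E x₀ 1 1 - Complex.exp (Complex.I * E * Ω)) := by
      rw [← hY.trace_monodromy E x₀, Complex.cos]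
      ring_nf
    rw [e1]
    refine (norm_add_le _ _).trans ((add_le_add h00 h11).trans ?_)
    have : C / ‖E‖ * X + C / ‖E‖ * X = 2 * C / ‖E‖ * X := by ring
    rw [this]
    gcongr
    linarith

/-! ### Entire functions of polynomial growth on a sequence of circles -/

/-- These circles pass midway between the zeros of the sine, which makes it comparable to its
maximal growth along them. -/
theorem exp_abs_im_le_norm_sin {k : ℕ} {z : ℂ} (hz : ‖z‖ = (k + 1 / 2) * Real.pi) :
    Real.exp |z.im| / 6 ≤ ‖Complex.sin z‖ := by
  rcases le_total 1 |z.im| with h | h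
  · have e1 : ‖Complex.exp (-z * Complex.I)‖ = Real.exp z.im := by
      rw [Complex.norm_exp]; simp
    have e2 : ‖Complex.exp (z * Complex.I)‖ = Real.exp (-z.im) := by
      rw [Complex.norm_exp]; simp
    have e3 : ‖Complex.sin z‖ =
        ‖Complex.exp (-z * Complex.I) - Complex.exp (z * Complex.I)‖ / 2 := by
      simp [Complex.sin]
    have e4 : |Real.exp z.im - Real.exp (-z.im)| ≤ 2 * ‖Complex.sin z‖ := by
      have := abs_norm_sub_norm_le (Complex.exp (-z * Complex.I)) (Complex.exp (z * Complex.I))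
      rw [e1, e2] at this
      linarith
    have e5 : |Real.exp z.im - Real.exp (-z.im)| = Real.exp |z.im| - Real.exp (-|z.im|) := by
      rcases le_total 0 z.im with h0 | h0
      · rw [abs_of_nonneg h0, abs_of_nonneg]
        have := Real.exp_le_exp.2 (show -z.im ≤ z.im by linarith)
        linarith
      · rw [abs_of_nonpos h0, abs_of_nonpos, neg_neg, neg_sub]
        have := Real.exp_le_exp.2 (show z.im ≤ -z.im by linarith)
        linarith
    have e6 : Real.exp (-|z.im|) ≤ 1 := Real.exp_le_one_iff.2 (by linarith)
    have e7 : 2 ≤ Real.exp |z.im| := by linarith [Real.add_one_le_exp |z.im|]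
    linarith
  · set r := ‖z‖
    have hr1 : 1 ≤ r := by
      have := Real.pi_gt_three
      have hk : (0 : ℝ) ≤ k := k.cast_nonneg
      rw [hz]
      nlinarith
    have hx : |z.re| ≤ r := Complex.abs_re_le_norm z
    have hsq : r ^ 2 = z.re ^ 2 + z.im ^ 2 := by
      rw [Complex.sq_norm, Complex.normSq_apply]; ring
    have hre := abs_nonneg z.re
    have hδ : r - |z.re| ≤ 1 := by
      have h1 : (r - |z.re|) * (r + |z.re|) ≤ 1 := by
        have : (r - |z.re|) * (r + |z.re|) = |z.im| ^ 2 := by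
          rw [sq_abs]
          nlinarith [sq_abs z.re]
        rw [this]
        exact pow_le_one₀ (abs_nonneg _) h
      nlinarith
    set δ := r - |z.re|
    have hδ0 : 0 ≤ δ := sub_nonneg.2 hx
    have hsin : 1 / 2 ≤ |Real.sin z.re| := by
      have e1 : |Real.sin z.re| = |Real.sin (|z.re|)| := by
        rcases abs_choice z.re with h' | h' <;> simp [h']
      have e2 : |z.re| = Real.pi / 2 - δ + k * Real.pi := by
        simp only [δ]; rw [hz]; ring
      rw [e1, e2, Real.sin_add_nat_mul_pi, Real.sin_pi_div_two_sub, abs_mul]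
      simp only [abs_pow, abs_neg, abs_one, one_pow, one_mul]
      have := Real.one_sub_sq_div_two_le_cos (x := δ)
      refine le_trans ?_ (le_abs_self _)
      nlinarith
    have h2 : |Real.sin z.re| ≤ ‖Complex.sin z‖ := by
      have h3 : (Complex.sin z).re = Real.sin z.re * Real.cosh z.im := by
        conv_lhs => rw [Complex.sin_eq z]
        rw [← Complex.ofReal_sin, ← Complex.ofReal_cosh, ← Complex.ofReal_cos,
          ← Complex.ofReal_sinh]
        simp [Complex.sin_ofReal_re]
      have h4 := Complex.abs_re_le_norm (Complex.sin z)
      rw [h3, abs_mul] at h4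
      have h5 : 1 ≤ |Real.cosh z.im| := (Real.one_le_cosh _).trans (le_abs_self _)
      nlinarith [abs_nonneg (Real.sin z.re)]
    have h3 : Real.exp |z.im| ≤ 3 :=
      (Real.exp_le_exp.2 h).trans (by linarith [Real.exp_one_lt_d9])
    linarith

theorem norm_cos_le_exp_abs_im (z : ℂ) : ‖Complex.cos z‖ ≤ Real.exp |z.im| := by
  have e1 : ‖Complex.exp (-z * Complex.I)‖ ≤ Real.exp |z.im| := by
    rw [Complex.norm_exp]
    simpa using le_abs_self z.im
  have e2 : ‖Complex.exp (z * Complex.I)‖ ≤ Real.exp |z.im| := by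
    rw [Complex.norm_exp]
    simpa using neg_le_abs z.im
  have e3 : ‖Complex.cos z‖ =
      ‖Complex.exp (z * Complex.I) + Complex.exp (-z * Complex.I)‖ / 2 := by
    simp [Complex.cos]
  rw [e3]
  linarith [norm_add_le (Complex.exp (z * Complex.I)) (Complex.exp (-z * Complex.I))]

/-- On the circles `|E| Ω = (k + 1/2) π` the function `τ² - 4` is as large as its exponential type
permits. -/
theorem exists_norm_sq_sub_four_ge {τ : ℂ → ℂ} {Ω C R : ℝ} (hΩ : 0 < Ω) (hC : 0 < C)
    (hτ : ∀ E : ℂ, R ≤ ‖E‖ →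
      ‖τ E - 2 * Complex.cos (E * Ω)‖ ≤ C / ‖E‖ * Real.exp (|E.im| * Ω)) :
    ∃ k₀ : ℕ, ∀ k ≥ k₀, ∀ E : ℂ, ‖E‖ = (k + 1 / 2) * Real.pi / Ω →
      Real.exp (|E.im| * Ω) ^ 2 / 18 ≤ ‖τ E ^ 2 - 4‖ := by
  obtain ⟨k₀, hk₀⟩ := exists_nat_gt (max R (max 1 (18 * (C * (C + 4)))) * Ω)
  refine ⟨k₀, fun k hk E hE => ?_⟩
  have hbig : max R (max 1 (18 * (C * (C + 4)))) ≤ ‖E‖ := by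
    rw [hE, le_div_iff₀ hΩ]
    have h1 : (k₀ : ℝ) ≤ k := by exact_mod_cast hk
    have := Real.pi_gt_three
    have hk' : (0 : ℝ) ≤ k := k.cast_nonneg
    nlinarith
  have hER : R ≤ ‖E‖ := (le_max_left _ _).trans hbig
  have hE1 : 1 ≤ ‖E‖ := (le_max_left _ _).trans ((le_max_right _ _).trans hbig)
  have hEC : 18 * (C * (C + 4)) ≤ ‖E‖ :=
    (le_max_right _ _).trans ((le_max_right _ _).trans hbig)
  have hE0 : 0 < ‖E‖ := by linarith
  have hnorm : ‖E * Ω‖ = (k + 1 / 2) * Real.pi := by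
    rw [norm_mul, Complex.norm_real, Real.norm_of_nonneg hΩ.le, hE]
    field_simp
  have him : |(E * Ω).im| = |E.im| * Ω := by
    rw [Complex.im_mul_ofReal, abs_mul, abs_of_pos hΩ]
  have hs := exp_abs_im_le_norm_sin hnorm
  have hc := norm_cos_le_exp_abs_im (E * Ω)
  rw [him] at hs hc
  set X := Real.exp (|E.im| * Ω)
  have hX : 0 < X := Real.exp_pos _
  have herr := hτ E hER
  set e := τ E - 2 * Complex.cos (E * Ω)
  have e1 : τ E ^ 2 - 4 = e * (e + 4 * Complex.cos (E * Ω)) - 4 * Complex.sin (E * Ω) ^ 2 := by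
    have := Complex.sin_sq_add_cos_sq (E * Ω)
    simp only [e]
    linear_combination (4 : ℂ) * this
  have hCE : C / ‖E‖ ≤ C := div_le_self hC.le hE1
  have h2 : ‖e * (e + 4 * Complex.cos (E * Ω))‖ ≤ C / ‖E‖ * X * ((C + 4) * X) := by
    rw [norm_mul]
    refine mul_le_mul herr ?_ (norm_nonneg _) (by positivity)
    refine (norm_add_le _ _).trans ?_
    rw [norm_mul, Complex.norm_ofNat]
    have : C / ‖E‖ * X ≤ C * X := by gcongr
    linarith
  have h3 : C / ‖E‖ * X * ((C + 4) * X) ≤ X ^ 2 / 18 := by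
    have : C / ‖E‖ * X * ((C + 4) * X) = C * (C + 4) / ‖E‖ * X ^ 2 := by ring
    rw [this]
    have : C * (C + 4) / ‖E‖ ≤ 1 / 18 := by
      rw [div_le_iff₀ hE0]; linarith
    nlinarith [sq_nonneg X]
  have h4 : X ^ 2 / 9 ≤ ‖4 * Complex.sin (E * Ω) ^ 2‖ := by
    rw [norm_mul, norm_pow, Complex.norm_ofNat]
    nlinarith [norm_nonneg (Complex.sin (E * Ω))]
  rw [e1, norm_sub_rev]
  have := norm_sub_norm_le (4 * Complex.sin (E * Ω) ^ 2) (e * (e + 4 * Complex.cos (E * Ω)))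
  linarith

/-- An entire function whose square is `O(r ^ d)` on circles of radius `r → ∞` is a polynomial of
degree at most `d / 2`, by Cauchy's estimates for the Taylor coefficients. -/
theorem exists_polynomial_of_growth {f : ℂ → ℂ} (hf : Differentiable ℂ f) {C : ℝ} {d : ℕ}
    {r : ℕ → ℝ} (hr : Tendsto r atTop atTop)
    (hb : ∀ᶠ k in atTop, ∀ E : ℂ, ‖E‖ = r k → ‖f E‖ ^ 2 ≤ C * r k ^ d) :
    ∃ P : ℂ[X], P.natDegree ≤ d / 2 ∧ ∀ E, f E = P.eval E := by
  have hC : ∀ᶠ k in atTop, ∀ E : ℂ, ‖E‖ = r k → ‖f E‖ ^ 2 ≤ max C 0 * r k ^ d := by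
    filter_upwards [hb, hr.eventually_ge_atTop 0] with k hk hk0 E hE
    refine (hk E hE).trans ?_
    gcongr
    exact le_max_left _ _
  have hcoef : ∀ n, d < 2 * n → iteratedDeriv n f 0 = 0 := by
    intro n hn
    have hle : ∀ᶠ k in atTop, ‖iteratedDeriv n f 0‖ ^ 2 ≤
        (n.factorial : ℝ) ^ 2 * max C 0 * (r k)⁻¹ := by
      filter_upwards [hC, hr.eventually_ge_atTop 1] with k hk hk1
      have hpos : 0 < r k := by linarith
      have hbound : ∀ z ∈ Metric.sphere (0 : ℂ) (r k),
          ‖f z‖ ≤ Real.sqrt (max C 0 * r k ^ d) := by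
        intro z hz
        rw [mem_sphere_zero_iff_norm] at hz
        exact Real.le_sqrt_of_sq_le (hk z hz)
      have h1 := Complex.norm_iteratedDeriv_le_of_forall_mem_sphere_norm_le n hpos
        hf.diffContOnCl hbound
      have h2 : ‖iteratedDeriv n f 0‖ ^ 2 ≤
          (n.factorial * Real.sqrt (max C 0 * r k ^ d) / r k ^ n) ^ 2 := by gcongr
      refine h2.trans ?_
      rw [div_pow, mul_pow, Real.sq_sqrt (by positivity), div_le_iff₀ (by positivity),
        ← pow_mul, mul_assoc, mul_assoc]
      gcongr
      rw [inv_mul_eq_div, le_div_iff₀ hpos, ← pow_succ]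
      exact pow_le_pow_right₀ hk1 (by omega)
    have hlim : Tendsto (fun k => (n.factorial : ℝ) ^ 2 * max C 0 * (r k)⁻¹) atTop (𝓝 0) := by
      simpa using hr.inv_tendsto_atTop.const_mul ((n.factorial : ℝ) ^ 2 * max C 0)
    have := ge_of_tendsto hlim hle
    have h0 : ‖iteratedDeriv n f 0‖ = 0 := by nlinarith [norm_nonneg (iteratedDeriv n f 0)]
    exact norm_eq_zero.1 h0
  refine ⟨∑ n ∈ Finset.range (d / 2 + 1),
    Polynomial.C ((n.factorial : ℂ)⁻¹ * iteratedDeriv n f 0) * X ^ n, ?_, fun E => ?_⟩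
  · refine Polynomial.natDegree_sum_le_of_forall_le _ _ fun n hn => ?_
    refine (Polynomial.natDegree_C_mul_X_pow_le _ _).trans ?_
    have := Finset.mem_range.1 hn
    omega
  · have h := Complex.hasSum_taylorSeries_of_entire hf 0 E
    have h' := hasSum_sum_of_ne_finset_zero (L := .unconditional ℕ) (f := fun n => (n.factorial : ℂ)⁻¹ • (E - 0) ^ n •
      iteratedDeriv n f 0) (s := Finset.range (d / 2 + 1)) (fun n hn => by
        rw [hcoef n (by rw [Finset.mem_range] at hn; omega)]
        simp)
    rw [h.unique h', Polynomial.eval_finsetSum]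
    refine Finset.sum_congr rfl fun n _ => ?_
    simp
    ring

theorem exists_norm_eval_le (P : ℂ[X]) :
    ∃ C : ℝ, 0 ≤ C ∧ ∀ E : ℂ, 1 ≤ ‖E‖ → ‖P.eval E‖ ≤ C * ‖E‖ ^ P.natDegree := by
  refine ⟨∑ i ∈ Finset.range (P.natDegree + 1), ‖P.coeff i‖, by positivity, fun E hE => ?_⟩
  rw [Polynomial.eval_eq_sum_range, Finset.sum_mul]
  refine (norm_sum_le _ _).trans (Finset.sum_le_sum fun i hi => ?_)
  rw [norm_mul, norm_pow]
  gcongr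
  have := Finset.mem_range.1 hi
  omega

/-- If `τ² - 4 = U D²` with a polynomial `U`, then an entire quotient `g / D`, with `g` of
exponential type `Ω`, is a polynomial of degree at most half the degree of `U`. -/
theorem exists_polynomial_of_mul_eq {τ D f g : ℂ → ℂ} {U : ℂ[X]} {Ω C R C' R' : ℝ} (hΩ : 0 < Ω)
    (hC : 0 < C) (hτ : ∀ E : ℂ, R ≤ ‖E‖ →
      ‖τ E - 2 * Complex.cos (E * Ω)‖ ≤ C / ‖E‖ * Real.exp (|E.im| * Ω))
    (hU : ∀ E, τ E ^ 2 - 4 = U.eval E * D E ^ 2)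
    (hf : Differentiable ℂ f) (hfg : ∀ E, g E = f E * D E)
    (hg : ∀ E : ℂ, R' ≤ ‖E‖ → ‖g E‖ ≤ C' * Real.exp (|E.im| * Ω)) :
    ∃ P : ℂ[X], P.natDegree ≤ U.natDegree / 2 ∧ ∀ E, f E = P.eval E := by
  obtain ⟨k₀, hk₀⟩ := exists_norm_sq_sub_four_ge hΩ hC hτ
  obtain ⟨CU, hCU, hUb⟩ := exists_norm_eval_le U
  have hr : Tendsto (fun k : ℕ => ((k : ℝ) + 1 / 2) * Real.pi / Ω) atTop atTop := by
    refine Tendsto.atTop_div_const hΩ (Tendsto.atTop_mul_const Real.pi_pos ?_)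
    exact tendsto_atTop_add_const_right _ _ tendsto_natCast_atTop_atTop
  refine exists_polynomial_of_growth (C := 18 * C' ^ 2 * CU) hf hr ?_
  filter_upwards [eventually_ge_atTop k₀, hr.eventually_ge_atTop 1,
    hr.eventually_ge_atTop R'] with k hk hk1 hkR E hE
  have h1 := hk₀ k hk E hE
  have h2 := hg E (by rw [hE]; exact hkR)
  have h3 := hUb E (by rw [hE]; exact hk1)
  rw [← hE]
  set X := Real.exp (|E.im| * Ω)
  have hX : 0 < X := Real.exp_pos _
  have e1 : ‖f E‖ ^ 2 * ‖τ E ^ 2 - 4‖ = ‖g E‖ ^ 2 * ‖U.eval E‖ := by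
    rw [← norm_pow, ← norm_pow, ← norm_mul, ← norm_mul, hU, hfg]
    ring_nf
  have h4 : ‖f E‖ ^ 2 * (X ^ 2 / 18) ≤ (C' * X) ^ 2 * (CU * ‖E‖ ^ U.natDegree) := by
    calc _ ≤ ‖f E‖ ^ 2 * ‖τ E ^ 2 - 4‖ := by gcongr
      _ = ‖g E‖ ^ 2 * ‖U.eval E‖ := e1
      _ ≤ _ := by gcongr
  have h5 : 0 < X ^ 2 := by positivity
  have h6 : (‖f E‖ ^ 2 - 18 * C' ^ 2 * CU * ‖E‖ ^ U.natDegree) * X ^ 2 ≤ 0 := by nlinarith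
  nlinarith

/-- Division of entire functions. -/
theorem exists_entire_quotient {D g : ℂ → ℂ} (hD : Differentiable ℂ D) (hg : Differentiable ℂ g)
    (hD0 : ∀ E, analyticOrderAt D E ≠ ⊤) (h : ∀ E, analyticOrderAt D E ≤ analyticOrderAt g E) :
    ∃ f : ℂ → ℂ, Differentiable ℂ f ∧ ∀ E, g E = f E * D E := by
  have hloc : ∀ E₀, ∃ k : ℂ → ℂ, AnalyticAt ℂ k E₀ ∧ ∀ᶠ E in 𝓝 E₀, g E = k E * D E := by
    intro E₀
    obtain ⟨n, hn⟩ := ENat.ne_top_iff_exists.1 (hD0 E₀)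
    obtain ⟨a, ha, ha0, hDa⟩ := ((hD.analyticAt E₀).analyticOrderAt_eq_natCast).1 hn.symm
    obtain ⟨b, hb, hgb⟩ := (natCast_le_analyticOrderAt (hg.analyticAt E₀)).1 (hn ▸ h E₀)
    refine ⟨fun E => b E / a E, hb.div ha ha0, ?_⟩
    filter_upwards [hDa, hgb, ha.continuousAt.eventually_ne ha0] with E h1 h2 h3
    rw [h1, h2]
    simp only [smul_eq_mul]
    field_simp
  choose k hk hgk using hloc
  have huniq : ∀ (E : ℂ) (a b : ℂ → ℂ), AnalyticAt ℂ a E → AnalyticAt ℂ b E →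
      (∀ᶠ z in 𝓝 E, g z = a z * D z) → (∀ᶠ z in 𝓝 E, g z = b z * D z) → a E = b E := by
    intro E a b ha hb h1 h2
    by_contra hne
    refine hD0 E (analyticOrderAt_eq_top.2 ?_)
    have h3 : ∀ᶠ z in 𝓝 E, a z - b z ≠ 0 :=
      (ha.sub hb).continuousAt.eventually_ne (sub_ne_zero.2 hne)
    filter_upwards [h1, h2, h3] with z h1 h2 h3
    have : (a z - b z) * D z = 0 := by rw [sub_mul, ← h1, ← h2, sub_self]
    exact (mul_eq_zero.1 this).resolve_left h3
  refine ⟨fun E => k E E, fun E₀ => ?_, fun E => (hgk E).self_of_nhds⟩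
  have hev : (fun E => k E E) =ᶠ[𝓝 E₀] k E₀ := by
    filter_upwards [(hgk E₀).eventually_nhds, (hk E₀).eventually_analyticAt] with E h1 h2
    exact huniq E _ _ (hk E) h2 (hgk E) h1
  exact ((hk E₀).congr hev.symm).differentiableAt

/-! ### Algebraic multiplicities of Dirichlet eigenvalues -/

theorem coeffMat_add (p q : ℝ → ℂ) (E E₀ : ℂ) (x : ℝ) :
    coeffMat p q E x = coeffMat p q E₀ x + (E - E₀) • (-J) := by
  ext i j
  fin_cases i <;> fin_cases j <;> simp [coeffMat, J] <;> ring

/-- The inhomogeneous equation `(L - E) y = z` as a first order system. -/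
theorem mulVec_add_sub_smul_eq_iff {p q : ℝ → ℂ} {E : ℂ} {x : ℝ} {y y' z : Fin 2 → ℂ} :
    J.mulVec y' + (Q p q x).mulVec y - E • y = z ↔
      y' = (coeffMat p q E x).mulVec y + (-J).mulVec z := by
  have hI : Complex.I * Complex.I = -1 := Complex.I_mul_I
  constructor
  · rintro rfl
    ext i
    fin_cases i
    · simp only [coeffMat, J, Q, Matrix.mulVec, dotProduct, Fin.sum_univ_two, Pi.add_apply,
        Pi.sub_apply, Pi.smul_apply, Matrix.neg_apply]
      simp
      linear_combination (y' 0 - q x * y 1) * hI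
    · simp only [coeffMat, J, Q, Matrix.mulVec, dotProduct, Fin.sum_univ_two, Pi.add_apply,
        Pi.sub_apply, Pi.smul_apply, Matrix.neg_apply]
      simp
      linear_combination (y' 1 - p x * y 0) * hI
  · rintro rfl
    ext i
    fin_cases i
    · simp only [coeffMat, J, Q, Matrix.mulVec, dotProduct, Fin.sum_univ_two, Pi.add_apply,
        Pi.sub_apply, Pi.smul_apply, Matrix.neg_apply]
      simp
      linear_combination -(E * y 0 + z 0) * hI
    · simp only [coeffMat, J, Q, Matrix.mulVec, dotProduct, Fin.sum_univ_two, Pi.add_apply,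
        Pi.sub_apply, Pi.smul_apply, Matrix.neg_apply]
      simp
      linear_combination -(E * y 1 + z 1) * hI

/-- A Jordan chain of `L` at `E`, shifted by one: `ψ 0 = 0` and `(L - E) ψ (j + 1) = ψ j`, with the
initial values of the Taylor coefficients in `E` of the solution starting at `(0, 1)`. -/
structure IsJordanChain (p q : ℝ → ℂ) (E : ℂ) (x₀ : ℝ) (ψ : ℕ → ℝ → Fin 2 → ℂ) : Prop where
  zero : ψ 0 = 0
  hasDerivAt : ∀ j x, HasDerivAt (ψ (j + 1))
    ((coeffMat p q E x).mulVec (ψ (j + 1) x) + (-J).mulVec (ψ j x)) x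
  init_one : ψ 1 x₀ = ![0, 1]
  init_succ : ∀ j, ψ (j + 2) x₀ = 0

/-- The Taylor expansion of `M₁₂(·, x₀)` at `E₀` has the Dirichlet boundary values of a Jordan
chain as coefficients. -/
theorem IsFundamental.exists_jordanChain {p q : ℝ → ℂ} {Y : ℂ → ℝ → Matrix (Fin 2) (Fin 2) ℂ}
    (hY : IsFundamental p q Y) (hpc : Continuous p) (hqc : Continuous q) {Ω : ℝ}
    (hp : Function.Periodic p Ω) (hq : Function.Periodic q Ω) (E₀ : ℂ) (x₀ : ℝ) :
    ∃ ψ, IsJordanChain p q E₀ x₀ ψ ∧ ∀ N, ∃ ρ : ℂ → ℂ, Differentiable ℂ ρ ∧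
      ρ E₀ = ψ (N + 1) (x₀ + Ω) 0 ∧
      ∀ E, monodromy Y Ω E x₀ 0 1 =
        ∑ j ∈ Finset.range N, (E - E₀) ^ j * ψ (j + 1) (x₀ + Ω) 0 + (E - E₀) ^ N * ρ E := by
  have key := fun (f : {f : ℝ → Fin 2 → ℂ // Continuous f}) (v : Fin 2 → ℂ) =>
    exists_entire_solution_system hpc hqc
      (f := fun x => (-J).mulVec (f.1 x)) (Continuous.matrix_mulVec continuous_const f.2) x₀ v
  choose r hr1 hr2 hr3 using key
  have hcont : ∀ f v E, Continuous (r f v E) := fun f v E =>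
    continuous_iff_continuousAt.2 fun x => (hr1 f v E x).continuousAt
  let init : ℕ → Fin 2 → ℂ := fun j => if j = 0 then ![0, 1] else 0
  let Ψ : ℕ → {f : ℝ → Fin 2 → ℂ // Continuous f} := fun n =>
    Nat.rec ⟨0, continuous_const⟩ (fun j f => ⟨r f (init j) E₀, hcont _ _ _⟩) n
  have hΨ : ∀ j, (Ψ (j + 1)).1 = r (Ψ j) (init j) E₀ := fun j => rfl
  have hsplit : ∀ j E x, r (Ψ j) (init j) E x =
      (Ψ (j + 1)).1 x + (E - E₀) • r (Ψ (j + 1)) (init (j + 1)) E x := by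
    intro j E x
    have hd : ∀ x, HasDerivAt (fun x => r (Ψ j) (init j) E x -
        ((Ψ (j + 1)).1 x + (E - E₀) • r (Ψ (j + 1)) (init (j + 1)) E x))
        ((coeffMat p q E x).mulVec (r (Ψ j) (init j) E x -
        ((Ψ (j + 1)).1 x + (E - E₀) • r (Ψ (j + 1)) (init (j + 1)) E x))) x := by
      intro x
      have h1 := hr1 (Ψ j) (init j) E x
      have h2 : HasDerivAt (Ψ (j + 1)).1 _ x := hr1 (Ψ j) (init j) E₀ x
      have h3 := hr1 (Ψ (j + 1)) (init (j + 1)) E x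
      refine (h1.sub (h2.add (h3.const_smul (E - E₀)))).congr_deriv ?_
      rw [Matrix.mulVec_sub, Matrix.mulVec_add, Matrix.mulVec_smul]
      rw [show (coeffMat p q E x).mulVec ((Ψ (j + 1)).1 x) =
        (coeffMat p q E₀ x).mulVec ((Ψ (j + 1)).1 x) +
          (E - E₀) • (-J).mulVec ((Ψ (j + 1)).1 x) by
          rw [coeffMat_add p q E E₀ x, Matrix.add_mulVec, Matrix.smul_mulVec]]
      rw [hΨ j, smul_add]
      abel
    have h0 := hY.eq_mulVec hd x x₀
    have hi : r (Ψ j) (init j) E x₀ -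
        ((Ψ (j + 1)).1 x₀ + (E - E₀) • r (Ψ (j + 1)) (init (j + 1)) E x₀) = 0 := by
      rw [hΨ, hr2, hr2, hr2]
      simp [init]
    rw [hi, Matrix.mulVec_zero, Matrix.mulVec_zero] at h0
    exact sub_eq_zero.1 h0
  refine ⟨fun j => (Ψ j).1, ⟨rfl, fun j x => hr1 (Ψ j) (init j) E₀ x, ?_, fun j => ?_⟩,
    fun N => ⟨fun E => r (Ψ N) (init N) E (x₀ + Ω) 0, ?_, rfl, fun E => ?_⟩⟩
  · change (Ψ (0 + 1)).1 x₀ = _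
    rw [hΨ 0, hr2]
    simp [init]
  · rw [hΨ (j + 1), hr2]
    simp [init]
  · exact differentiable_pi.1 (hr3 _ _ _) 0
  · induction N with
    | zero =>
      have hd : ∀ x, HasDerivAt (r (Ψ 0) (init 0) E)
          ((coeffMat p q E x).mulVec (r (Ψ 0) (init 0) E x)) x := by
        intro x
        have := hr1 (Ψ 0) (init 0) E x
        have e : (Ψ 0).1 x = 0 := rfl
        simpa only [e, Matrix.mulVec_zero, add_zero] using this
      have h0 := hY.eq_mulVec hd (x₀ + Ω) x₀
      rw [hr2, Matrix.mulVec_mulVec, ← hY.monodromy_eq hp hq] at h0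
      rw [Finset.range_zero, Finset.sum_empty, pow_zero, one_mul, zero_add]
      change _ = r (Ψ 0) (init 0) E (x₀ + Ω) 0
      rw [h0]
      simp [init, Matrix.mulVec, dotProduct]
    | succ N ih =>
      rw [ih, Finset.sum_range_succ]
      simp only [hsplit N E (x₀ + Ω)]
      simp only [Pi.add_apply, Pi.smul_apply, smul_eq_mul]
      ring

theorem mem_dirichletKer_succ {p q : ℝ → ℂ} {Ω : ℝ} {E : ℂ} {x₀ : ℝ} {k : ℕ} {y : VecFun} :
    y ∈ dirichletKer p q Ω E x₀ (k + 1) ↔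
      (∀ x, x ∉ Icc x₀ (x₀ + Ω) → y x = 0) ∧ y x₀ 0 = 0 ∧ y (x₀ + Ω) 0 = 0 ∧
        ∃ z ∈ dirichletKer p q Ω E x₀ k, ∀ x ∈ Icc x₀ (x₀ + Ω),
          HasDerivWithinAt y ((coeffMat p q E x).mulVec (y x) + (-J).mulVec (z x))
            (Icc x₀ (x₀ + Ω)) x := by
  constructor
  · rintro ⟨h1, h2, h3, y', z, hz, h⟩
    exact ⟨h1, h2, h3, z, hz, fun x hx =>
      (h x hx).1.congr_deriv (mulVec_add_sub_smul_eq_iff.1 (h x hx).2)⟩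
  · rintro ⟨h1, h2, h3, z, hz, h⟩
    exact ⟨h1, h2, h3, fun x => (coeffMat p q E x).mulVec (y x) + (-J).mulVec (z x), z, hz,
      fun x hx => ⟨h x hx, mulVec_add_sub_smul_eq_iff.2 rfl⟩⟩

namespace IsJordanChain

variable {p q : ℝ → ℂ} {E : ℂ} {x₀ Ω : ℝ} {ψ : ℕ → ℝ → Fin 2 → ℂ}

theorem init_fst (hψ : IsJordanChain p q E x₀ ψ) (j : ℕ) : ψ j x₀ 0 = 0 := by
  rcases j with _ | _ | j
  · rw [hψ.zero]; rfl
  · rw [hψ.init_one]; rfl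
  · rw [hψ.init_succ]; rfl

theorem hasDerivAt_sum (hψ : IsJordanChain p q E x₀ ψ) (N : ℕ) (d : ℕ → ℂ) (x : ℝ) :
    HasDerivAt (fun x => ∑ j ∈ Finset.range N, d j • ψ (j + 1) x)
      ((coeffMat p q E x).mulVec (∑ j ∈ Finset.range N, d j • ψ (j + 1) x) +
        (-J).mulVec (∑ j ∈ Finset.range N, d j • ψ j x)) x := by
  refine (HasDerivAt.fun_sum fun j _ => (hψ.hasDerivAt j x).const_smul (d j)).congr_deriv ?_
  rw [Matrix.mulVec_sum, Matrix.mulVec_sum, ← Finset.sum_add_distrib]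
  refine Finset.sum_congr rfl fun j _ => ?_
  rw [Matrix.mulVec_smul, Matrix.mulVec_smul, smul_add]

theorem J_mulVec_eq_zero {v : Fin 2 → ℂ} (h : (-J).mulVec v = 0) : v = 0 := by
  have h0 := congrFun h 0
  have h1 := congrFun h 1
  ext i
  fin_cases i
  · simpa [J, Matrix.mulVec, dotProduct, Fin.sum_univ_two, Complex.I_ne_zero] using h0
  · simpa [J, Matrix.mulVec, dotProduct, Fin.sum_univ_two, Complex.I_ne_zero] using h1

/-- The members of a Jordan chain are linearly independent on the interval. -/
theorem eq_zero_of_sum_eq_zero (hψ : IsJordanChain p q E x₀ ψ) (hΩ : 0 < Ω) :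
    ∀ (N : ℕ) (d : ℕ → ℂ),
      (∀ x ∈ Icc x₀ (x₀ + Ω), ∑ j ∈ Finset.range N, d j • ψ (j + 1) x = 0) →
      ∀ j < N, d j = 0 := by
  intro N
  induction N with
  | zero => intro d _ j hj; omega
  | succ N ih =>
    intro d h
    have hx₀ : x₀ ∈ Icc x₀ (x₀ + Ω) := left_mem_Icc.2 (by linarith)
    have h0 : d 0 = 0 := by
      have := h x₀ hx₀
      rw [Finset.sum_range_succ', Finset.sum_eq_zero (fun j _ => by
        rw [hψ.init_succ, smul_zero]), zero_add, zero_add, hψ.init_one] at this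
      simpa using congrFun this 1
    have h1 : ∀ x ∈ Icc x₀ (x₀ + Ω), ∑ j ∈ Finset.range N, d (j + 1) • ψ (j + 1) x = 0 := by
      intro x hx
      have hd := (hψ.hasDerivAt_sum (N + 1) d x).hasDerivWithinAt (s := Icc x₀ (x₀ + Ω))
      have hd' : HasDerivWithinAt (fun x => ∑ j ∈ Finset.range (N + 1), d j • ψ (j + 1) x) 0
          (Icc x₀ (x₀ + Ω)) x :=
        (hasDerivWithinAt_const x _ 0).congr h (h x hx)
      have := (uniqueDiffOn_Icc (by linarith : x₀ < x₀ + Ω) x hx).eq_deriv _ hd hd'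
      rw [h x hx, Matrix.mulVec_zero, zero_add] at this
      have := J_mulVec_eq_zero this
      rw [Finset.sum_range_succ', hψ.zero] at this
      simpa using this
    intro j hj
    rcases j with _ | j
    · exact h0
    · exact ih (fun j => d (j + 1)) h1 j (by omega)

/-- The members of a Jordan chain that satisfy the boundary conditions, extended by zero, are in
the generalized Dirichlet kernels. -/
theorem indicator_mem_dirichletKer (hψ : IsJordanChain p q E x₀ ψ) {k : ℕ}
    (hΩ : 0 < Ω) (hk : ∀ j < k, ψ (j + 1) (x₀ + Ω) 0 = 0) :
    ∀ j ≤ k, ∀ m ≥ j, (Icc x₀ (x₀ + Ω)).indicator (ψ j) ∈ dirichletKer p q Ω E x₀ m := by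
  intro j
  induction j with
  | zero =>
    intro _ m _
    rw [hψ.zero, indicator_zero']
    exact Submodule.zero_mem _
  | succ j ih =>
    intro hj m hm
    obtain ⟨m, rfl⟩ : ∃ m', m = m' + 1 := ⟨m - 1, by omega⟩
    have hx₀ : x₀ ∈ Icc x₀ (x₀ + Ω) := left_mem_Icc.2 (by linarith)
    have hx₁ : x₀ + Ω ∈ Icc x₀ (x₀ + Ω) := right_mem_Icc.2 (by linarith)
    refine mem_dirichletKer_succ.2 ⟨fun x hx => indicator_of_notMem hx _, ?_, ?_,
      _, ih (by omega) m (by omega), fun x hx => ?_⟩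
    · rw [indicator_of_mem hx₀, hψ.init_fst]
    · rw [indicator_of_mem hx₁, hk j (by omega)]
    · rw [indicator_of_mem hx, indicator_of_mem hx]
      exact (hψ.hasDerivAt j x).hasDerivWithinAt.congr
        (fun z hz => indicator_of_mem hz _) (indicator_of_mem hx _)

/-- Every element of a generalized Dirichlet kernel is a combination of the members of the Jordan
chain that satisfy the boundary conditions. -/
theorem exists_eq_sum_of_mem_dirichletKer (hψ : IsJordanChain p q E x₀ ψ)
    {Y : ℂ → ℝ → Matrix (Fin 2) (Fin 2) ℂ} (hY : IsFundamental p q Y) {k : ℕ}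
    (hΩ : 0 < Ω) (hk : ∀ j < k, ψ (j + 1) (x₀ + Ω) 0 = 0) (hk' : ψ (k + 1) (x₀ + Ω) 0 ≠ 0)
    (m : ℕ) : ∀ y ∈ dirichletKer p q Ω E x₀ m, ∃ d : ℕ → ℂ,
      y = (Icc x₀ (x₀ + Ω)).indicator fun x => ∑ j ∈ Finset.range k, d j • ψ (j + 1) x := by
  induction m with
  | zero =>
    intro y hy
    rw [show y = 0 from hy]
    exact ⟨fun _ => 0, funext fun x => by by_cases hx : x ∈ Icc x₀ (x₀ + Ω) <;> simp [hx]⟩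
  | succ m ih =>
    intro y hy
    obtain ⟨h1, h2, h3, z, hz, hd⟩ := mem_dirichletKer_succ.1 hy
    obtain ⟨c, hc⟩ := ih z hz
    have hx₀ : x₀ ∈ Icc x₀ (x₀ + Ω) := left_mem_Icc.2 (by linarith)
    have hx₁ : x₀ + Ω ∈ Icc x₀ (x₀ + Ω) := right_mem_Icc.2 (by linarith)
    let d : ℕ → ℂ := fun j => Nat.casesOn j (y x₀ 1) c
    have hd0 : d 0 = y x₀ 1 := rfl
    have hds : ∀ j, d (j + 1) = c j := fun j => rfl
    have hu : ∀ x ∈ Icc x₀ (x₀ + Ω), HasDerivWithinAt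
        (fun x => y x - ∑ j ∈ Finset.range (k + 1), d j • ψ (j + 1) x)
        ((coeffMat p q E x).mulVec (y x - ∑ j ∈ Finset.range (k + 1), d j • ψ (j + 1) x))
        (Icc x₀ (x₀ + Ω)) x := by
      intro x hx
      refine ((hd x hx).sub (hψ.hasDerivAt_sum (k + 1) d x).hasDerivWithinAt).congr_deriv ?_
      have e : ∑ j ∈ Finset.range (k + 1), d j • ψ j x = z x := by
        rw [hc, indicator_of_mem hx, Finset.sum_range_succ', hψ.zero]
        simp [hds]
      rw [e, Matrix.mulVec_sub]
      abel
    have hu0 : y x₀ - ∑ j ∈ Finset.range (k + 1), d j • ψ (j + 1) x₀ = 0 := by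
      rw [Finset.sum_range_succ', Finset.sum_eq_zero (fun j _ => by
        rw [hψ.init_succ, smul_zero]), zero_add, zero_add, hψ.init_one, hd0]
      ext i
      fin_cases i
      · simp [h2]
      · simp
    have hy' : ∀ x ∈ Icc x₀ (x₀ + Ω), y x = ∑ j ∈ Finset.range (k + 1), d j • ψ (j + 1) x := by
      intro x hx
      have := hY.eq_mulVec_of_convex (convex_Icc _ _) hu hx hx₀
      rw [hu0, Matrix.mulVec_zero, Matrix.mulVec_zero] at this
      exact sub_eq_zero.1 this
    have hdk : d k = 0 := by
      have := congrFun (hy' _ hx₁) 0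
      rw [h3, Finset.sum_range_succ, Pi.add_apply, Finset.sum_apply,
        Finset.sum_eq_zero (fun j hj => by
          rw [Pi.smul_apply, hk j (Finset.mem_range.1 hj), smul_zero]), zero_add,
        Pi.smul_apply, smul_eq_mul] at this
      exact (mul_eq_zero.1 this.symm).resolve_right hk'
    refine ⟨d, funext fun x => ?_⟩
    by_cases hx : x ∈ Icc x₀ (x₀ + Ω)
    · rw [indicator_of_mem hx, hy' x hx, Finset.sum_range_succ, hdk, zero_smul, add_zero]
    · rw [indicator_of_notMem hx, h1 x hx]

theorem exists_linearIndependent (hψ : IsJordanChain p q E x₀ ψ) {k : ℕ} (hΩ : 0 < Ω)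
    (hk : ∀ j < k, ψ (j + 1) (x₀ + Ω) 0 = 0) :
    ∃ w : Fin k → VecFun, LinearIndependent ℂ w ∧
      (∀ j, w j ∈ ⨆ m, dirichletKer p q Ω E x₀ m) ∧
      ∀ d : ℕ → ℂ, (Icc x₀ (x₀ + Ω)).indicator
        (fun x => ∑ j ∈ Finset.range k, d j • ψ (j + 1) x) ∈ Submodule.span ℂ (range w) := by
  let w : Fin k → VecFun := fun j => (Icc x₀ (x₀ + Ω)).indicator (ψ (j + 1))
  have hsum : ∀ (c : Fin k → ℂ) (d : ℕ → ℂ), (∀ j : Fin k, c j = d j) →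
      ∑ j, c j • w j = (Icc x₀ (x₀ + Ω)).indicator
        fun x => ∑ j ∈ Finset.range k, d j • ψ (j + 1) x := by
    intro c d hcd
    funext x
    rw [Finset.sum_apply]
    by_cases hx : x ∈ Icc x₀ (x₀ + Ω)
    · rw [indicator_of_mem hx, ← Fin.sum_univ_eq_sum_range (fun j => d j • ψ (j + 1) x)]
      exact Finset.sum_congr rfl fun j _ => by
        rw [Pi.smul_apply, hcd]
        simp only [w]
        rw [indicator_of_mem hx]
    · rw [indicator_of_notMem hx]
      exact Finset.sum_eq_zero fun j _ => by
        rw [Pi.smul_apply]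
        simp only [w]
        rw [indicator_of_notMem hx, smul_zero]
  refine ⟨w, ?_, fun j => ?_, fun d => ?_⟩
  · rw [Fintype.linearIndependent_iff]
    intro c hc j
    let d : ℕ → ℂ := fun j => if h : j < k then c ⟨j, h⟩ else 0
    have hcd : ∀ j : Fin k, c j = d j := fun j => by simp [d]
    rw [hsum c d hcd] at hc
    rw [hcd]
    refine hψ.eq_zero_of_sum_eq_zero hΩ k d (fun x hx => ?_) j j.2
    have := congrFun hc x
    rwa [indicator_of_mem hx] at this
  · exact (le_iSup (fun m => dirichletKer p q Ω E x₀ m) k)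
      (hψ.indicator_mem_dirichletKer hΩ hk (j + 1) j.2 k j.2)
  · rw [← hsum (fun j => d j) d fun _ => rfl]
    exact Submodule.sum_mem _ fun j _ =>
      Submodule.smul_mem _ _ (Submodule.subset_span (mem_range_self j))

theorem toENat_rank_span {k : ℕ} {w : Fin k → VecFun} (hw : LinearIndependent ℂ w) :
    Cardinal.toENat (Module.rank ℂ (Submodule.span ℂ (range w))) = k := by
  rw [rank_span hw, Cardinal.mk_range_eq w hw.injective]
  simp

theorem le_delta (hψ : IsJordanChain p q E x₀ ψ) {k : ℕ} (hΩ : 0 < Ω)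
    (hk : ∀ j < k, ψ (j + 1) (x₀ + Ω) 0 = 0) : k ≤ delta p q Ω E x₀ := by
  obtain ⟨w, hw, hmem, -⟩ := hψ.exists_linearIndependent hΩ hk
  rw [delta, ← toENat_rank_span hw]
  refine OrderHomClass.mono Cardinal.toENat (Submodule.rank_mono (Submodule.span_le.2 ?_))
  rintro _ ⟨j, rfl⟩
  exact hmem j

theorem delta_eq (hψ : IsJordanChain p q E x₀ ψ)
    {Y : ℂ → ℝ → Matrix (Fin 2) (Fin 2) ℂ} (hY : IsFundamental p q Y) {k : ℕ}
    (hΩ : 0 < Ω) (hk : ∀ j < k, ψ (j + 1) (x₀ + Ω) 0 = 0) (hk' : ψ (k + 1) (x₀ + Ω) 0 ≠ 0) :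
    delta p q Ω E x₀ = k := by
  obtain ⟨w, hw, -, hspan⟩ := hψ.exists_linearIndependent hΩ hk
  refine le_antisymm ?_ (hψ.le_delta hΩ hk)
  rw [delta, ← toENat_rank_span hw]
  refine OrderHomClass.mono Cardinal.toENat (Submodule.rank_mono (iSup_le fun m y hy => ?_))
  obtain ⟨d, rfl⟩ := hψ.exists_eq_sum_of_mem_dirichletKer hY hΩ hk hk' m y hy
  exact hspan d

end IsJordanChain

/-- The algebraic multiplicity of a Dirichlet eigenvalue is the order of the zero of `M₁₂`. -/
theorem IsFundamental.delta_eq {p q : ℝ → ℂ} {Y : ℂ → ℝ → Matrix (Fin 2) (Fin 2) ℂ}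
    (hY : IsFundamental p q Y) (hpc : Continuous p) (hqc : Continuous q) {Ω : ℝ} (hΩ : 0 < Ω)
    (hp : Function.Periodic p Ω) (hq : Function.Periodic q Ω) (E₀ : ℂ) (x₀ : ℝ) :
    delta p q Ω E₀ x₀ = analyticOrderAt (fun E => monodromy Y Ω E x₀ 0 1) E₀ := by
  obtain ⟨ψ, hψ, hexp⟩ := hY.exists_jordanChain hpc hqc hp hq E₀ x₀
  have hF := (hY.monodromy_entire Ω x₀ 0 1).analyticAt E₀
  have hcoef : ∀ N, (∀ j < N, ψ (j + 1) (x₀ + Ω) 0 = 0) → ∃ ρ : ℂ → ℂ, AnalyticAt ℂ ρ E₀ ∧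
      ρ E₀ = ψ (N + 1) (x₀ + Ω) 0 ∧
      ∀ᶠ E in 𝓝 E₀, monodromy Y Ω E x₀ 0 1 = (E - E₀) ^ N • ρ E := by
    intro N hN
    obtain ⟨ρ, h1, h2, h3⟩ := hexp N
    refine ⟨ρ, h1.analyticAt E₀, h2, Eventually.of_forall fun E => ?_⟩
    rw [h3, Finset.sum_eq_zero fun j hj => by rw [hN j (Finset.mem_range.1 hj), mul_zero],
      zero_add, smul_eq_mul]
  have hzero : ∀ j : ℕ, (j : ℕ∞) < analyticOrderAt (fun E => monodromy Y Ω E x₀ 0 1) E₀ →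
      ψ (j + 1) (x₀ + Ω) 0 = 0 := by
    intro j
    induction j using Nat.strong_induction_on with
    | _ j ih =>
      intro hj
      by_contra hne
      obtain ⟨ρ, h1, h2, h3⟩ := hcoef j fun i hi => ih i hi ((Nat.cast_lt.2 hi).trans hj)
      exact hj.ne' (hF.analyticOrderAt_eq_natCast.2 ⟨ρ, h1, by rwa [h2], h3⟩)
  by_cases h : analyticOrderAt (fun E => monodromy Y Ω E x₀ 0 1) E₀ = ⊤
  · rw [h]
    refine ENat.eq_top_iff_forall_ge.2 fun k => hψ.le_delta hΩ fun j _ => hzero j ?_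
    rw [h]
    exact ENat.natCast_lt_top j
  obtain ⟨k, hk⟩ := ENat.ne_top_iff_exists.1 h
  rw [← hk] at hzero ⊢
  have hzero' : ∀ j < k, ψ (j + 1) (x₀ + Ω) 0 = 0 := fun j hj => hzero j (Nat.cast_lt.2 hj)
  refine hψ.delta_eq hY hΩ hzero' fun h0 => ?_
  obtain ⟨ρ, h1, h2, h3⟩ := hcoef (k + 1) fun j hj => by
    rcases Nat.lt_succ_iff_lt_or_eq.1 hj with h | rfl
    · exact hzero' j h
    · exact h0
  have : ((k + 1 : ℕ) : ℕ∞) ≤ analyticOrderAt (fun E => monodromy Y Ω E x₀ 0 1) E₀ :=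
    (natCast_le_analyticOrderAt hF).2 ⟨ρ, h1, h3⟩
  rw [← hk] at this
  have := Nat.cast_le.1 this
  omega

/-! ### The monodromy matrix divided by the immovable factor -/

theorem le_analyticOrderAt_mul_right {f g : ℂ → ℂ} {z : ℂ} {n : ℕ∞} (hf : AnalyticAt ℂ f z)
    (hg : AnalyticAt ℂ g z) (h : n ≤ analyticOrderAt g z) :
    n ≤ analyticOrderAt (fun w => f w * g w) z := by
  have := analyticOrderAt_mul hf hg
  rw [show (fun w => f w * g w) = f * g from rfl, this]
  exact h.trans le_add_self

theorem le_analyticOrderAt_of_mul {f g : ℂ → ℂ} {z : ℂ} {n : ℕ∞} (hf : AnalyticAt ℂ f z)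
    (hg : AnalyticAt ℂ g z) (hf0 : f z ≠ 0) (h : n ≤ analyticOrderAt (fun w => f w * g w) z) :
    n ≤ analyticOrderAt g z := by
  rwa [show (fun w => f w * g w) = f * g from rfl, analyticOrderAt_mul hf hg,
    hf.analyticOrderAt_eq_zero.2 hf0, zero_add] at h

theorem le_analyticOrderAt_fun_add {f g : ℂ → ℂ} {z : ℂ} {n : ℕ∞} (hf : n ≤ analyticOrderAt f z)
    (hg : n ≤ analyticOrderAt g z) : n ≤ analyticOrderAt (fun w => f w + g w) z :=
  (le_min hf hg).trans le_analyticOrderAt_add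

theorem le_analyticOrderAt_fun_sub {f g : ℂ → ℂ} {z : ℂ} {n : ℕ∞} (hf : n ≤ analyticOrderAt f z)
    (hg : n ≤ analyticOrderAt g z) : n ≤ analyticOrderAt (fun w => f w - g w) z :=
  (le_min hf hg).trans le_analyticOrderAt_sub

namespace IsFundamental

variable {p q : ℝ → ℂ} {Y : ℂ → ℝ → Matrix (Fin 2) (Fin 2) ℂ} (hY : IsFundamental p q Y)
include hY

/-- The monodromy matrices at two base points are conjugate by the propagator `Φ` between them. -/
theorem monodromy_conj (Ω : ℝ) (E : ℂ) (x x₀ : ℝ) :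
    ∃ Φ : Matrix (Fin 2) (Fin 2) ℂ, Φ = Y E x * (Y E x₀).adjugate ∧ Φ.det = 1 ∧
      monodromy Y Ω E x = Φ * monodromy Y Ω E x₀ * Φ.adjugate := by
  refine ⟨_, rfl, ?_, ?_⟩
  · rw [Matrix.det_mul, Matrix.det_adjugate, hY.det, hY.det]
    simp
  · have h1 := hY.adjugate_mul E x₀
    rw [Matrix.adjugate_mul_distrib, Matrix.adjugate_adjugate _ (by simp), hY.det]
    simp only [Fintype.card_fin, monodromy, Nat.sub_self, pow_zero, one_smul]
    calc Y E x * Y E Ω * (Y E x).adjugate =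
        Y E x * 1 * Y E Ω * 1 * (Y E x).adjugate := by rw [mul_one, mul_one]
      _ = _ := by
        rw [← h1]
        simp only [Matrix.mul_assoc]

/-- A common zero of all the functions `M₁₂(·, x)` is a zero, of the same order, of the other
entries of the traceless part of the monodromy matrix. -/
theorem le_analyticOrderAt_monodromy {Ω : ℝ} {E₀ : ℂ} {n : ℕ∞}
    (hF : ∀ x, n ≤ analyticOrderAt (fun E => monodromy Y Ω E x 0 1) E₀)
    {x₀ : ℝ} (hq0 : q x₀ ≠ 0) (x : ℝ) :
    n ≤ analyticOrderAt
      (fun E => (monodromy Y Ω E x 0 0 - monodromy Y Ω E x 1 1) / 2) E₀ ∧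
    n ≤ analyticOrderAt (fun E => monodromy Y Ω E x 1 0) E₀ := by
  let Φ : ℝ → ℂ → Matrix (Fin 2) (Fin 2) ℂ := fun x E => Y E x * (Y E x₀).adjugate
  have hΦd : ∀ x i j, Differentiable ℂ fun E => Φ x E i j := by
    intro x i j
    simp only [Φ, Matrix.adjugate_fin_two, Matrix.mul_apply, Fin.sum_univ_two]
    have h00 := hY.entire x i 0
    have h01 := hY.entire x i 1
    have k00 := hY.entire x₀ 0 0
    have k01 := hY.entire x₀ 0 1
    have k10 := hY.entire x₀ 1 0
    have k11 := hY.entire x₀ 1 1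
    fin_cases j <;> simp <;> fun_prop
  have hΦ : ∀ x i j, AnalyticAt ℂ (fun E => Φ x E i j) E₀ := fun x i j =>
    (hΦd x i j).analyticAt E₀
  have hMd : ∀ i j, Differentiable ℂ (fun E => monodromy Y Ω E x₀ i j) :=
    hY.monodromy_entire Ω x₀
  have hM : ∀ i j, AnalyticAt ℂ (fun E => monodromy Y Ω E x₀ i j) E₀ := fun i j =>
    (hMd i j).analyticAt E₀
  have hconj : ∀ E x, (Φ x E 0 0 * Φ x E 1 1 - Φ x E 0 1 * Φ x E 1 0 = 1) ∧
      monodromy Y Ω E x = Φ x E * monodromy Y Ω E x₀ * (Φ x E).adjugate := by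
    intro E x
    obtain ⟨Ψ, h1, h2, h3⟩ := hY.monodromy_conj Ω E x x₀
    subst h1
    refine ⟨?_, h3⟩
    rwa [Matrix.det_fin_two] at h2
  let G : ℂ → ℂ := fun E => (monodromy Y Ω E x₀ 0 0 - monodromy Y Ω E x₀ 1 1) / 2
  have hGd : Differentiable ℂ G := ((hMd 0 0).sub (hMd 1 1)).div_const 2
  have hG : AnalyticAt ℂ G E₀ := hGd.analyticAt E₀
  -- The combinations of `G` and `H` that occur in `M₁₂` at the other base points.
  have hcomb : ∀ x, Φ x E₀ 0 1 ≠ 0 → n ≤ analyticOrderAt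
      (fun E => 2 * Φ x E 0 0 * G E + Φ x E 0 1 * monodromy Y Ω E x₀ 1 0) E₀ := by
    intro x hb
    refine le_analyticOrderAt_of_mul (hΦ x 0 1)
      (Differentiable.analyticAt (((hΦd x 0 0).const_mul 2).mul hGd |>.add
        ((hΦd x 0 1).mul (hMd 1 0))) E₀) hb ?_
    have e : (fun E => Φ x E 0 1 *
        (2 * Φ x E 0 0 * G E + Φ x E 0 1 * monodromy Y Ω E x₀ 1 0)) =
        fun E => (Φ x E 0 0 * Φ x E 0 0) * monodromy Y Ω E x₀ 0 1 - monodromy Y Ω E x 0 1 := by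
      funext E
      obtain ⟨h1, h2⟩ := hconj E x
      rw [h2, Matrix.adjugate_fin_two]
      simp [Matrix.mul_apply, Fin.sum_univ_two, G]
      ring
    rw [e]
    exact le_analyticOrderAt_fun_sub
      (le_analyticOrderAt_mul_right ((hΦ x 0 0).mul (hΦ x 0 0)) (hM 0 1) (hF x₀)) (hF x)
  -- Two base points near `x₀` at which these combinations are independent.
  obtain ⟨x₁, x₂, hb1, hb2, hdet⟩ : ∃ x₁ x₂, Φ x₁ E₀ 0 1 ≠ 0 ∧ Φ x₂ E₀ 0 1 ≠ 0 ∧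
      Φ x₁ E₀ 0 0 * Φ x₂ E₀ 0 1 - Φ x₂ E₀ 0 0 * Φ x₁ E₀ 0 1 ≠ 0 := by
    have hΦ0 : Φ x₀ E₀ = 1 := hY.mul_adjugate E₀ x₀
    have hd : ∀ j, HasDerivAt (fun x => Φ x E₀ 0 j)
        (-Complex.I * E₀ * Φ x₀ E₀ 0 j + q x₀ * Φ x₀ E₀ 1 j) x₀ := by
      intro j
      simp only [Φ, Matrix.mul_apply, Fin.sum_univ_two]
      refine (((hY.d0 E₀ x₀ 0).mul_const _).add ((hY.d0 E₀ x₀ 1).mul_const _)).congr_deriv ?_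
      ring
    have ha0 : Φ x₀ E₀ 0 0 ≠ 0 := by rw [hΦ0]; simp
    have hr := (hd 1).div (hd 0) ha0
    have hrd : HasDerivAt (fun x => Φ x E₀ 0 1 / Φ x E₀ 0 0) (q x₀) x₀ := by
      refine hr.congr_deriv ?_
      rw [hΦ0]
      simp
    have hne := hrd.eventually_ne hq0 (c := 0)
    have hane : ∀ᶠ x in 𝓝[≠] x₀, Φ x E₀ 0 0 ≠ 0 :=
      ((hd 0).continuousAt.eventually_ne ha0).filter_mono nhdsWithin_le_nhds
    obtain ⟨x₁, h1, h1a⟩ := (hne.and hane).exists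
    have hlim : ∀ᶠ x in 𝓝[≠] x₀, Φ x E₀ 0 1 / Φ x E₀ 0 0 ≠ Φ x₁ E₀ 0 1 / Φ x₁ E₀ 0 0 := by
      refine (hrd.continuousAt.eventually_ne ?_).filter_mono nhdsWithin_le_nhds
      rw [hΦ0]
      simpa using h1.symm
    obtain ⟨x₂, ⟨h2, h2a⟩, h2l⟩ := ((hne.and hane).and hlim).exists
    refine ⟨x₁, x₂, fun h => h1 (by rw [h, zero_div]), fun h => h2 (by rw [h, zero_div]), ?_⟩
    intro h
    apply h2l
    rw [div_eq_div_iff h2a h1a]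
    linear_combination h
  have hGn : n ≤ analyticOrderAt G E₀ := by
    have hden : AnalyticAt ℂ (fun E => 2 * (Φ x₁ E 0 0 * Φ x₂ E 0 1 -
        Φ x₂ E 0 0 * Φ x₁ E 0 1)) E₀ :=
      Differentiable.analyticAt ((((hΦd x₁ 0 0).mul (hΦd x₂ 0 1)).sub
        ((hΦd x₂ 0 0).mul (hΦd x₁ 0 1))).const_mul 2) E₀
    refine le_analyticOrderAt_of_mul hden hG (mul_ne_zero two_ne_zero hdet) ?_
    have e : (fun E => 2 * (Φ x₁ E 0 0 * Φ x₂ E 0 1 - Φ x₂ E 0 0 * Φ x₁ E 0 1) * G E) =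
        fun E => Φ x₂ E 0 1 *
          (2 * Φ x₁ E 0 0 * G E + Φ x₁ E 0 1 * monodromy Y Ω E x₀ 1 0) - Φ x₁ E 0 1 *
          (2 * Φ x₂ E 0 0 * G E + Φ x₂ E 0 1 * monodromy Y Ω E x₀ 1 0) := by
      funext E
      ring
    have hK : ∀ x, AnalyticAt ℂ
        (fun E => 2 * Φ x E 0 0 * G E + Φ x E 0 1 * monodromy Y Ω E x₀ 1 0) E₀ := fun x =>
      Differentiable.analyticAt (((hΦd x 0 0).const_mul 2).mul hGd |>.add
        ((hΦd x 0 1).mul (hMd 1 0))) E₀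
    rw [e]
    exact le_analyticOrderAt_fun_sub
      (le_analyticOrderAt_mul_right (hΦ x₂ 0 1) (hK x₁) (hcomb x₁ hb1))
      (le_analyticOrderAt_mul_right (hΦ x₁ 0 1) (hK x₂) (hcomb x₂ hb2))
  have hHn : n ≤ analyticOrderAt (fun E => monodromy Y Ω E x₀ 1 0) E₀ := by
    refine le_analyticOrderAt_of_mul (hΦ x₁ 0 1) (hM 1 0) hb1 ?_
    have e : (fun E => Φ x₁ E 0 1 * monodromy Y Ω E x₀ 1 0) =
        fun E => (2 * Φ x₁ E 0 0 * G E + Φ x₁ E 0 1 * monodromy Y Ω E x₀ 1 0) -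
          (2 * Φ x₁ E 0 0) * G E := by
      funext E
      ring
    rw [e]
    exact le_analyticOrderAt_fun_sub (hcomb x₁ hb1) (le_analyticOrderAt_mul_right
      (Differentiable.analyticAt ((hΦd x₁ 0 0).const_mul 2) E₀) hG hGn)
  have hlin : ∀ a b c : ℂ → ℂ, Differentiable ℂ a → Differentiable ℂ b → Differentiable ℂ c →
      n ≤ analyticOrderAt (fun E => a E * G E + b E * monodromy Y Ω E x₀ 1 0 +
        c E * monodromy Y Ω E x₀ 0 1) E₀ := fun a b c ha hb hc =>
    le_analyticOrderAt_fun_add (le_analyticOrderAt_fun_add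
      (le_analyticOrderAt_mul_right (ha.analyticAt E₀) hG hGn)
      (le_analyticOrderAt_mul_right (hb.analyticAt E₀) (hM 1 0) hHn))
      (le_analyticOrderAt_mul_right (hc.analyticAt E₀) (hM 0 1) (hF x₀))
  constructor
  · have e : (fun E => (monodromy Y Ω E x 0 0 - monodromy Y Ω E x 1 1) / 2) = fun E =>
        (Φ x E 0 0 * Φ x E 1 1 + Φ x E 0 1 * Φ x E 1 0) * G E +
        (Φ x E 0 1 * Φ x E 1 1) * monodromy Y Ω E x₀ 1 0 +
        (-(Φ x E 0 0 * Φ x E 1 0)) * monodromy Y Ω E x₀ 0 1 := by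
      funext E
      obtain ⟨h1, h2⟩ := hconj E x
      rw [h2, Matrix.adjugate_fin_two]
      simp [Matrix.mul_apply, Fin.sum_univ_two, G]
      ring
    rw [e]
    exact hlin _ _ _ (((hΦd x 0 0).mul (hΦd x 1 1)).add ((hΦd x 0 1).mul (hΦd x 1 0)))
      ((hΦd x 0 1).mul (hΦd x 1 1)) ((hΦd x 0 0).mul (hΦd x 1 0)).neg
  · have e : (fun E => monodromy Y Ω E x 1 0) = fun E =>
        (2 * (Φ x E 1 0 * Φ x E 1 1)) * G E +
        (Φ x E 1 1 * Φ x E 1 1) * monodromy Y Ω E x₀ 1 0 +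
        (-(Φ x E 1 0 * Φ x E 1 0)) * monodromy Y Ω E x₀ 0 1 := by
      funext E
      obtain ⟨h1, h2⟩ := hconj E x
      rw [h2, Matrix.adjugate_fin_two]
      simp [Matrix.mul_apply, Fin.sum_univ_two, G]
      ring
    rw [e]
    exact hlin _ _ _ (((hΦd x 1 0).mul (hΦd x 1 1)).const_mul 2)
      ((hΦd x 1 1).mul (hΦd x 1 1)) ((hΦd x 1 0).mul (hΦd x 1 0)).neg

end IsFundamental

/-- The order of the zeros of `τ'`, where `τ² - 4 = U D²`. -/
theorem le_analyticOrderAt_deriv_of_sq {τ D : ℂ → ℂ} {U : ℂ[X]} (hτ : Differentiable ℂ τ)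
    (hD : Differentiable ℂ D) (hU : ∀ E, τ E ^ 2 - 4 = U.eval E * D E ^ 2) (E₀ : ℂ) :
    analyticOrderAt D E₀ ≤ analyticOrderAt (deriv τ) E₀ := by
  by_cases h0 : analyticOrderAt D E₀ = 0
  · rw [h0]
    exact zero_le
  have hDE : D E₀ = 0 := apply_eq_zero_of_analyticOrderAt_ne_zero h0
  have hτ4 : τ E₀ ^ 2 = 4 := by
    have := hU E₀
    rw [hDE] at this
    linear_combination this
  have hτ0 : τ E₀ ≠ 0 := by
    intro h
    rw [h] at hτ4
    norm_num at hτ4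
  have hUd : Differentiable ℂ fun E => U.eval E := U.differentiable
  have e1 : analyticOrderAt (fun E => τ E ^ 2 - 4) E₀ = analyticOrderAt (fun E => τ E - τ E₀) E₀ := by
    have : (fun E => τ E ^ 2 - 4) = (fun E => τ E + τ E₀) * fun E => τ E - τ E₀ := by
      funext E
      simp only [Pi.mul_apply]
      linear_combination hτ4
    rw [this, analyticOrderAt_mul ((hτ.add_const _).analyticAt E₀)
      ((hτ.sub_const _).analyticAt E₀), ((hτ.add_const _).analyticAt E₀).analyticOrderAt_eq_zero.2
      (by simpa [← two_mul] using hτ0), zero_add]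
  have e2 : analyticOrderAt (fun E => τ E ^ 2 - 4) E₀ =
      analyticOrderAt (fun E => U.eval E) E₀ + 2 • analyticOrderAt D E₀ := by
    rw [show (fun E => τ E ^ 2 - 4) = (fun E => U.eval E) * D ^ 2 from funext hU,
      analyticOrderAt_mul (hUd.analyticAt E₀) ((hD.pow 2).analyticAt E₀),
      analyticOrderAt_pow (hD.analyticAt E₀)]
  have e3 := (hτ.analyticAt E₀).analyticOrderAt_deriv_add_one
  rw [← e1, e2] at e3
  have h1 : 1 ≤ analyticOrderAt D E₀ := Order.one_le_iff_pos.2 (pos_iff_ne_zero.2 h0)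
  have h2 : analyticOrderAt D E₀ + 1 ≤ analyticOrderAt (deriv τ) E₀ + 1 := by
    rw [e3, two_nsmul]
    exact (by gcongr : analyticOrderAt D E₀ + 1 ≤ analyticOrderAt D E₀ + analyticOrderAt D E₀).trans
      le_add_self
  exact (ENat.add_le_add_iff_right ENat.one_ne_top).1 h2

/-- If the values of a polynomial depending on `x` have derivatives that are values of a
polynomial, then so do the coefficients: they are fixed linear combinations of finitely many
values, by Lagrange interpolation. -/
theorem hasDerivAt_coeff_of_hasDerivAt_eval {P : ℝ → ℂ[X]} {R : ℂ[X]} {N : ℕ} {S : Set ℂ} {x : ℝ}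
    (hS : S.Infinite) (hP : ∀ x, (P x).natDegree < N) (hR : R.natDegree < N)
    (h : ∀ E ∈ S, HasDerivAt (fun x => (P x).eval E) (R.eval E) x) (k : ℕ) :
    HasDerivAt (fun x => (P x).coeff k) (R.coeff k) x := by
  obtain ⟨s, hsS, hsN⟩ := hS.exists_subset_card_eq N
  have key : ∀ T : ℂ[X], T.natDegree < N →
      T.coeff k = ∑ E ∈ s, T.eval E * (Lagrange.basis s id E).coeff k := by
    intro T hT
    have hdeg : T.degree < s.card := by
      rw [hsN]
      exact lt_of_le_of_lt T.degree_le_natDegree (by exact_mod_cast hT)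
    have := Lagrange.eq_interpolate (v := id) (injOn_id _) hdeg
    conv_lhs => rw [this, Lagrange.interpolate_apply, finsetSum_coeff]
    simp
  simp only [fun x => key (P x) (hP x)]
  rw [key R hR]
  exact HasDerivAt.fun_sum fun E hE => (h E (hsS hE)).mul_const _

theorem infinite_setOf_ne_zero {D : ℂ → ℂ} (hD : Differentiable ℂ D)
    (hD0 : ∀ E, analyticOrderAt D E ≠ ⊤) : {E | D E ≠ 0}.Infinite := by
  have hev : ∀ᶠ E in 𝓝[≠] (0 : ℂ), D E ≠ 0 := by
    rcases (hD.analyticAt 0).eventually_eq_zero_or_eventually_ne_zero with h | h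
    · exact absurd (analyticOrderAt_eq_top.2 h) (hD0 0)
    · exact h
  have hnhds : insert (0 : ℂ) {E | D E ≠ 0} ∈ 𝓝 (0 : ℂ) := insert_mem_nhds_iff.2 hev
  refine ((infinite_of_mem_nhds (0 : ℂ) hnhds).sdiff (finite_singleton 0)).mono ?_
  rintro E ⟨rfl | h, h'⟩
  · exact absurd rfl h'
  · exact h

/-- Polynomials `F`, `G`, `H` in the spectral parameter, with coefficients depending on `x`, such
that the matrix `!![G, F; H, -G]` commutes with the differential equation and has determinant
`-U / 4`. The coefficient of `E ^ m` is the constant diagonal matrix with entries `g` and `-g`. -/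
structure IsPolynomialMonodromy (p q : ℝ → ℂ) (m : ℕ) (g : ℂ) (F G H : ℝ → ℂ[X]) (U : ℂ[X]) :
    Prop where
  natDegree_F : ∀ x, (F x).natDegree ≤ m
  natDegree_G : ∀ x, (G x).natDegree ≤ m
  natDegree_H : ∀ x, (H x).natDegree ≤ m
  coeff_F : ∀ x, (F x).coeff m = 0
  coeff_G : ∀ x, (G x).coeff m = g
  coeff_H : ∀ x, (H x).coeff m = 0
  ne_zero : g ≠ 0
  hasDerivAt_F : ∀ k x, HasDerivAt (fun x => (F x).coeff k)
    ((C (-2 * Complex.I) * X * F x - C (2 * q x) * G x).coeff k) x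
  hasDerivAt_G : ∀ k x, HasDerivAt (fun x => (G x).coeff k)
    ((C (q x) * H x - C (p x) * F x).coeff k) x
  hasDerivAt_H : ∀ k x, HasDerivAt (fun x => (H x).coeff k)
    ((C (2 * Complex.I) * X * H x + C (2 * p x) * G x).coeff k) x
  discr : ∀ x, U = 4 * (G x ^ 2 + F x * H x)

/-- The lower bound for `τ² - 4` on large circles excludes `U = 0` and `D = 0`. -/
theorem ne_zero_of_sq_sub_four {τ D : ℂ → ℂ} {U : ℂ[X]} {Ω C R : ℝ} (hΩ : 0 < Ω) (hC : 0 < C)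
    (hτ : ∀ E : ℂ, R ≤ ‖E‖ →
      ‖τ E - 2 * Complex.cos (E * Ω)‖ ≤ C / ‖E‖ * Real.exp (|E.im| * Ω))
    (hU : ∀ E, τ E ^ 2 - 4 = U.eval E * D E ^ 2) (hD : Differentiable ℂ D) :
    U ≠ 0 ∧ ∀ E, analyticOrderAt D E ≠ ⊤ := by
  obtain ⟨k₀, hk₀⟩ := exists_norm_sq_sub_four_ge hΩ hC hτ
  have hpos : 0 ≤ ((k₀ : ℝ) + 1 / 2) * Real.pi / Ω := by positivity
  have h := hk₀ k₀ le_rfl (((k₀ : ℝ) + 1 / 2) * Real.pi / Ω : ℝ)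
    (by rw [Complex.norm_real, Real.norm_of_nonneg hpos])
  rw [hU] at h
  constructor
  · rintro rfl
    rw [eval_zero, zero_mul, norm_zero] at h
    have : 0 < Real.exp (|(((k₀ + 1 / 2) * Real.pi / Ω : ℝ) : ℂ).im| * Ω) ^ 2 / 18 := by positivity
    linarith
  · intro E hE
    have hD0 : D = 0 := by
      have := AnalyticOnNhd.eqOn_zero_of_preconnected_of_eventuallyEq_zero
        (f := D) (U := univ) (fun z _ => hD.analyticAt z) isPreconnected_univ (mem_univ E)
        (analyticOrderAt_eq_top.1 hE)
      exact funext fun z => this (mem_univ z)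
    rw [hD0, Pi.zero_apply, zero_pow two_ne_zero, mul_zero, norm_zero] at h
    have : 0 < Real.exp (|(((k₀ + 1 / 2) * Real.pi / Ω : ℝ) : ℂ).im| * Ω) ^ 2 / 18 := by positivity
    linarith

/-- If `q` vanishes identically then every `E` is a Dirichlet eigenvalue of infinite algebraic
multiplicity. -/
theorem exists_q_ne_zero {p q : ℝ → ℂ} {Y : ℂ → ℝ → Matrix (Fin 2) (Fin 2) ℂ}
    (hY : IsFundamental p q Y) (hpc : Continuous p) (hqc : Continuous q) {Ω : ℝ} (hΩ : 0 < Ω)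
    (hp : Function.Periodic p Ω) (hq : Function.Periodic q Ω) {E : ℂ}
    (h : deltaImm p q Ω E ≠ ⊤) : ∃ x, q x ≠ 0 := by
  by_contra! hq0
  have h01 : ∀ E x, Y E x 0 1 = 0 := by
    intro E x
    have hd : ∀ x, HasDerivAt (fun x : ℝ => Complex.exp (Complex.I * E * x) * Y E x 0 1) 0 x := by
      intro x
      have h1 : HasDerivAt (fun x : ℝ => Complex.I * E * (x : ℂ)) (Complex.I * E * 1) x :=
        (Complex.ofRealCLM.hasDerivAt (x := x)).const_mul _
      refine (h1.cexp.mul (hY.d0 E x 1)).congr_deriv ?_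
      rw [hq0]
      ring
    have := is_const_of_deriv_eq_zero (fun x => (hd x).differentiableAt) (fun x => (hd x).deriv) x 0
    simp only [hY.init, Complex.ofReal_zero, mul_zero, Complex.exp_zero, one_mul] at this
    simpa using this
  refine h (iInf_eq_top.2 fun x => ?_)
  rw [hY.delta_eq hpc hqc hΩ hp hq, analyticOrderAt_eq_top]
  refine Eventually.of_forall fun E => ?_
  simp [monodromy, Matrix.adjugate_fin_two, Matrix.mul_apply, Fin.sum_univ_two, h01]

/-- The traceless part of the monodromy matrix is `D` times a polynomial in `E`. -/
theorem IsFundamental.exists_isPolynomialMonodromy {p q : ℝ → ℂ}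
    {Y : ℂ → ℝ → Matrix (Fin 2) (Fin 2) ℂ} (hY : IsFundamental p q Y)
    (hpC : ContDiff ℝ 1 p) (hqC : ContDiff ℝ 1 q) {Ω : ℝ} (hΩ : 0 < Ω)
    (hp : Function.Periodic p Ω) (hq : Function.Periodic q Ω) {D : ℂ → ℂ}
    (hD : IsImmovableFactor p q Ω D) {U : ℂ[X]}
    (hU : ∀ E : ℂ, discr hp hq E = U.eval E * D E ^ 2) :
    ∃ (n : ℕ) (g : ℂ) (F G H : ℝ → ℂ[X]), U.natDegree = 2 * (n + 1) ∧
      IsPolynomialMonodromy p q (n + 1) g F G H U ∧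
      ∀ x E, monodromy Y Ω E x 0 1 = (F x).eval E * D E := by
  have hpc := hpC.continuous
  have hqc := hqC.continuous
  obtain ⟨hDd, hDo⟩ := hD
  have hτU : ∀ E, (Y E Ω).trace ^ 2 - 4 = U.eval E * D E ^ 2 := by
    intro E
    rw [← hU, AKNS.discr, hY.trace_floquetOperator hp hq]
  have hasymp := fun x => hY.exists_monodromy_asymptotics hpC hqC hΩ hp hq x
  obtain ⟨C₀, R₀, hC₀, -, has₀⟩ := hasymp 0
  have hτ₀ := fun E hE => (has₀ E hE).2
  obtain ⟨hU0, hD0⟩ := ne_zero_of_sq_sub_four hΩ hC₀ hτ₀ hτU hDd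
  obtain ⟨x₀, hx₀⟩ := exists_q_ne_zero hY hpc hqc hΩ hp hq (E := 0) (by rw [← hDo]; exact hD0 0)
  have hFo : ∀ E x, analyticOrderAt D E ≤ analyticOrderAt (fun E => monodromy Y Ω E x 0 1) E := by
    intro E x
    rw [hDo, ← hY.delta_eq hpc hqc hΩ hp hq]
    exact iInf_le _ x
  have hGHo := fun E x => hY.le_analyticOrderAt_monodromy (hFo E) hx₀ x
  set m := U.natDegree / 2
  have hquot : ∀ f : ℂ → ℝ → ℂ, (∀ x, Differentiable ℂ fun E => f E x) →
      (∀ E x, analyticOrderAt D E ≤ analyticOrderAt (fun E => f E x) E) →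
      (∀ x, ∃ C R : ℝ, ∀ E : ℂ, R ≤ ‖E‖ → ‖f E x‖ ≤ C * Real.exp (|E.im| * Ω)) →
      ∃ P : ℝ → ℂ[X], (∀ x, (P x).natDegree ≤ m) ∧ ∀ x E, f E x = (P x).eval E * D E := by
    intro f hf hfo hfb
    have : ∀ x, ∃ P : ℂ[X], P.natDegree ≤ m ∧ ∀ E, f E x = P.eval E * D E := by
      intro x
      obtain ⟨k, hk, hfk⟩ := exists_entire_quotient hDd (hf x) hD0 fun E => hfo E x
      obtain ⟨C, R, hb⟩ := hfb x
      obtain ⟨P, hP, hkP⟩ := exists_polynomial_of_mul_eq hΩ hC₀ hτ₀ hτU hk hfk hb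
      exact ⟨P, hP, fun E => by rw [hfk, hkP]⟩
    choose P hP hfP using this
    exact ⟨P, hP, hfP⟩
  have hMb : ∀ i j x, ∃ C R : ℝ, ∀ E : ℂ, R ≤ ‖E‖ →
      ‖monodromy Y Ω E x i j‖ ≤ C * Real.exp (|E.im| * Ω) := by
    intro i j x
    obtain ⟨C, R, -, -, h⟩ := hasymp x
    exact ⟨C, R, fun E hE => (h E hE).1 i j⟩
  obtain ⟨F, hFdeg, hF⟩ := hquot (fun E x => monodromy Y Ω E x 0 1)
    (fun x => hY.monodromy_entire Ω x 0 1) hFo (hMb 0 1)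
  obtain ⟨H, hHdeg, hH⟩ := hquot (fun E x => monodromy Y Ω E x 1 0)
    (fun x => hY.monodromy_entire Ω x 1 0) (fun E x => (hGHo E x).2) (hMb 1 0)
  obtain ⟨G, hGdeg, hG⟩ := hquot
    (fun E x => (monodromy Y Ω E x 0 0 - monodromy Y Ω E x 1 1) / 2)
    (fun x => ((hY.monodromy_entire Ω x 0 0).sub (hY.monodromy_entire Ω x 1 1)).div_const 2)
    (fun E x => (hGHo E x).1) (fun x => by
      obtain ⟨C, R, -, -, h⟩ := hasymp x
      refine ⟨C, R, fun E hE => ?_⟩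
      have h0 := (h E hE).1 0 0
      have h1 := (h E hE).1 1 1
      rw [norm_div, Complex.norm_ofNat]
      linarith [norm_sub_le (monodromy Y Ω E x 0 0) (monodromy Y Ω E x 1 1)])
  have hinf := infinite_setOf_ne_zero hDd hD0
  have hlt : ∀ {P : ℂ[X]}, P.natDegree ≤ m → P.natDegree < m + 2 := fun h => by omega
  have hXdeg : ∀ (c : ℂ) {P : ℂ[X]}, P.natDegree ≤ m → (C c * X * P).natDegree ≤ m + 1 := by
    intro c P hP
    refine natDegree_mul_le.trans ?_
    have : (C c * X).natDegree ≤ 1 := (natDegree_C_mul_le c X).trans natDegree_X_le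
    omega
  have hCdeg : ∀ (c : ℂ) {P : ℂ[X]}, P.natDegree ≤ m → (C c * P).natDegree ≤ m + 1 := by
    intro c P hP
    exact (natDegree_C_mul_le c P).trans (by omega)
  have hFd : ∀ k x, HasDerivAt (fun x => (F x).coeff k)
      ((C (-2 * Complex.I) * X * F x - C (2 * q x) * G x).coeff k) x := by
    intro k x
    refine hasDerivAt_coeff_of_hasDerivAt_eval hinf (fun x => hlt (hFdeg x)) (N := m + 2)
      (Nat.lt_succ_of_le ((natDegree_sub_le _ _).trans
        (max_le (hXdeg _ (hFdeg x)) (hCdeg _ (hGdeg x))))) (fun E hE => ?_) k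
    have h := (hY.hasDerivAt_monodromyF Ω E x).div_const (D E)
    simp only [hF, hG, mul_div_cancel_right₀ _ (show D E ≠ 0 from hE)] at h
    refine h.congr_deriv ?_
    have hE' : D E ≠ 0 := hE
    simp
    field_simp
  have hGd : ∀ k x, HasDerivAt (fun x => (G x).coeff k)
      ((C (q x) * H x - C (p x) * F x).coeff k) x := by
    intro k x
    refine hasDerivAt_coeff_of_hasDerivAt_eval hinf (fun x => hlt (hGdeg x)) (N := m + 2)
      (Nat.lt_succ_of_le ((natDegree_sub_le _ _).trans
        (max_le (hCdeg _ (hHdeg x)) (hCdeg _ (hFdeg x))))) (fun E hE => ?_) k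
    have h := (hY.hasDerivAt_monodromyG Ω E x).div_const (D E)
    simp only [hF, hG, hH, mul_div_cancel_right₀ _ (show D E ≠ 0 from hE)] at h
    refine h.congr_deriv ?_
    have hE' : D E ≠ 0 := hE
    simp
    field_simp
  have hHd : ∀ k x, HasDerivAt (fun x => (H x).coeff k)
      ((C (2 * Complex.I) * X * H x + C (2 * p x) * G x).coeff k) x := by
    intro k x
    refine hasDerivAt_coeff_of_hasDerivAt_eval hinf (fun x => hlt (hHdeg x)) (N := m + 2)
      (Nat.lt_succ_of_le ((natDegree_add_le _ _).trans
        (max_le (hXdeg _ (hHdeg x)) (hCdeg _ (hGdeg x))))) (fun E hE => ?_) k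
    have h := (hY.hasDerivAt_monodromyH Ω E x).div_const (D E)
    simp only [hH, hG, mul_div_cancel_right₀ _ (show D E ≠ 0 from hE)] at h
    refine h.congr_deriv ?_
    have hE' : D E ≠ 0 := hE
    simp
    field_simp
  have hdisc : ∀ x, U = 4 * (G x ^ 2 + F x * H x) := by
    intro x
    refine Polynomial.eq_of_infinite_eval_eq _ _ (hinf.mono fun E hE => ?_)
    have hE' : D E ≠ 0 := hE
    have h := hU E
    rw [hY.discr_eq hp hq E x, hF, hH, hG] at h
    have h2 : D E ^ 2 ≠ 0 := pow_ne_zero 2 hE'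
    change U.eval E = (4 * (G x ^ 2 + F x * H x) : ℂ[X]).eval E
    rw [eval_mul, eval_add, eval_pow, eval_mul, eval_ofNat]
    refine mul_right_cancel₀ h2 ?_
    rw [← h]
    ring
  -- The equations for `F'` and `H'` in degree `m + 1`.
  have hXcoeff : ∀ (c : ℂ) (P : ℂ[X]) (k : ℕ), (C c * X * P).coeff (k + 1) = c * P.coeff k := by
    intro c P k
    rw [mul_assoc, coeff_C_mul, coeff_X_mul]
  have hhigh : ∀ {P : ℂ[X]}, P.natDegree ≤ m → P.coeff (m + 1) = 0 := fun h =>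
    coeff_eq_zero_of_natDegree_lt (by omega)
  have hFm : ∀ x, (F x).coeff m = 0 := by
    intro x
    have h0 : HasDerivAt (fun x => (F x).coeff (m + 1)) 0 x := by
      simp only [fun x => hhigh (hFdeg x)]
      exact hasDerivAt_const _ _
    have := (hFd (m + 1) x).unique h0
    rw [coeff_sub, hXcoeff, coeff_C_mul, hhigh (hGdeg x)] at this
    simpa using this
  have hHm : ∀ x, (H x).coeff m = 0 := by
    intro x
    have h0 : HasDerivAt (fun x => (H x).coeff (m + 1)) 0 x := by
      simp only [fun x => hhigh (hHdeg x)]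
      exact hasDerivAt_const _ _
    have := (hHd (m + 1) x).unique h0
    rw [coeff_add, hXcoeff, coeff_C_mul, hhigh (hGdeg x)] at this
    simpa using this
  have hGm : ∀ x, (G x).coeff m = (G 0).coeff m := by
    intro x
    refine is_const_of_deriv_eq_zero (f := fun x => (G x).coeff m)
      (fun x => (hGd m x).differentiableAt) (fun x => ?_) x 0
    rw [(hGd m x).deriv, coeff_sub, coeff_C_mul, coeff_C_mul, hFm, hHm]
    simp
  set g := (G 0).coeff m
  have hUle : U.natDegree ≤ 2 * m := by
    rw [hdisc 0]
    refine natDegree_mul_le.trans ?_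
    rw [show ((4 : ℂ[X])).natDegree = 0 from natDegree_ofNat 4, zero_add]
    refine (natDegree_add_le _ _).trans (max_le ?_ ?_)
    · exact natDegree_pow_le.trans (by have := hGdeg 0; omega)
    · exact natDegree_mul_le.trans (by have := hFdeg 0; have := hHdeg 0; omega)
  have hUeq : U.natDegree = 2 * m := by omega
  have hUcoeff : U.coeff (2 * m) = 4 * g ^ 2 := by
    rw [hdisc 0, show (4 : ℂ[X]) = C 4 from rfl, coeff_C_mul, coeff_add, two_mul,
      coeff_mul_add_eq_of_natDegree_le (hFdeg 0) (hHdeg 0), pow_two,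
      coeff_mul_add_eq_of_natDegree_le (hGdeg 0) (hGdeg 0), hFm, zero_mul, add_zero, pow_two]
  have hg : g ≠ 0 := by
    intro h
    rw [h, ← hUeq, coeff_natDegree, zero_pow two_ne_zero, mul_zero] at hUcoeff
    exact hU0 (leadingCoeff_eq_zero.1 hUcoeff)
  have hm : m ≠ 0 := by
    intro h0
    have h1 : HasDerivAt (fun x => (F x).coeff m) 0 x₀ := by
      simp only [hFm]
      exact hasDerivAt_const _ _
    have := (hFd m x₀).unique h1
    rw [coeff_sub, coeff_C_mul, hGm] at this
    rw [h0, mul_assoc, coeff_C_mul, coeff_X_mul_zero, mul_zero, zero_sub] at this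
    simp only [neg_eq_zero, mul_eq_zero] at this
    rcases this with (h | h) | h
    · norm_num at h
    · exact hx₀ h
    · exact hg h
  obtain ⟨n, hn⟩ := Nat.exists_eq_succ_of_ne_zero hm
  rw [Nat.succ_eq_add_one] at hn
  refine ⟨n, g, F, G, H, by omega, ?_, hF⟩
  rw [← hn]
  exact ⟨hFdeg, hGdeg, hHdeg, hFm, hGm, hHm, hg, hFd, hGd, hHd, hdisc⟩

/-! ### Smoothness of the coefficients and the commuting differential expression -/

namespace IsPolynomialMonodromy

variable {p q : ℝ → ℂ} {n : ℕ} {g : ℂ} {F G H : ℝ → ℂ[X]} {U : ℂ[X]}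

theorem coeff_C_mul_X_mul_succ (c : ℂ) (P : ℂ[X]) (k : ℕ) :
    (C c * X * P).coeff (k + 1) = c * P.coeff k := by
  rw [mul_assoc, coeff_C_mul, coeff_X_mul]

theorem coeff_C_mul_X_mul_zero (c : ℂ) (P : ℂ[X]) : (C c * X * P).coeff 0 = 0 := by
  rw [mul_assoc, coeff_C_mul, coeff_X_mul_zero, mul_zero]

/-- The potential `q` is, up to a constant, the leading coefficient of `F`. -/
theorem coeff_F_eq (h : IsPolynomialMonodromy p q (n + 1) g F G H U) (x : ℝ) :
    (F x).coeff n = Complex.I * g * q x := by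
  have h0 : HasDerivAt (fun x => (F x).coeff (n + 1)) 0 x := by
    simp only [h.coeff_F]
    exact hasDerivAt_const _ _
  have := (h.hasDerivAt_F (n + 1) x).unique h0
  rw [coeff_sub, coeff_C_mul_X_mul_succ, coeff_C_mul, h.coeff_G] at this
  linear_combination (Complex.I / 2) * this + ((F x).coeff n) * Complex.I_mul_I

theorem coeff_H_eq (h : IsPolynomialMonodromy p q (n + 1) g F G H U) (x : ℝ) :
    (H x).coeff n = Complex.I * g * p x := by
  have h0 : HasDerivAt (fun x => (H x).coeff (n + 1)) 0 x := by
    simp only [h.coeff_H]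
    exact hasDerivAt_const _ _
  have := (h.hasDerivAt_H (n + 1) x).unique h0
  rw [coeff_add, coeff_C_mul_X_mul_succ, coeff_C_mul, h.coeff_G] at this
  linear_combination (-Complex.I / 2) * this + ((H x).coeff n) * Complex.I_mul_I

/-- The coefficients of `F`, `G`, `H` satisfy an autonomous polynomial system of differential
equations, so that they are smooth. -/
theorem contDiff_coeff (h : IsPolynomialMonodromy p q (n + 1) g F G H U) :
    (∀ k, ContDiff ℝ ∞ fun x => (F x).coeff k) ∧ (∀ k, ContDiff ℝ ∞ fun x => (G x).coeff k) ∧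
      ∀ k, ContDiff ℝ ∞ fun x => (H x).coeff k := by
  have hIg : Complex.I * g ≠ 0 := mul_ne_zero Complex.I_ne_zero h.ne_zero
  have hqF : q = fun x => (Complex.I * g)⁻¹ * (F x).coeff n := by
    funext x
    rw [h.coeff_F_eq, inv_mul_cancel_left₀ hIg]
  have hpH : p = fun x => (Complex.I * g)⁻¹ * (H x).coeff n := by
    funext x
    rw [h.coeff_H_eq, inv_mul_cancel_left₀ hIg]
  have key : ∀ N : ℕ, (∀ k, ContDiff ℝ N fun x => (F x).coeff k) ∧
      (∀ k, ContDiff ℝ N fun x => (G x).coeff k) ∧ ∀ k, ContDiff ℝ N fun x => (H x).coeff k := by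
    intro N
    induction N with
    | zero =>
      refine ⟨fun k => ?_, fun k => ?_, fun k => ?_⟩
      · exact contDiff_zero.2 (continuous_iff_continuousAt.2 fun x =>
          (h.hasDerivAt_F k x).continuousAt)
      · exact contDiff_zero.2 (continuous_iff_continuousAt.2 fun x =>
          (h.hasDerivAt_G k x).continuousAt)
      · exact contDiff_zero.2 (continuous_iff_continuousAt.2 fun x =>
          (h.hasDerivAt_H k x).continuousAt)
    | succ N ih =>
      obtain ⟨iF, iG, iH⟩ := ih
      have iq : ContDiff ℝ N q := by
        rw [hqF]
        exact contDiff_const.mul (iF n)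
      have ip : ContDiff ℝ N p := by
        rw [hpH]
        exact contDiff_const.mul (iH n)
      have hsucc : ∀ f f' : ℝ → ℂ, (∀ x, HasDerivAt f (f' x) x) → ContDiff ℝ N f' →
          ContDiff ℝ ((N + 1 : ℕ) : WithTop ℕ∞) f := by
        intro f f' hf hf'
        rw [show ((N + 1 : ℕ) : WithTop ℕ∞) = (N : WithTop ℕ∞) + 1 from by push_cast; rfl,
          contDiff_succ_iff_deriv]
        refine ⟨fun x => (hf x).differentiableAt, by simp, ?_⟩
        rwa [show deriv f = f' from funext fun x => (hf x).deriv]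
      have hXF : ∀ (c : ℂ) (P : ℝ → ℂ[X]), (∀ k, ContDiff ℝ N fun x => (P x).coeff k) →
          ∀ k, ContDiff ℝ N fun x => (C c * X * P x).coeff k := by
        intro c P hP k
        rcases k with _ | k
        · simp only [coeff_C_mul_X_mul_zero]
          exact contDiff_const
        · simp only [coeff_C_mul_X_mul_succ]
          exact contDiff_const.mul (hP k)
      refine ⟨fun k => ?_, fun k => ?_, fun k => ?_⟩
      · refine hsucc _ _ (h.hasDerivAt_F k) ?_
        simp only [coeff_sub]
        refine (hXF _ F iF k).sub ?_
        simp only [coeff_C_mul]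
        exact (contDiff_const.mul iq).mul (iG k)
      · refine hsucc _ _ (h.hasDerivAt_G k) ?_
        simp only [coeff_sub, coeff_C_mul]
        exact (iq.mul (iH k)).sub (ip.mul (iF k))
      · refine hsucc _ _ (h.hasDerivAt_H k) ?_
        simp only [coeff_add]
        refine (hXF _ H iH k).add ?_
        simp only [coeff_C_mul]
        exact (contDiff_const.mul ip).mul (iG k)
  exact ⟨fun k => contDiff_infty.2 fun N => (key N).1 k,
    fun k => contDiff_infty.2 fun N => (key N).2.1 k,
    fun k => contDiff_infty.2 fun N => (key N).2.2 k⟩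

theorem contDiff_q (h : IsPolynomialMonodromy p q (n + 1) g F G H U) : ContDiff ℝ ∞ q := by
  have hIg : Complex.I * g ≠ 0 := mul_ne_zero Complex.I_ne_zero h.ne_zero
  have hqF : q = fun x => (Complex.I * g)⁻¹ * (F x).coeff n := by
    funext x
    rw [h.coeff_F_eq, inv_mul_cancel_left₀ hIg]
  rw [hqF]
  exact contDiff_const.mul (h.contDiff_coeff.1 n)

theorem contDiff_p (h : IsPolynomialMonodromy p q (n + 1) g F G H U) : ContDiff ℝ ∞ p := by
  have hIg : Complex.I * g ≠ 0 := mul_ne_zero Complex.I_ne_zero h.ne_zero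
  have hpH : p = fun x => (Complex.I * g)⁻¹ * (H x).coeff n := by
    funext x
    rw [h.coeff_H_eq, inv_mul_cancel_left₀ hIg]
  rw [hpH]
  exact contDiff_const.mul (h.contDiff_coeff.2.2 n)

theorem leadingCoeff (h : IsPolynomialMonodromy p q n g F G H U) : U.coeff (2 * n) = 4 * g ^ 2 := by
  rw [h.discr 0, show (4 : ℂ[X]) = C 4 from rfl, coeff_C_mul, coeff_add, two_mul,
    coeff_mul_add_eq_of_natDegree_le (h.natDegree_F 0) (h.natDegree_H 0), pow_two,
    coeff_mul_add_eq_of_natDegree_le (h.natDegree_G 0) (h.natDegree_G 0), h.coeff_F, h.coeff_G,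
    zero_mul, add_zero, pow_two]

end IsPolynomialMonodromy

theorem L_apply_zero (p q : ℝ → ℂ) (y : VecFun) (x : ℝ) :
    L p q y x 0 = Complex.I * deriv y x 0 - Complex.I * q x * y x 1 := by
  simp [L, J, Q, dotProduct, Fin.sum_univ_two]
  ring

theorem L_apply_one (p q : ℝ → ℂ) (y : VecFun) (x : ℝ) :
    L p q y x 1 = -Complex.I * deriv y x 1 + Complex.I * p x * y x 0 := by
  simp [L, J, Q, dotProduct, Fin.sum_univ_two]

theorem contDiff_L {p q : ℝ → ℂ} (hp : ContDiff ℝ ∞ p) (hq : ContDiff ℝ ∞ q) {y : VecFun}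
    (hy : ContDiff ℝ ∞ y) : ContDiff ℝ ∞ (L p q y) := by
  have hd : ContDiff ℝ ∞ (deriv y) := (contDiff_infty_iff_deriv.1 hy).2
  rw [contDiff_pi]
  rw [contDiff_pi] at hd hy
  intro i
  fin_cases i
  · change ContDiff ℝ ∞ fun x => L p q y x 0
    simp only [L_apply_zero]
    exact (contDiff_const.mul (hd 0)).sub ((contDiff_const.mul hq).mul (hy 1))
  · change ContDiff ℝ ∞ fun x => L p q y x 1
    simp only [L_apply_one]
    exact (contDiff_const.mul (hd 1)).add ((contDiff_const.mul hp).mul (hy 0))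

theorem contDiff_iterate_L {p q : ℝ → ℂ} (hp : ContDiff ℝ ∞ p) (hq : ContDiff ℝ ∞ q) {y : VecFun}
    (hy : ContDiff ℝ ∞ y) (k : ℕ) : ContDiff ℝ ∞ ((L p q)^[k] y) := by
  induction k with
  | zero => exact hy
  | succ k ih =>
    rw [Function.iterate_succ_apply']
    exact contDiff_L hp hq ih

/-- The components of `L z` determine the derivative of `z`. -/
theorem hasDerivAt_of_L {p q : ℝ → ℂ} {z : VecFun} (hz : ContDiff ℝ ∞ z) (x : ℝ) :
    HasDerivAt (fun x => z x 0) (-Complex.I * L p q z x 0 + q x * z x 1) x ∧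
      HasDerivAt (fun x => z x 1) (p x * z x 0 + Complex.I * L p q z x 1) x := by
  have hd : HasDerivAt z (deriv z x) x :=
    ((hz.differentiable (by simp)) x).hasDerivAt
  rw [hasDerivAt_pi] at hd
  refine ⟨(hd 0).congr_deriv ?_, (hd 1).congr_deriv ?_⟩
  · rw [L_apply_zero]
    linear_combination (deriv z x 0 - q x * z x 1) * Complex.I_mul_I
  · rw [L_apply_one]
    linear_combination (deriv z x 1 - p x * z x 0) * Complex.I_mul_I

/-- The linear functional on polynomials that sends `X ^ k` to `a k`. -/
noncomputable def momentFunctional (a : ℕ → ℂ) : ℂ[X] →ₗ[ℂ] ℂ :=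
  Polynomial.lsum fun k => LinearMap.mulRight ℂ (a k)

theorem momentFunctional_eq_sum (a : ℕ → ℂ) {P : ℂ[X]} {N : ℕ} (hP : P.natDegree < N) :
    momentFunctional a P = ∑ k ∈ Finset.range N, P.coeff k * a k := by
  rw [momentFunctional, lsum_apply, sum_over_range' _ _ N hP]
  · rfl
  · simp

theorem momentFunctional_mul (a : ℕ → ℂ) (P R : ℂ[X]) {N : ℕ} (hP : P.natDegree < N) :
    momentFunctional a (P * R) =
      ∑ j ∈ Finset.range N, P.coeff j * momentFunctional (fun k => a (k + j)) R := by
  conv_lhs => rw [P.as_sum_range_C_mul_X_pow' hP, Finset.sum_mul, map_sum]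
  refine Finset.sum_congr rfl fun j _ => ?_
  rw [mul_assoc, ← smul_eq_C_mul, map_smul, smul_eq_mul]
  congr 1
  have hdeg : (X ^ j * R).natDegree < R.natDegree + 1 + j := by
    refine lt_of_le_of_lt natDegree_mul_le ?_
    rw [natDegree_X_pow]
    omega
  rw [momentFunctional_eq_sum _ hdeg, momentFunctional_eq_sum _ (Nat.lt_succ_self R.natDegree),
    add_comm _ j, Finset.sum_range_add]
  rw [Finset.sum_eq_zero (fun i hi => by
    rw [coeff_X_pow_mul', if_neg (by have := Finset.mem_range.1 hi; omega), zero_mul]), zero_add]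
  refine Finset.sum_congr rfl fun k _ => ?_
  rw [add_comm j k, coeff_X_pow_mul]

theorem momentFunctional_X_mul (a : ℕ → ℂ) (P : ℂ[X]) :
    momentFunctional a (X * P) = momentFunctional (fun k => a (k + 1)) P := by
  rw [momentFunctional_mul a X P (N := 2) (by rw [natDegree_X]; omega)]
  simp [Finset.sum_range_succ]

/-- The values at `x` of the component `i` of the iterates `Lᵏ y`. -/
noncomputable def iterComp (p q : ℝ → ℂ) (y : VecFun) (x : ℝ) (i : Fin 2) (k : ℕ) : ℂ :=
  (L p q)^[k] y x i

/-- The expression `∑ₖ Mₖ(x) Lᵏ y`, where `∑ₖ Mₖ(x) Eᵏ` is the matrix with entries `G`, `F`, `H`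
and `-G`. -/
noncomputable def monodromyExpr (p q : ℝ → ℂ) (F G H : ℝ → ℂ[X]) (y : VecFun) : VecFun := fun x =>
  ![momentFunctional (iterComp p q y x 0) (G x) + momentFunctional (iterComp p q y x 1) (F x),
    momentFunctional (iterComp p q y x 0) (H x) - momentFunctional (iterComp p q y x 1) (G x)]

theorem polyL_apply (p q : ℝ → ℂ) (R : ℂ[X]) (y : VecFun) (x : ℝ) (i : Fin 2) :
    polyL p q R y x i = momentFunctional (iterComp p q y x i) R := by
  rw [polyL, momentFunctional, lsum_apply, sum_def, sum_def, Finset.sum_apply, Finset.sum_apply]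
  rfl

theorem hasDerivAt_momentFunctional {a : ℝ → ℕ → ℂ} {a' : ℕ → ℂ} {P : ℝ → ℂ[X]} {R : ℂ[X]} {N : ℕ}
    {x : ℝ} (hP : ∀ x, (P x).natDegree < N) (hR : R.natDegree < N)
    (ha : ∀ k, HasDerivAt (fun x => a x k) (a' k) x)
    (hPR : ∀ k, HasDerivAt (fun x => (P x).coeff k) (R.coeff k) x) :
    HasDerivAt (fun x => momentFunctional (a x) (P x))
      (momentFunctional (a x) R + momentFunctional a' (P x)) x := by
  simp only [fun x => momentFunctional_eq_sum (a x) (hP x), momentFunctional_eq_sum _ hR,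
    momentFunctional_eq_sum _ (hP x)]
  rw [← Finset.sum_add_distrib]
  exact HasDerivAt.fun_sum fun k _ => (hPR k).mul (ha k)

theorem momentFunctional_comb (a b : ℕ → ℂ) (c d : ℂ) (P : ℂ[X]) :
    momentFunctional (fun k => c * a k + d * b k) P =
      c * momentFunctional a P + d * momentFunctional b P := by
  simp only [momentFunctional_eq_sum _ (Nat.lt_succ_self P.natDegree), Finset.mul_sum]
  rw [← Finset.sum_add_distrib]
  exact Finset.sum_congr rfl fun k _ => by ring

namespace IsPolynomialMonodromy

variable {p q : ℝ → ℂ} {n : ℕ} {g : ℂ} {F G H : ℝ → ℂ[X]} {U : ℂ[X]}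

/-- The zero curvature equations for `F`, `G`, `H` say that the expression commutes with `L`. -/
theorem monodromyExpr_L (h : IsPolynomialMonodromy p q (n + 1) g F G H U) {y : VecFun}
    (hy : ContDiff ℝ ∞ y) :
    monodromyExpr p q F G H (L p q y) = L p q (monodromyExpr p q F G H y) := by
  funext x
  have hp := h.contDiff_p
  have hq := h.contDiff_q
  have hshift : ∀ x i, iterComp p q (L p q y) x i = fun k => iterComp p q y x i (k + 1) :=
    fun x i => rfl
  have ha : ∀ k, HasDerivAt (fun x => iterComp p q y x 0 k)
      (-Complex.I * iterComp p q y x 0 (k + 1) + q x * iterComp p q y x 1 k) x := fun k => by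
    have := (hasDerivAt_of_L (p := p) (q := q) (contDiff_iterate_L hp hq hy k) x).1
    rwa [← Function.iterate_succ_apply' (L p q) k y] at this
  have hb : ∀ k, HasDerivAt (fun x => iterComp p q y x 1 k)
      (p x * iterComp p q y x 0 k + Complex.I * iterComp p q y x 1 (k + 1)) x := fun k => by
    have := (hasDerivAt_of_L (p := p) (q := q) (contDiff_iterate_L hp hq hy k) x).2
    rwa [← Function.iterate_succ_apply' (L p q) k y] at this
  have hlt : ∀ {P : ℂ[X]}, P.natDegree ≤ n + 1 → P.natDegree < n + 3 := fun h => by omega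
  have hXdeg : ∀ (c : ℂ) {P : ℂ[X]}, P.natDegree ≤ n + 1 → (C c * X * P).natDegree ≤ n + 2 := by
    intro c P hP
    refine natDegree_mul_le.trans ?_
    have : (C c * X).natDegree ≤ 1 := (natDegree_C_mul_le c X).trans natDegree_X_le
    omega
  have hCdeg : ∀ (c : ℂ) {P : ℂ[X]}, P.natDegree ≤ n + 1 → (C c * P).natDegree ≤ n + 2 := by
    intro c P hP
    exact (natDegree_C_mul_le c P).trans (by omega)
  have dGa := hasDerivAt_momentFunctional (fun x => hlt (h.natDegree_G x))
    (Nat.lt_succ_of_le ((natDegree_sub_le _ _).trans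
      (max_le (hCdeg _ (h.natDegree_H x)) (hCdeg _ (h.natDegree_F x))))) ha
    (fun k => h.hasDerivAt_G k x)
  have dGb := hasDerivAt_momentFunctional (fun x => hlt (h.natDegree_G x))
    (Nat.lt_succ_of_le ((natDegree_sub_le _ _).trans
      (max_le (hCdeg _ (h.natDegree_H x)) (hCdeg _ (h.natDegree_F x))))) hb
    (fun k => h.hasDerivAt_G k x)
  have dFb := hasDerivAt_momentFunctional (fun x => hlt (h.natDegree_F x))
    (Nat.lt_succ_of_le ((natDegree_sub_le _ _).trans
      (max_le (hXdeg _ (h.natDegree_F x)) (hCdeg _ (h.natDegree_G x))))) hb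
    (fun k => h.hasDerivAt_F k x)
  have dHa := hasDerivAt_momentFunctional (fun x => hlt (h.natDegree_H x))
    (Nat.lt_succ_of_le ((natDegree_add_le _ _).trans
      (max_le (hXdeg _ (h.natDegree_H x)) (hCdeg _ (h.natDegree_G x))))) ha
    (fun k => h.hasDerivAt_H k x)
  have hC : ∀ (a : ℕ → ℂ) (c : ℂ) (P : ℂ[X]),
      momentFunctional a (C c * P) = c * momentFunctional a P := fun a c P => by
    rw [← smul_eq_C_mul, map_smul, smul_eq_mul]
  have hCX : ∀ (a : ℕ → ℂ) (c : ℂ) (P : ℂ[X]), momentFunctional a (C c * X * P) =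
      c * momentFunctional (fun k => a (k + 1)) P := fun a c P => by
    rw [mul_assoc, hC, momentFunctional_X_mul]
  simp only [map_add, map_sub, hC, hCX, momentFunctional_comb] at dGa dGb dFb dHa
  have d := (hasDerivAt_pi (φ := monodromyExpr p q F G H y) (φ' := ![_, _])).2
    (Fin.forall_fin_two.2 ⟨dGa.add dFb, dHa.sub dGb⟩)
  ext i
  fin_cases i
  · change monodromyExpr p q F G H (L p q y) x 0 = L p q (monodromyExpr p q F G H y) x 0
    rw [L_apply_zero, d.deriv]
    simp only [monodromyExpr, hshift, Matrix.cons_val_zero, Matrix.cons_val_one]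
    linear_combination (momentFunctional (fun k => iterComp p q y x 0 (k + 1)) (G x) +
      momentFunctional (fun k => iterComp p q y x 1 (k + 1)) (F x)) * Complex.I_mul_I
  · change monodromyExpr p q F G H (L p q y) x 1 = L p q (monodromyExpr p q F G H y) x 1
    rw [L_apply_one, d.deriv]
    simp only [monodromyExpr, hshift, Matrix.cons_val_zero, Matrix.cons_val_one]
    linear_combination (momentFunctional (fun k => iterComp p q y x 0 (k + 1)) (H x) -
      momentFunctional (fun k => iterComp p q y x 1 (k + 1)) (G x)) * Complex.I_mul_I

theorem contDiff_monodromyExpr (h : IsPolynomialMonodromy p q (n + 1) g F G H U) {y : VecFun}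
    (hy : ContDiff ℝ ∞ y) : ContDiff ℝ ∞ (monodromyExpr p q F G H y) := by
  have key : ∀ (i : Fin 2) (P : ℝ → ℂ[X]), (∀ x, (P x).natDegree ≤ n + 1) →
      (∀ k, ContDiff ℝ ∞ fun x => (P x).coeff k) →
      ContDiff ℝ ∞ fun x => momentFunctional (iterComp p q y x i) (P x) := by
    intro i P hP hPc
    simp only [fun x => momentFunctional_eq_sum (iterComp p q y x i) (Nat.lt_succ_of_le (hP x))]
    refine ContDiff.sum fun k _ => (hPc k).mul ?_
    exact contDiff_pi.1 (contDiff_iterate_L h.contDiff_p h.contDiff_q hy k) i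
  obtain ⟨hF, hG, hH⟩ := h.contDiff_coeff
  rw [contDiff_pi, Fin.forall_fin_two]
  exact ⟨(key 0 G h.natDegree_G hG).add (key 1 F h.natDegree_F hF),
    (key 0 H h.natDegree_H hH).sub (key 1 G h.natDegree_G hG)⟩

theorem monodromyExpr_iterate_L (h : IsPolynomialMonodromy p q (n + 1) g F G H U) {y : VecFun}
    (hy : ContDiff ℝ ∞ y) (k : ℕ) :
    monodromyExpr p q F G H ((L p q)^[k] y) = (L p q)^[k] (monodromyExpr p q F G H y) := by
  induction k with
  | zero => rfl
  | succ k ih =>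
    rw [Function.iterate_succ_apply', Function.iterate_succ_apply', ← ih,
      h.monodromyExpr_L (contDiff_iterate_L h.contDiff_p h.contDiff_q hy k)]

/-- The matrix with entries `G`, `F`, `H`, `-G` squares to the scalar `G² + FH`; since the
expression commutes with `L`, it squares to `G² + FH` evaluated at `L`. -/
theorem monodromyExpr_monodromyExpr (h : IsPolynomialMonodromy p q (n + 1) g F G H U) {y : VecFun}
    (hy : ContDiff ℝ ∞ y) (x : ℝ) (i : Fin 2) :
    monodromyExpr p q F G H (monodromyExpr p q F G H y) x i = 4⁻¹ * polyL p q U y x i := by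
  have hU : 4⁻¹ * polyL p q U y x i =
      momentFunctional (iterComp p q y x i) (G x ^ 2 + F x * H x) := by
    rw [polyL_apply, h.discr x, show (4 : ℂ[X]) = C 4 from rfl, ← smul_eq_C_mul, map_smul,
      smul_eq_mul, inv_mul_cancel_left₀ (by norm_num)]
  have hT : ∀ i, iterComp p q (monodromyExpr p q F G H y) x i =
      fun k => monodromyExpr p q F G H ((L p q)^[k] y) x i := fun i => by
    funext k
    rw [iterComp, h.monodromyExpr_iterate_L hy]
  have hshift : ∀ k i, iterComp p q ((L p q)^[k] y) x i = fun m => iterComp p q y x i (m + k) :=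
    fun k i => by
      funext m
      rw [iterComp, iterComp, Function.iterate_add_apply]
  have hcomp : ∀ (a : ℕ → ℂ) (P R : ℂ[X]),
      momentFunctional (fun k => momentFunctional (fun m => a (m + k)) R) P =
        momentFunctional a (P * R) := fun a P R => by
    rw [momentFunctional_mul a P R (Nat.lt_succ_self _),
      momentFunctional_eq_sum _ (Nat.lt_succ_self _)]
  have hT0 : iterComp p q (monodromyExpr p q F G H y) x 0 = fun k =>
      1 * momentFunctional (fun m => iterComp p q y x 0 (m + k)) (G x) +
        1 * momentFunctional (fun m => iterComp p q y x 1 (m + k)) (F x) := by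
    rw [hT]
    funext k
    simp only [monodromyExpr, hshift, Matrix.cons_val_zero, one_mul]
  have hT1 : iterComp p q (monodromyExpr p q F G H y) x 1 = fun k =>
      1 * momentFunctional (fun m => iterComp p q y x 0 (m + k)) (H x) +
        (-1) * momentFunctional (fun m => iterComp p q y x 1 (m + k)) (G x) := by
    rw [hT]
    funext k
    simp only [monodromyExpr, hshift, Matrix.cons_val_zero, Matrix.cons_val_one]
    ring
  rw [hU, monodromyExpr, hT0, hT1]
  simp only [momentFunctional_comb, hcomp]
  fin_cases i
  · simp only [Fin.zero_eta, Matrix.cons_val_zero, map_add, pow_two, mul_comm (F x) (G x)]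
    ring
  · simp only [Fin.mk_one, Matrix.cons_val_zero, Matrix.cons_val_one, map_add, pow_two, mul_comm (F x) (H x),
      mul_comm (G x) (H x)]
    ring

end IsPolynomialMonodromy

/-- The product rule for a matrix-valued function applied to a vector-valued function. -/
theorem hasDerivAt_matrix_mulVec {M : ℝ → Matrix (Fin 2) (Fin 2) ℂ} {v : VecFun} {v' : Fin 2 → ℂ}
    {x : ℝ} (hM : ∀ a b, DifferentiableAt ℝ (fun x => M x a b) x) (hv : HasDerivAt v v' x) :
    HasDerivAt (fun x => (M x).mulVec (v x))
      ((Matrix.of fun a b => deriv (fun x => M x a b) x).mulVec (v x) + (M x).mulVec v') x := by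
  rw [hasDerivAt_pi] at hv ⊢
  intro i
  simp only [Matrix.mulVec, dotProduct, Pi.add_apply, Matrix.of_apply, ← Finset.sum_add_distrib]
  exact HasDerivAt.fun_sum fun b _ => (hM i b).hasDerivAt.mul (hv b)

theorem hasDerivAt_iteratedDeriv {y : VecFun} (hy : ContDiff ℝ ∞ y) (j : ℕ) (x : ℝ) :
    HasDerivAt (iteratedDeriv j y) (iteratedDeriv (j + 1) y x) x := by
  rw [iteratedDeriv_succ]
  exact (hy.differentiable_iteratedDeriv j (by exact_mod_cast WithTop.coe_lt_top _) x).hasDerivAt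

/-- The iterate `Lᵏ` is a differential expression of order `k` with leading coefficient `Jᵏ`. -/
theorem exists_diffExpr_iterate_L {p q : ℝ → ℂ} (hp : ContDiff ℝ ∞ p) (hq : ContDiff ℝ ∞ q)
    (k : ℕ) : ∃ B : ℕ → ℝ → Matrix (Fin 2) (Fin 2) ℂ,
      (∀ j a b, ContDiff ℝ ∞ fun x => B j x a b) ∧ (∀ x, B k x = J ^ k) ∧
      (∀ j x, k < j → B j x = 0) ∧
      ∀ y : VecFun, ContDiff ℝ ∞ y → (L p q)^[k] y = diffExpr k B y := by
  induction k with
  | zero =>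
    refine ⟨fun j _ => if j = 0 then 1 else 0, fun j a b => contDiff_const, fun x => by simp,
      fun j x hj => if_neg hj.ne', fun y _ => ?_⟩
    funext x
    simp only [Function.iterate_zero, id, diffExpr, zero_add, Finset.sum_range_one, if_true,
      Matrix.one_mulVec, iteratedDeriv_zero]
  | succ k ih =>
    obtain ⟨B, hB, hBk, hB0, hL⟩ := ih
    have hQ : ∀ a b, ContDiff ℝ ∞ fun x => Q p q x a b := by
      intro a b
      fin_cases a <;> fin_cases b
      · exact contDiff_const
      · exact contDiff_const.mul hq
      · exact contDiff_const.mul hp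
      · exact contDiff_const
    have hmul : ∀ M N : ℝ → Matrix (Fin 2) (Fin 2) ℂ, (∀ a b, ContDiff ℝ ∞ fun x => M x a b) →
        (∀ a b, ContDiff ℝ ∞ fun x => N x a b) → ∀ a b, ContDiff ℝ ∞ fun x => (M x * N x) a b := by
      intro M N hM hN a b
      simp only [Matrix.mul_apply]
      exact ContDiff.sum fun c _ => (hM a c).mul (hN c b)
    set B' : ℕ → ℝ → Matrix (Fin 2) (Fin 2) ℂ :=
      fun j x => Matrix.of fun a b => deriv (fun x => B j x a b) x with hB'
    have hB's : ∀ j a b, ContDiff ℝ ∞ fun x => B' j x a b := fun j a b =>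
      (contDiff_infty_iff_deriv.1 (hB j a b)).2
    have hB'0 : ∀ j x, k < j → B' j x = 0 := by
      intro j x hj
      ext a b
      simp [hB', hB0 j _ hj]
    have hJ : ∀ N : ℝ → Matrix (Fin 2) (Fin 2) ℂ, (∀ a b, ContDiff ℝ ∞ fun x => N x a b) →
        ∀ a b, ContDiff ℝ ∞ fun x => (J * N x) a b :=
      fun N hN => hmul (fun _ => J) N (fun _ _ => contDiff_const) hN
    have hfirst : ∀ j a b, ContDiff ℝ ∞ fun x => (J * B' j x + Q p q x * B j x) a b := by
      intro j a b
      have h1 := hJ (B' j) (hB's j) a b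
      have h2 := hmul (Q p q) (B j) hQ (hB j) a b
      simp only [Matrix.add_apply]
      exact h1.add h2
    refine ⟨fun j x => (J * B' j x + Q p q x * B j x) + if j = 0 then 0 else J * B (j - 1) x,
      fun j a b => ?_, fun x => ?_, fun j x hj => ?_, fun y hy => ?_⟩
    · rcases j with _ | j
      · simpa using hfirst 0 a b
      · simp only [Nat.succ_ne_zero, if_false, Nat.add_sub_cancel]
        have h1 := hfirst (j + 1) a b
        have h2 := hJ (B j) (hB j) a b
        simp only [Matrix.add_apply] at h1 ⊢
        exact h1.add h2
    · simp [hB0 (k + 1) _ (Nat.lt_succ_self k), hB'0 (k + 1) _ (Nat.lt_succ_self k), hBk, pow_succ']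
    · simp [hB0 j _ (by omega : k < j), hB'0 j _ (by omega : k < j),
        hB0 (j - 1) _ (by omega : k < j - 1)]
    · rw [Function.iterate_succ_apply', hL y hy]
      funext x
      have hd : HasDerivAt (diffExpr k B y) (∑ j ∈ Finset.range (k + 1),
          ((B' j x).mulVec (iteratedDeriv j y x) + (B j x).mulVec (iteratedDeriv (j + 1) y x))) x :=
        HasDerivAt.fun_sum fun j _ => hasDerivAt_matrix_mulVec
          (fun a b => ((hB j a b).differentiable (by simp)) x) (hasDerivAt_iteratedDeriv hy j x)
      rw [L, hd.deriv]
      simp only [diffExpr, Matrix.mulVec_sum, Matrix.mulVec_add, Matrix.add_mulVec,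
        Finset.sum_add_distrib, Matrix.mulVec_mulVec]
      rw [Finset.sum_range_succ (fun j => (J * B' j x).mulVec _) (k + 1),
        Finset.sum_range_succ (fun j => (Q p q x * B j x).mulVec _) (k + 1),
        Finset.sum_range_succ' (fun j => (if j = 0 then 0 else J * B (j - 1) x).mulVec _) (k + 1)]
      simp only [hB0 (k + 1) _ (Nat.lt_succ_self k), hB'0 (k + 1) _ (Nat.lt_succ_self k), mul_zero,
        Matrix.zero_mulVec, add_zero, Nat.succ_ne_zero, if_false, if_true, Nat.add_sub_cancel]
      abel

/-- A combination of the iterates of `L` with matrix-valued coefficients is a differential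
expression. -/
theorem exists_diffExpr_eq_sum {p q : ℝ → ℂ} (hp : ContDiff ℝ ∞ p) (hq : ContDiff ℝ ∞ q)
    {M : ℕ → ℝ → Matrix (Fin 2) (Fin 2) ℂ} (hM : ∀ k a b, ContDiff ℝ ∞ fun x => M k x a b)
    (N : ℕ) : ∃ B : ℕ → ℝ → Matrix (Fin 2) (Fin 2) ℂ,
      (∀ j a b, ContDiff ℝ ∞ fun x => B j x a b) ∧ (∀ x, B N x = M N x * J ^ N) ∧
      ∀ y : VecFun, ContDiff ℝ ∞ y → ∀ x, diffExpr N B y x =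
        ∑ k ∈ Finset.range (N + 1), (M k x).mulVec ((L p q)^[k] y x) := by
  choose B hB hBk hB0 hL using exists_diffExpr_iterate_L hp hq
  refine ⟨fun j x => ∑ k ∈ Finset.range (N + 1), M k x * B k j x, fun j a b => ?_, fun x => ?_,
    fun y hy x => ?_⟩
  · simp only [Matrix.sum_apply, Matrix.mul_apply]
    exact ContDiff.sum fun k _ => ContDiff.sum fun c _ => (hM k a c).mul (hB k j c b)
  · beta_reduce
    rw [Finset.sum_range_succ, hBk, Finset.sum_eq_zero, zero_add]
    intro k hk
    rw [hB0 k N x (Finset.mem_range.1 hk), mul_zero]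
  · simp only [diffExpr, Matrix.sum_mulVec]
    rw [Finset.sum_comm]
    refine Finset.sum_congr rfl fun k hk => ?_
    rw [hL k y hy, diffExpr, Matrix.mulVec_sum]
    simp only [Matrix.mulVec_mulVec]
    symm
    refine Finset.sum_subset (fun j hj => ?_) (fun j _ hj => ?_)
    · simp only [Finset.mem_range] at hj hk ⊢
      omega
    · rw [hB0 k j x (by simp only [Finset.mem_range] at hj; omega), mul_zero, Matrix.zero_mulVec]

theorem polyL_C_mul (p q : ℝ → ℂ) (c : ℂ) (R : ℂ[X]) (y : VecFun) :
    polyL p q (C c * R) y = c • polyL p q R y := by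
  funext x i
  rw [Pi.smul_apply, Pi.smul_apply, polyL_apply, polyL_apply, ← smul_eq_C_mul, map_smul]

namespace IsPolynomialMonodromy

variable {p q : ℝ → ℂ} {n : ℕ} {g : ℂ} {F G H : ℝ → ℂ[X]} {U : ℂ[X]}

theorem const_mul (h : IsPolynomialMonodromy p q n g F G H U) {c : ℂ} (hc : c ≠ 0) :
    IsPolynomialMonodromy p q n (c * g) (fun x => C c * F x) (fun x => C c * G x)
      (fun x => C c * H x) (C (c ^ 2) * U) where
  natDegree_F x := (natDegree_C_mul_le _ _).trans (h.natDegree_F x)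
  natDegree_G x := (natDegree_C_mul_le _ _).trans (h.natDegree_G x)
  natDegree_H x := (natDegree_C_mul_le _ _).trans (h.natDegree_H x)
  coeff_F x := by rw [coeff_C_mul, h.coeff_F, mul_zero]
  coeff_G x := by rw [coeff_C_mul, h.coeff_G]
  coeff_H x := by rw [coeff_C_mul, h.coeff_H, mul_zero]
  ne_zero := mul_ne_zero hc h.ne_zero
  hasDerivAt_F k x := by
    simp only [coeff_C_mul]
    refine ((h.hasDerivAt_F k x).const_mul c).congr_deriv ?_
    rw [← coeff_C_mul]
    congr 1
    ring
  hasDerivAt_G k x := by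
    simp only [coeff_C_mul]
    refine ((h.hasDerivAt_G k x).const_mul c).congr_deriv ?_
    rw [← coeff_C_mul]
    congr 1
    ring
  hasDerivAt_H k x := by
    simp only [coeff_C_mul]
    refine ((h.hasDerivAt_H k x).const_mul c).congr_deriv ?_
    rw [← coeff_C_mul]
    congr 1
    ring
  discr x := by
    rw [h.discr x, C_pow]
    ring

/-- With the normalization `g = i`, the expression built from `F`, `G`, `H` is the commuting
differential expression with leading coefficient `J ^ (n + 2)`. -/
theorem exists_diffExpr (h : IsPolynomialMonodromy p q (n + 1) Complex.I F G H U) :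
    ∃ B : ℕ → ℝ → Matrix (Fin 2) (Fin 2) ℂ,
      (∀ j a b, ContDiff ℝ ∞ fun x => B j x a b) ∧ (∀ x, B (n + 1) x = J ^ (n + 2)) ∧
      (∀ y : VecFun, ContDiff ℝ ∞ y →
        diffExpr (n + 1) B (L p q y) = L p q (diffExpr (n + 1) B y)) ∧
      ∀ y : VecFun, ContDiff ℝ ∞ y →
        diffExpr (n + 1) B (diffExpr (n + 1) B y) = (4⁻¹ : ℂ) • polyL p q U y := by
  have hp := h.contDiff_p
  have hq := h.contDiff_q
  obtain ⟨hF, hG, hH⟩ := h.contDiff_coeff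
  obtain ⟨B, hB, hBn, hBy⟩ := exists_diffExpr_eq_sum hp hq (M := fun k x =>
    !![(G x).coeff k, (F x).coeff k; (H x).coeff k, -(G x).coeff k]) (fun k a b => by
      fin_cases a <;> fin_cases b
      · exact hG k
      · exact hF k
      · exact hH k
      · exact (hG k).neg) (n + 1)
  have hT : ∀ y : VecFun, ContDiff ℝ ∞ y →
      diffExpr (n + 1) B y = monodromyExpr p q F G H y := by
    intro y hy
    funext x i
    rw [hBy y hy, monodromyExpr, momentFunctional_eq_sum _ (Nat.lt_succ_of_le (h.natDegree_G x)),
      momentFunctional_eq_sum _ (Nat.lt_succ_of_le (h.natDegree_F x)),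
      momentFunctional_eq_sum _ (Nat.lt_succ_of_le (h.natDegree_G x)),
      momentFunctional_eq_sum _ (Nat.lt_succ_of_le (h.natDegree_H x)), ← Finset.sum_add_distrib,
      ← Finset.sum_sub_distrib, Finset.sum_apply]
    fin_cases i
    · simp [dotProduct, iterComp, Matrix.mulVec]
    · simp [dotProduct, iterComp, Matrix.mulVec, sub_eq_add_neg]
  refine ⟨B, hB, fun x => ?_, fun y hy => ?_, fun y hy => ?_⟩
  · rw [hBn, h.coeff_F, h.coeff_G, h.coeff_H, pow_succ' J (n + 1)]
    rfl
  · rw [hT _ hy, hT _ (contDiff_L hp hq hy), h.monodromyExpr_L hy]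
  · rw [hT _ hy, hT _ (h.contDiff_monodromyExpr hy)]
    funext x i
    rw [h.monodromyExpr_monodromyExpr hy]
    rfl

end IsPolynomialMonodromy

/-! ### Multiplicities -/

theorem analyticOrderAt_eval {P : ℂ[X]} (hP : P ≠ 0) (z : ℂ) :
    analyticOrderAt (fun w => P.eval w) z = P.rootMultiplicity z := by
  obtain ⟨R, hR, hdvd⟩ := exists_eq_pow_rootMultiplicity_mul_and_not_dvd P hP z
  have han : ∀ R : ℂ[X], AnalyticAt ℂ (fun w => R.eval w) z := fun R =>
    R.differentiable.analyticAt z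
  rw [(han P).analyticOrderAt_eq_natCast]
  refine ⟨fun w => R.eval w, han R, fun h => hdvd (dvd_iff_isRoot.2 h), Eventually.of_forall ?_⟩
  intro w
  conv_lhs => rw [hR]
  simp

theorem analyticOrderAt_eval_mul {P : ℂ[X]} (hP : P ≠ 0) {f : ℂ → ℂ} (hf : Differentiable ℂ f)
    (z : ℂ) : analyticOrderAt (fun w => P.eval w * f w) z =
      P.rootMultiplicity z + analyticOrderAt f z := by
  rw [← analyticOrderAt_eval hP z]
  exact analyticOrderAt_mul (P.differentiable.analyticAt z) (hf.analyticAt z)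

theorem hasSum_rootMultiplicity {P : ℂ[X]} (hP : P ≠ 0) :
    HasSum (fun z => ((P.rootMultiplicity z : ℕ) : ℕ∞)) (P.natDegree : ℕ∞) := by
  have h1 : (P.natDegree : ℕ∞) = ∑ z ∈ P.roots.toFinset, ((P.rootMultiplicity z : ℕ) : ℕ∞) := by
    rw [(IsAlgClosed.splits P).natDegree_eq_card_roots, ← Multiset.toFinset_sum_count_eq]
    push_cast
    simp only [count_roots]
  rw [h1]
  refine hasSum_sum_of_ne_finset_zero fun z hz => ?_
  rw [Multiset.mem_toFinset, mem_roots hP] at hz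
  rw [rootMultiplicity_eq_zero hz, Nat.cast_zero]

section

variable {p q : ℝ → ℂ} {Ω : ℝ} (hp : Function.Periodic p Ω) (hq : Function.Periodic q Ω)
  {D : ℂ → ℂ} (hD : IsImmovableFactor p q Ω D) {U : ℂ[X]}
  (hU : ∀ E : ℂ, AKNS.discr hp hq E = U.eval E * D E ^ 2) (hU0 : U ≠ 0)
include hD hU hU0

theorem sOrder_eq (E : ℂ) :
    sOrder hp hq E = U.rootMultiplicity E + 2 * deltaImm p q Ω E := by
  have h2 : analyticOrderAt (fun E => D E ^ 2) E = 2 * analyticOrderAt D E := by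
    rw [show (fun E => D E ^ 2) = D ^ 2 from rfl, analyticOrderAt_pow (hD.1.analyticAt E) 2,
      nsmul_eq_mul, Nat.cast_ofNat]
  rw [sOrder, show AKNS.discr hp hq = fun E => U.eval E * D E ^ 2 from funext hU,
    analyticOrderAt_eval_mul hU0 (f := fun E => D E ^ 2) (hD.1.pow 2), h2, hD.2]

theorem branchSet_eq (hD0 : ∀ E, analyticOrderAt D E ≠ ⊤) :
    branchSet hp hq = ↑U.roots.toFinset := by
  ext E
  have hfin := hD0 E
  rw [hD.2] at hfin
  obtain ⟨d, hd⟩ := ENat.ne_top_iff_exists.1 hfin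
  rw [branchSet, mem_ofPred_eq, sOrder_eq hp hq hD hU hU0, Finset.mem_coe, Multiset.mem_toFinset,
    mem_roots hU0, ← rootMultiplicity_pos hU0]
  rw [← hd]
  norm_cast
  omega

theorem eq_C_mul_curvePoly (hD0 : ∀ E, analyticOrderAt D E ≠ ⊤) :
    U = C U.leadingCoeff * curvePoly hp hq := by
  have hexp : ∀ E, (sOrder hp hq E).toNat - 2 * (deltaImm p q Ω E).toNat =
      U.rootMultiplicity E := by
    intro E
    have hfin := hD0 E
    rw [hD.2] at hfin
    obtain ⟨d, hd⟩ := ENat.ne_top_iff_exists.1 hfin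
    rw [sOrder_eq hp hq hD hU hU0, ← hd]
    have : ((U.rootMultiplicity E : ℕ) : ℕ∞) + 2 * (d : ℕ∞) =
      ((U.rootMultiplicity E + 2 * d : ℕ) : ℕ∞) := by push_cast; rfl
    rw [this, ENat.toNat_natCast, ENat.toNat_natCast]
    omega
  have hsplit := (IsAlgClosed.splits U).eq_prod_roots
  rw [curvePoly, branchSet_eq hp hq hD hU hU0 hD0, finprod_mem_coe_finset]
  simp only [hexp]
  conv_lhs => rw [hsplit, Finset.prod_multiset_map_count]
  simp only [count_roots]

end

/-! ### Level arcs of an analytic function -/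

theorem isRegularAnalyticArc_image_Icc {γ : ℝ → ℂ} {a b : ℝ} (hab : a < b)
    (hγ : AnalyticOnNhd ℝ γ (Icc a b)) (hd : ∀ t ∈ Icc a b, deriv γ t ≠ 0)
    (hinj : InjOn γ (Icc a b)) : IsRegularAnalyticArc (γ '' Icc a b) := by
  refine ⟨Icc a b, γ, ordConnected_Icc, isClosed_Icc, 
    ⟨a, left_mem_Icc.2 hab.le, b, right_mem_Icc.2 hab.le, hab.ne⟩, hγ, hd, hinj,
    ?_, rfl⟩
  have : cocompact ℝ ⊓ 𝓟 (Icc a b) = ⊥ := by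
    rw [inf_principal_eq_bot]
    exact isCompact_Icc.compl_mem_cocompact
  rw [this]
  exact tendsto_bot

/-- An arc on which `f` takes real values, parametrized by the value of `f`. The derivative of `f`
may vanish at the two ends, where the parametrization need not be differentiable; the arcs cut
out by subintervals are nevertheless regular analytic arcs. -/
structure IsLevelArc (f : ℂ → ℂ) (σ : ℝ → ℂ) (a b : ℝ) : Prop where
  lt : a < b
  continuousOn : ContinuousOn σ (Icc a b)
  map_eq : ∀ s ∈ Icc a b, f (σ s) = s
  deriv_ne_zero : ∀ s ∈ Ioo a b, deriv f (σ s) ≠ 0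
  isRegularAnalyticArc : ∀ c d, a ≤ c → c < d → d ≤ b → IsRegularAnalyticArc (σ '' Icc c d)

theorem IsLevelArc.neg {f : ℂ → ℂ} {σ : ℝ → ℂ} {a b : ℝ} (h : IsLevelArc (fun z => -f z) σ a b) :
    IsLevelArc f (fun s => σ (-s)) (-b) (-a) where
  lt := neg_lt_neg h.lt
  continuousOn := h.continuousOn.comp continuous_neg.continuousOn fun s hs =>
    ⟨by linarith [hs.2], by linarith [hs.1]⟩
  map_eq s hs := by
    have := h.map_eq (-s) ⟨by linarith [hs.2], by linarith [hs.1]⟩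
    push_cast at this
    exact neg_injective this
  deriv_ne_zero s hs := by
    have := h.deriv_ne_zero (-s) ⟨by linarith [hs.2], by linarith [hs.1]⟩
    rw [show (fun z => -f z) = -f from rfl, deriv.neg] at this
    exact neg_ne_zero.1 this
  isRegularAnalyticArc c d hc hcd hd := by
    rw [show (fun s => σ (-s)) = σ ∘ Neg.neg from rfl, image_comp, Set.image_neg_eq_neg,
      Set.neg_Icc]
    exact h.isRegularAnalyticArc (-d) (-c) (by linarith) (by linarith) (by linarith)

/-- A regular curve along which `f - c` is a power of the parameter becomes a level arc when it is
parametrized by the value of `f`. -/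
theorem exists_isLevelArc {f : ℂ → ℂ} (hf : Differentiable ℂ f) {γ : ℝ → ℂ} {r c : ℝ} (hr : 0 < r)
    {k : ℕ} (hk : k ≠ 0) (hγ : AnalyticOnNhd ℝ γ (Icc 0 r)) (hd : ∀ t ∈ Icc 0 r, deriv γ t ≠ 0)
    (hinj : InjOn γ (Icc 0 r)) (hfγ : ∀ t ∈ Icc 0 r, f (γ t) = c + t ^ k) :
    ∃ σ, IsLevelArc f σ c (c + r ^ k) ∧ σ '' Icc c (c + r ^ k) = γ '' Icc 0 r := by
  set ρ : ℝ → ℝ := fun s => (s - c) ^ ((k : ℝ)⁻¹) with hρ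
  have hρpow : ∀ s, c ≤ s → ρ s ^ k = s - c := fun s hs =>
    Real.rpow_inv_natCast_pow (sub_nonneg.2 hs) hk
  have hρ0 : ∀ s, c ≤ s → 0 ≤ ρ s := fun s hs => Real.rpow_nonneg (sub_nonneg.2 hs) _
  have hρinv : ∀ t, 0 ≤ t → ρ (c + t ^ k) = t := fun t ht => by
    rw [hρ]
    simp only [add_sub_cancel_left]
    exact Real.pow_rpow_inv_natCast ht hk
  have hρmono : ∀ s s', c ≤ s → s ≤ s' → ρ s ≤ ρ s' := fun s s' hs hss' =>
    Real.rpow_le_rpow (sub_nonneg.2 hs) (by linarith) (by positivity)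
  have hρlt : ∀ s s', c ≤ s → s < s' → ρ s < ρ s' := fun s s' hs hss' =>
    Real.rpow_lt_rpow (sub_nonneg.2 hs) (by linarith) (by positivity)
  have hρc : ρ c = 0 := by
    have := hρinv 0 le_rfl
    rwa [zero_pow hk, add_zero] at this
  have hρcont : Continuous ρ :=
    (continuous_id.sub continuous_const).rpow_const fun _ => Or.inr (by positivity)
  have hρr := hρinv r hr.le
  have himg : ∀ s s', c ≤ s → s ≤ s' → ρ '' Icc s s' = Icc (ρ s) (ρ s') := by
    intro s s' hs hss'
    ext t
    constructor
    · rintro ⟨u, hu, rfl⟩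
      exact ⟨hρmono _ _ hs hu.1, hρmono _ _ (hs.trans hu.1) hu.2⟩
    · rintro ⟨h1, h2⟩
      have ht : 0 ≤ t := (hρ0 s hs).trans h1
      refine ⟨c + t ^ k, ⟨?_, ?_⟩, hρinv t ht⟩
      · have := pow_le_pow_left₀ (hρ0 s hs) h1 k
        rw [hρpow s hs] at this
        linarith
      · have := pow_le_pow_left₀ ht h2 k
        rw [hρpow s' (hs.trans hss')] at this
        linarith
  have hrk : 0 < r ^ k := pow_pos hr k
  have hmaps : MapsTo ρ (Icc c (c + r ^ k)) (Icc 0 r) := fun s hs =>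
    ⟨hρ0 s hs.1, by rw [← hρr]; exact hρmono _ _ hs.1 hs.2⟩
  refine ⟨γ ∘ ρ, ⟨by linarith, ?_, ?_, ?_, ?_⟩, ?_⟩
  · exact hγ.continuousOn.comp hρcont.continuousOn hmaps
  · intro s hs
    rw [Function.comp_apply, hfγ _ (hmaps hs), ← Complex.ofReal_pow, hρpow s hs.1]
    push_cast
    ring
  · intro s hs h0
    have hs' : s ∈ Icc c (c + r ^ k) := Ioo_subset_Icc_self hs
    have ht0 : 0 < ρ s := by
      rw [← hρc]
      exact hρlt _ _ le_rfl hs.1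
    have htr : ρ s < r := by
      rw [← hρr]
      exact hρlt _ _ hs.1.le hs.2
    have h1 : HasDerivAt (fun t : ℝ => f (γ t)) (deriv γ (ρ s) • deriv f (γ (ρ s))) (ρ s) := by
      have := (hf (γ (ρ s))).hasDerivAt.scomp_of_eq (ρ s) (h := γ) (h' := deriv γ (ρ s))
        (hγ _ (hmaps hs')).differentiableAt.hasDerivAt rfl
      exact this
    have h2 : HasDerivAt (fun t : ℝ => (c : ℂ) + (t : ℂ) ^ k) (k * (ρ s : ℂ) ^ (k - 1) * 1)
        (ρ s) := by
      have := ((Complex.ofRealCLM.hasDerivAt (x := ρ s)).pow k).const_add (c : ℂ)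
      simpa using this
    have h3 : (fun t : ℝ => f (γ t)) =ᶠ[𝓝 (ρ s)] fun t : ℝ => (c : ℂ) + (t : ℂ) ^ k := by
      filter_upwards [Ioo_mem_nhds ht0 htr] with t ht
      exact hfγ t (Ioo_subset_Icc_self ht)
    have h4 := h1.unique (h2.congr_of_eventuallyEq h3)
    rw [Function.comp_apply] at h0
    rw [h0, smul_zero, mul_one] at h4
    have : (k : ℂ) * (ρ s : ℂ) ^ (k - 1) ≠ 0 :=
      mul_ne_zero (Nat.cast_ne_zero.2 hk) (pow_ne_zero _ (Complex.ofReal_ne_zero.2 ht0.ne'))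
    exact this h4.symm
  · intro s s' hs hss' hs'
    have hsub : Icc (ρ s) (ρ s') ⊆ Icc 0 r := Icc_subset_Icc (hρ0 s hs) (by
      rw [← hρr]
      exact hρmono _ _ (hs.trans hss'.le) hs')
    rw [image_comp, himg s s' hs hss'.le]
    exact isRegularAnalyticArc_image_Icc (hρlt _ _ hs hss') (hγ.mono hsub)
      (fun t ht => hd t (hsub ht)) (hinj.mono hsub)
  · rw [image_comp, himg c _ le_rfl (by linarith), hρc, hρr]

/-- Near each point an analytic function is a power in a suitable coordinate `w`; here `ψ` is the
inverse of the coordinate map. -/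
theorem exists_power_chart {f : ℂ → ℂ} {z₀ : ℂ} (hf : AnalyticAt ℂ f z₀)
    (hf0 : ¬ ∀ᶠ z in 𝓝 z₀, f z = f z₀) : ∃ k : ℕ, k ≠ 0 ∧ ∃ (ψ : ℂ → ℂ) (r : ℝ), 0 < r ∧
      AnalyticOnNhd ℂ ψ (Metric.ball 0 r) ∧ (∀ w ∈ Metric.ball 0 r, deriv ψ w ≠ 0) ∧
      InjOn ψ (Metric.ball 0 r) ∧ (∀ w ∈ Metric.ball 0 r, f (ψ w) = f z₀ + w ^ k) ∧
      map ψ (𝓝 0) = 𝓝 z₀ := by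
  have hsub : AnalyticAt ℂ (fun z => f z - f z₀) z₀ := hf.sub analyticAt_const
  have hord : analyticOrderAt (fun z => f z - f z₀) z₀ ≠ ⊤ := by
    rw [Ne, analyticOrderAt_eq_top]
    simpa only [sub_eq_zero] using hf0
  obtain ⟨k, hk⟩ := ENat.ne_top_iff_exists.1 hord
  obtain ⟨g, hg, hg0, hfg⟩ := (hsub.analyticOrderAt_eq_natCast).1 hk.symm
  have hk0 : k ≠ 0 := by
    rintro rfl
    have := hfg.self_of_nhds
    simp only [sub_self, pow_zero, one_smul] at this
    exact hg0 this.symm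
  obtain ⟨a, ha⟩ := IsAlgClosed.exists_pow_nat_eq (g z₀) (Nat.pos_of_ne_zero hk0)
  have ha0 : a ≠ 0 := by
    rintro rfl
    rw [zero_pow hk0] at ha
    exact hg0 ha.symm
  set h : ℂ → ℂ := fun z => a * (g z / g z₀) ^ ((k : ℂ)⁻¹) with hh
  have hhan : AnalyticAt ℂ h z₀ := by
    refine analyticAt_const.mul ((hg.div_const).cpow analyticAt_const ?_)
    rw [div_self hg0]
    exact Complex.one_mem_slitPlane
  have hhk : ∀ z, h z ^ k = g z := by
    intro z
    rw [hh]
    simp only [mul_pow]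
    rw [Complex.cpow_nat_inv_pow _ hk0, ha, mul_div_cancel₀ _ hg0]
  have hhz : h z₀ = a := by
    rw [hh]
    simp only [div_self hg0, Complex.one_cpow, mul_one]
  set φ : ℂ → ℂ := fun z => (z - z₀) * h z with hφ
  have hφan : AnalyticAt ℂ φ z₀ := (analyticAt_id.sub analyticAt_const).mul hhan
  have hφ0 : φ z₀ = 0 := by simp [hφ]
  have hφd : deriv φ z₀ = a := by
    have := ((hasDerivAt_id z₀).sub_const z₀).mul hhan.differentiableAt.hasDerivAt
    rw [HasDerivAt.deriv (f := φ) this, hhz]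
    simp
  have hφd0 : deriv φ z₀ ≠ 0 := hφd ▸ ha0
  set ψ := hφan.hasStrictDerivAt.localInverse _ _ _ hφd0 with hψ
  have hψan : AnalyticAt ℂ ψ 0 := by
    rw [← hφ0]
    exact hφan.analyticAt_localInverse hφd0
  have hψd : HasStrictDerivAt ψ (deriv φ z₀)⁻¹ 0 := by
    have := hφan.hasStrictDerivAt.to_localInverse hφd0
    rwa [hφ0] at this
  have hψ0 : ψ 0 = z₀ := by
    have := HasStrictFDerivAt.localInverse_apply_image
      (hφan.hasStrictDerivAt.hasStrictFDerivAt_equiv hφd0)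
    rwa [hφ0] at this
  have hright : ∀ᶠ w in 𝓝 (0 : ℂ), φ (ψ w) = w := by
    have := HasStrictDerivAt.eventually_right_inverse hφan.hasStrictDerivAt hφd0
    rwa [hφ0] at this
  have hψtend : Tendsto ψ (𝓝 0) (𝓝 z₀) := by
    have := hψan.continuousAt.tendsto
    rwa [hψ0] at this
  have hψd' : ∀ᶠ w in 𝓝 (0 : ℂ), deriv ψ w ≠ 0 := by
    refine hψan.deriv.continuousAt.eventually_ne ?_
    rw [hψd.hasDerivAt.deriv]
    exact inv_ne_zero hφd0
  have hfψ : ∀ᶠ w in 𝓝 (0 : ℂ), f (ψ w) = f z₀ + w ^ k := by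
    filter_upwards [hψtend.eventually hfg, hright] with w h1 h2
    rw [← sub_eq_iff_eq_add', h1, smul_eq_mul, ← hhk, ← mul_pow]
    exact congrArg (· ^ k) h2
  obtain ⟨r, hr, hball⟩ := Metric.eventually_nhds_iff_ball.1
    (hψan.eventually_analyticAt.and (hψd'.and (hright.and hfψ)))
  refine ⟨k, hk0, ψ, r, hr, fun w hw => (hball w hw).1, fun w hw => (hball w hw).2.1, ?_,
    fun w hw => (hball w hw).2.2.2, ?_⟩
  · intro w hw w' hw' he
    rw [← (hball w hw).2.2.1, ← (hball w' hw').2.2.1, he]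
  · rw [hψd.map_nhds_eq (inv_ne_zero hφd0), hψ0]

/-- Near each of its points, the set where `f` takes values in `[-2, 2]` is a finite union of level
arcs. In the coordinate in which `f` is a power these are radii. -/
theorem exists_isLevelArc_nhds {f : ℂ → ℂ} (hf : Differentiable ℂ f) {z₀ : ℂ} {c : ℝ}
    (hc : c ∈ Icc (-2 : ℝ) 2) (hz₀ : f z₀ = c) (hf0 : ¬ ∀ᶠ z in 𝓝 z₀, f z = f z₀) :
    ∃ A : Set ((ℝ → ℂ) × ℝ × ℝ), A.Finite ∧
      (∀ α ∈ A, IsLevelArc f α.1 α.2.1 α.2.2 ∧ -2 ≤ α.2.1 ∧ α.2.2 ≤ 2) ∧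
      ∀ᶠ z in 𝓝 z₀, (∃ t ∈ Icc (-2 : ℝ) 2, f z = t) →
        ∃ α ∈ A, z ∈ α.1 '' Icc α.2.1 α.2.2 := by
  obtain ⟨k, hk, ψ, r₀, hr₀, hψ, hψd, hψinj, hfψ, hψmap⟩ := exists_power_chart (hf.analyticAt z₀) hf0
  have hψ0 : ψ 0 = z₀ := by
    have h1 : Tendsto ψ (𝓝 0) (𝓝 z₀) := hψmap.le
    exact tendsto_nhds_unique (hψ 0 (Metric.mem_ball_self hr₀)).continuousAt.tendsto h1
  -- The radius is such that `c ± r ^ k` does not leave `[-2, 2]` unless `c` is an end of it.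
  obtain ⟨r, hr, hrr₀, hup, hdown⟩ : ∃ r : ℝ, 0 < r ∧ r < r₀ ∧ (c < 2 → c + r ^ k ≤ 2) ∧
      (-2 < c → -2 ≤ c - r ^ k) := by
    have hlim : Tendsto (fun r : ℝ => r ^ k) (𝓝[>] 0) (𝓝 0) := by
      have : Tendsto (fun r : ℝ => r ^ k) (𝓝 0) (𝓝 (0 ^ k)) := (continuous_pow k).tendsto 0
      rw [zero_pow hk] at this
      exact this.mono_left nhdsWithin_le_nhds
    have e1 : ∀ᶠ r : ℝ in 𝓝[>] 0, c < 2 → c + r ^ k ≤ 2 := by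
      by_cases h : c < 2
      · filter_upwards [hlim.eventually (Iio_mem_nhds (sub_pos.2 h))] with r hr _
        have hr' : r ^ k < 2 - c := hr
        linarith
      · exact Eventually.of_forall fun r h' => absurd h' h
    have e2 : ∀ᶠ r : ℝ in 𝓝[>] 0, -2 < c → -2 ≤ c - r ^ k := by
      by_cases h : -2 < c
      · filter_upwards [hlim.eventually (Iio_mem_nhds (show (0 : ℝ) < c + 2 by linarith))]
          with r hr _
        have hr' : r ^ k < c + 2 := hr
        linarith
      · exact Eventually.of_forall fun r h' => absurd h' h
    obtain ⟨r, ⟨h1, h2⟩, h3⟩ := (((eventually_mem_set.2 (Ioo_mem_nhdsGT hr₀)).and e1).and e2).exists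
    exact ⟨r, h1.1, h1.2, h2, h3⟩
  have hmem : ∀ {η : ℂ}, ‖η‖ = 1 → ∀ t ∈ Icc 0 r, η * (t : ℂ) ∈ Metric.ball (0 : ℂ) r₀ := by
    intro η hη t ht
    rw [mem_ball_zero_iff, norm_mul, hη, one_mul, Complex.norm_real, Real.norm_of_nonneg ht.1]
    exact ht.2.trans_lt hrr₀
  have hray : ∀ η : ℂ, ‖η‖ = 1 → AnalyticOnNhd ℝ (fun t : ℝ => ψ (η * t)) (Icc 0 r) ∧
      (∀ t ∈ Icc 0 r, deriv (fun t : ℝ => ψ (η * t)) t ≠ 0) ∧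
      InjOn (fun t : ℝ => ψ (η * t)) (Icc 0 r) := by
    intro η hη
    have hη0 : η ≠ 0 := by
      rintro rfl
      simp at hη
    refine ⟨fun t ht => ?_, fun t ht => ?_, fun t ht t' ht' he => ?_⟩
    · have h1 : AnalyticAt ℝ (fun t : ℝ => η * (t : ℂ)) t :=
        analyticAt_const.mul (Complex.ofRealCLM.analyticAt t)
      exact ((hψ _ (hmem hη t ht)).restrictScalars (𝕜 := ℝ)).comp_of_eq h1 rfl
    · have h1 : HasDerivAt (fun t : ℝ => η * (t : ℂ)) (η * 1) t :=
        (Complex.ofRealCLM.hasDerivAt (x := t)).const_mul η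
      have h2 := (hψ _ (hmem hη t ht)).differentiableAt.hasDerivAt.scomp_of_eq t h1 rfl
      rw [HasDerivAt.deriv (f := fun t : ℝ => ψ (η * t)) h2, mul_one]
      exact smul_ne_zero hη0 (hψd _ (hmem hη t ht))
    · have := mul_left_cancel₀ hη0 (hψinj (hmem hη t ht) (hmem hη t' ht') he)
      exact_mod_cast this
  have hpos : ∀ η : ℂ, ‖η‖ = 1 → η ^ k = 1 → ∃ σ, IsLevelArc f σ c (c + r ^ k) ∧
      σ '' Icc c (c + r ^ k) = (fun t : ℝ => ψ (η * t)) '' Icc 0 r := by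
    intro η hη hηk
    obtain ⟨h1, h2, h3⟩ := hray η hη
    refine exists_isLevelArc hf hr hk h1 h2 h3 fun t ht => ?_
    rw [hfψ _ (hmem hη t ht), hz₀, mul_pow, hηk, one_mul]
  have hneg : ∀ η : ℂ, ‖η‖ = 1 → η ^ k = -1 → ∃ σ, IsLevelArc f σ (c - r ^ k) c ∧
      σ '' Icc (c - r ^ k) c = (fun t : ℝ => ψ (η * t)) '' Icc 0 r := by
    intro η hη hηk
    obtain ⟨h1, h2, h3⟩ := hray η hη
    obtain ⟨σ, hσ, hσi⟩ := exists_isLevelArc (f := fun z => -f z) (c := -c) hf.fun_neg hr hk h1 h2 h3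
      fun t ht => by
        rw [hfψ _ (hmem hη t ht), hz₀, mul_pow, hηk]
        push_cast
        ring
    refine ⟨fun s => σ (-s), ?_, ?_⟩
    · have := hσ.neg
      rwa [neg_neg, show -(-c + r ^ k) = c - r ^ k by ring] at this
    · rw [← hσi, show (fun s => σ (-s)) = σ ∘ Neg.neg from rfl, image_comp, Set.image_neg_eq_neg,
        Set.neg_Icc, show -(c - r ^ k) = -c + r ^ k by ring]
  choose! σp hσp hσpi using hpos
  choose! σn hσn hσni using hneg
  have hfin : {η : ℂ | η ^ (2 * k) = 1}.Finite := by
    have : {η : ℂ | η ^ (2 * k) = 1} ⊆ ↑(nthRoots (2 * k) (1 : ℂ)).toFinset := by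
      intro η hη
      rw [Finset.mem_coe, Multiset.mem_toFinset, mem_nthRoots (by omega)]
      exact hη
    exact (Finset.finite_toSet _).subset this
  have hnorm : ∀ {η : ℂ} {m : ℕ}, m ≠ 0 → ‖η ^ m‖ = 1 → ‖η‖ = 1 := by
    intro η m hm h
    rw [norm_pow] at h
    exact (pow_eq_one_iff_of_nonneg (norm_nonneg η) hm).1 h
  refine ⟨(fun η => (σp η, c, c + r ^ k)) '' {η | η ^ k = 1 ∧ c < 2} ∪
    (fun η => (σn η, c - r ^ k, c)) '' {η | η ^ k = -1 ∧ -2 < c}, ?_, ?_, ?_⟩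
  · refine (Finite.image _ (hfin.subset ?_)).union (Finite.image _ (hfin.subset ?_))
    · rintro η ⟨hη, -⟩
      rw [mem_ofPred_eq, mul_comm, pow_mul, hη, one_pow]
    · rintro η ⟨hη, -⟩
      rw [mem_ofPred_eq, mul_comm, pow_mul, hη, neg_one_sq]
  · rintro α (⟨η, ⟨hη, hc2⟩, rfl⟩ | ⟨η, ⟨hη, hc2⟩, rfl⟩)
    · exact ⟨hσp η (hnorm hk (by rw [hη, norm_one])) hη, hc.1, hup hc2⟩
    · exact ⟨hσn η (hnorm hk (by rw [hη, norm_neg, norm_one])) hη, hdown hc2, hc.2⟩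
  · rw [← hψmap, eventually_map]
    filter_upwards [Metric.ball_mem_nhds (0 : ℂ) hr] with w hw ⟨t, ht, htw⟩
    rw [mem_ball_zero_iff] at hw
    have hwr₀ : w ∈ Metric.ball (0 : ℂ) r₀ := mem_ball_zero_iff.2 (hw.trans hrr₀)
    rw [hfψ w hwr₀, hz₀] at htw
    have hwk : w ^ k = ((t - c : ℝ) : ℂ) := by
      push_cast
      linear_combination htw
    have hwnorm : ‖w‖ ^ k = |t - c| := by
      rw [← norm_pow, hwk, Complex.norm_real, Real.norm_eq_abs]
    have hIcc : ‖w‖ ∈ Icc 0 r := ⟨norm_nonneg w, hw.le⟩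
    -- A unit vector in the direction of `w`; it is arbitrary if `w = 0`.
    have hdir : ∀ ε : ℂ, ‖ε‖ = 1 → (w ≠ 0 → w ^ k = ε * ‖w‖ ^ k) →
        ∃ η : ℂ, η ^ k = ε ∧ w = η * ‖w‖ := by
      intro ε hε hwε
      rcases eq_or_ne w 0 with rfl | hw0
      · obtain ⟨η, hη⟩ := IsAlgClosed.exists_pow_nat_eq ε (Nat.pos_of_ne_zero hk)
        exact ⟨η, hη, by simp⟩
      · have hn : (‖w‖ : ℂ) ≠ 0 := by simpa using hw0
        refine ⟨w / ‖w‖, ?_, (div_mul_cancel₀ _ hn).symm⟩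
        rw [div_pow, hwε hw0, mul_div_cancel_right₀ _ (pow_ne_zero k hn)]
    have hcase : (c < 2 ∧ (w ≠ 0 → c < t)) ∨ (-2 < c ∧ (w ≠ 0 → t < c)) := by
      rcases eq_or_ne w 0 with h0 | h0
      · rcases lt_or_ge c 2 with h | h
        · exact Or.inl ⟨h, fun h' => absurd h0 h'⟩
        · exact Or.inr ⟨by linarith, fun h' => absurd h0 h'⟩
      · have hne : t - c ≠ 0 := by
          intro h
          rw [h, Complex.ofReal_zero] at hwk
          exact pow_ne_zero k h0 hwk
        rcases lt_or_gt_of_ne hne with h | h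
        · exact Or.inr ⟨by linarith [ht.1], fun _ => by linarith⟩
        · exact Or.inl ⟨by linarith [ht.2], fun _ => by linarith⟩
    rcases hcase with ⟨hc2, htc⟩ | ⟨hc2, htc⟩
    · obtain ⟨η, hηk, hwη⟩ := hdir 1 norm_one fun h0 => by
        rw [one_mul, ← Complex.ofReal_pow, hwnorm, abs_of_pos (by linarith [htc h0]), hwk]
      refine ⟨_, Or.inl ⟨η, ⟨hηk, hc2⟩, rfl⟩, ?_⟩
      rw [hσpi η (hnorm hk (by rw [hηk, norm_one])) hηk]
      exact ⟨‖w‖, hIcc, congrArg ψ hwη.symm⟩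
    · obtain ⟨η, hηk, hwη⟩ := hdir (-1) (by rw [norm_neg, norm_one]) fun h0 => by
        rw [← Complex.ofReal_pow, hwnorm, abs_of_neg (by linarith [htc h0]), hwk]
        push_cast
        ring
      refine ⟨_, Or.inr ⟨η, ⟨hηk, hc2⟩, rfl⟩, ?_⟩
      rw [hσni η (hnorm hk (by rw [hηk, norm_neg, norm_one])) hηk]
      exact ⟨‖w‖, hIcc, congrArg ψ hwη.symm⟩

/-- A property that is locally constant on an open interval is constant. -/
theorem forall_or_forall_not_of_eventually {P : ℝ → Prop} {a b : ℝ}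
    (h1 : ∀ s ∈ Ioo a b, P s → ∀ᶠ t in 𝓝 s, P t)
    (h2 : ∀ s ∈ Ioo a b, ¬ P s → ∀ᶠ t in 𝓝 s, ¬ P t) :
    (∀ s ∈ Ioo a b, P s) ∨ ∀ s ∈ Ioo a b, ¬ P s := by
  by_contra! h
  obtain ⟨⟨s, hs, hPs⟩, t, ht, hPt⟩ := h
  have hopen1 : IsOpen {s | s ∈ Ioo a b ∧ P s} := isOpen_iff_mem_nhds.2 fun s hs => by
    filter_upwards [isOpen_Ioo.mem_nhds hs.1, h1 s hs.1 hs.2] with u hu hu'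
    exact ⟨hu, hu'⟩
  have hopen2 : IsOpen {s | s ∈ Ioo a b ∧ ¬ P s} := isOpen_iff_mem_nhds.2 fun s hs => by
    filter_upwards [isOpen_Ioo.mem_nhds hs.1, h2 s hs.1 hs.2] with u hu hu'
    exact ⟨hu, hu'⟩
  obtain ⟨u, -, hu, hu'⟩ := isPreconnected_Ioo (a := a) (b := b) _ _ hopen1 hopen2
    (fun u hu => (em (P u)).imp (fun h => ⟨hu, h⟩) fun h => ⟨hu, h⟩) ⟨t, ht, ht, hPt⟩
    ⟨s, hs, hs, hPs⟩
  exact hu'.2 hu.2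

/-- A regular analytic arc `T` in the set where `f` takes values in `[-2, 2]` that is closed and,
away from points where `f = ±2`, relatively open in this set. -/
structure IsTail (f : ℂ → ℂ) (T O : Set ℂ) : Prop where
  isRegularAnalyticArc : IsRegularAnalyticArc T
  isClosed : IsClosed T
  isOpen : IsOpen O
  exists_eq : ∀ z ∈ T, ∃ t ∈ Icc (-2 : ℝ) 2, f z = t
  mem : ∀ z ∈ O, (∃ t ∈ Icc (-2 : ℝ) 2, f z = t) → z ∈ T
  eq_or_eq : ∀ z ∈ T, z ∉ O → f z = 2 ∨ f z = -2

namespace IsLevelArc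

variable {f : ℂ → ℂ} {σ ρ : ℝ → ℂ} {a b : ℝ}

theorem mono (h : IsLevelArc f σ a b) {c d : ℝ} (hac : a ≤ c) (hcd : c < d) (hdb : d ≤ b) :
    IsLevelArc f σ c d where
  lt := hcd
  continuousOn := h.continuousOn.mono (Icc_subset_Icc hac hdb)
  map_eq s hs := h.map_eq s (Icc_subset_Icc hac hdb hs)
  deriv_ne_zero s hs := h.deriv_ne_zero s (Ioo_subset_Ioo hac hdb hs)
  isRegularAnalyticArc c' d' hc' hcd' hd' :=
    h.isRegularAnalyticArc c' d' (hac.trans hc') hcd' (hd'.trans hdb)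

theorem continuousAt (h : IsLevelArc f σ a b) {s : ℝ} (hs : s ∈ Ioo a b) : ContinuousAt σ s :=
  h.continuousOn.continuousAt (Icc_mem_nhds hs.1 hs.2)

/-- Two level arcs over the same interval coincide or meet at most at their ends. -/
theorem eqOn_or_forall_ne (hf : Differentiable ℂ f) (hσ : IsLevelArc f σ a b)
    (hρ : IsLevelArc f ρ a b) : EqOn σ ρ (Icc a b) ∨ ∀ s ∈ Ioo a b, σ s ≠ ρ s := by
  have key := forall_or_forall_not_of_eventually (P := fun s => σ s = ρ s) (a := a) (b := b) ?_ ?_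
  · refine key.imp (fun h => ?_) id
    refine EqOn.of_subset_closure (s := Ioo a b) h hσ.continuousOn hρ.continuousOn
      Ioo_subset_Icc_self ?_
    rw [closure_Ioo hσ.lt.ne]
  · intro s hs h
    have hstrict := (hf.analyticAt (σ s)).hasStrictDerivAt
    have hinv := hstrict.eventually_left_inverse (hσ.deriv_ne_zero s hs)
    have hρs := (hρ.continuousAt hs).tendsto
    rw [← h] at hρs
    filter_upwards [(hσ.continuousAt hs).eventually hinv, hρs.eventually hinv,
      isOpen_Ioo.mem_nhds hs] with t h1 h2 ht
    rw [← h1, ← h2, hσ.map_eq t (Ioo_subset_Icc_self ht), hρ.map_eq t (Ioo_subset_Icc_self ht)]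
  · intro s hs h
    exact (((hσ.continuousAt hs).sub (hρ.continuousAt hs)).eventually_ne (sub_ne_zero.2 h)).mono
      fun t => sub_ne_zero.1

theorem inter_finite (hf : Differentiable ℂ f) (hσ : IsLevelArc f σ a b)
    (hρ : IsLevelArc f ρ a b) (hne : σ '' Icc a b ≠ ρ '' Icc a b) :
    (σ '' Icc a b ∩ ρ '' Icc a b).Finite := by
  rcases hσ.eqOn_or_forall_ne hf hρ with h | h
  · exact absurd h.image_eq hne
  · refine (toFinite {σ a, σ b}).subset ?_
    rintro z ⟨⟨s, hs, rfl⟩, t, ht, hts⟩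
    have hst : t = s := by
      have h1 := hσ.map_eq s hs
      rw [← hts, hρ.map_eq t ht] at h1
      exact_mod_cast h1
    rw [hst] at hts
    rcases eq_or_lt_of_le hs.1 with h1 | h1
    · exact Or.inl (by rw [h1])
    rcases eq_or_lt_of_le hs.2 with h2 | h2
    · exact Or.inr (by rw [h2]; rfl)
    exact absurd hts.symm (h s ⟨h1, h2⟩)

/-- A level arc is contained in a tail or meets it at most at its ends. -/
theorem subset_or_finite_inter (hσ : IsLevelArc f σ a b) (ha : -2 ≤ a) (hb : b ≤ 2) {T O : Set ℂ}
    (hT : IsTail f T O) : σ '' Icc a b ⊆ T ∨ (σ '' Icc a b ∩ T).Finite := by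
  have key := forall_or_forall_not_of_eventually (P := fun s => σ s ∈ T) (a := a) (b := b) ?_ ?_
  · rcases key with h | h
    · left
      have hcl : closure (Ioo a b) = Icc a b := closure_Ioo hσ.lt.ne
      have := ContinuousOn.image_closure (f := σ) (s := Ioo a b) (by rw [hcl]; exact hσ.continuousOn)
      rw [hcl] at this
      refine this.trans (closure_minimal ?_ hT.isClosed)
      rintro _ ⟨s, hs, rfl⟩
      exact h s hs
    · right
      refine (toFinite {σ a, σ b}).subset ?_
      rintro z ⟨⟨s, hs, rfl⟩, hz⟩
      rcases eq_or_lt_of_le hs.1 with h1 | h1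
      · exact Or.inl (by rw [h1])
      rcases eq_or_lt_of_le hs.2 with h2 | h2
      · exact Or.inr (by rw [h2]; rfl)
      exact absurd hz (h s ⟨h1, h2⟩)
  · intro s hs h
    have hO : σ s ∈ O := by
      by_contra hO
      have := hT.eq_or_eq _ h hO
      rw [hσ.map_eq s (Ioo_subset_Icc_self hs)] at this
      rcases this with h' | h'
      · have : s = 2 := by exact_mod_cast h'
        linarith [hs.2]
      · have : s = -2 := by exact_mod_cast h'
        linarith [hs.1]
    filter_upwards [(hσ.continuousAt hs).eventually (hT.isOpen.mem_nhds hO),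
      isOpen_Ioo.mem_nhds hs] with t h1 ht
    exact hT.mem _ h1 ⟨t, ⟨ha.trans ht.1.le, ht.2.le.trans hb⟩,
      hσ.map_eq t (Ioo_subset_Icc_self ht)⟩
  · intro s hs h
    exact (hσ.continuousAt hs).eventually (hT.isClosed.isOpen_compl.mem_nhds h)

end IsLevelArc

/-- A finite set of reals that contains `a` and `b` cuts `[a, b]` into intervals between
consecutive elements. -/
theorem exists_consecutive {Λ : Set ℝ} (hΛ : Λ.Finite) {a b s : ℝ} (ha : a ∈ Λ) (hb : b ∈ Λ)
    (hab : a < b) (hs : s ∈ Icc a b) : ∃ c ∈ Λ, ∃ d ∈ Λ, c < d ∧ a ≤ c ∧ d ≤ b ∧ s ∈ Icc c d ∧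
      ∀ e ∈ Λ, e ≤ c ∨ d ≤ e := by
  rcases eq_or_lt_of_le hs.2 with rfl | hsb
  · obtain ⟨c, ⟨hcΛ, hcs⟩, hc⟩ := exists_max_image (Λ ∩ Iio s) id (hΛ.inter_of_left _) ⟨a, ha, hab⟩
    exact ⟨c, hcΛ, s, hb, hcs, hc a ⟨ha, hab⟩, le_rfl, ⟨hcs.le, le_rfl⟩, fun e he =>
      (lt_or_ge e s).imp (fun h => hc e ⟨he, h⟩) id⟩
  · obtain ⟨c, ⟨hcΛ, hcs⟩, hc⟩ := exists_max_image (Λ ∩ Iic s) id (hΛ.inter_of_left _)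
      ⟨a, ha, hs.1⟩
    obtain ⟨d, ⟨hdΛ, hds⟩, hd⟩ := exists_min_image (Λ ∩ Ioi s) id (hΛ.inter_of_left _)
      ⟨b, hb, hsb⟩
    exact ⟨c, hcΛ, d, hdΛ, lt_of_le_of_lt hcs hds, hc a ⟨ha, hs.1⟩, hd b ⟨hb, hsb⟩,
      ⟨hcs, le_of_lt hds⟩, fun e he => (le_or_gt e s).imp (fun h => hc e ⟨he, h⟩)
        fun h => hd e ⟨he, h⟩⟩

/-- If, up to two tails, the set where `f` takes values in `[-2, 2]` is bounded, then this set is a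
finite union of regular analytic arcs with finite pairwise intersections. -/
theorem exists_regularAnalyticArcs {f : ℂ → ℂ} (hf : Differentiable ℂ f)
    (hf0 : ∀ z₀, ¬ ∀ᶠ z in 𝓝 z₀, f z = f z₀) {T₁ O₁ T₂ O₂ : Set ℂ} (h₁ : IsTail f T₁ O₁)
    (h₂ : IsTail f T₂ O₂) (h₁₂ : (T₁ ∩ T₂).Finite) {R : ℝ}
    (hR : ∀ z, (∃ t ∈ Icc (-2 : ℝ) 2, f z = t) → z ∉ T₁ → z ∉ T₂ → ‖z‖ ≤ R) :
    ∃ (N : ℕ) (A : Fin N → Set ℂ), (∀ i, IsRegularAnalyticArc (A i)) ∧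
      (∀ i j, i ≠ j → (A i ∩ A j).Finite) ∧ {z | ∃ t ∈ Icc (-2 : ℝ) 2, f z = t} = ⋃ i, A i := by
  set S : Set ℂ := {z | ∃ t ∈ Icc (-2 : ℝ) 2, f z = t} with hS
  have hSclosed : IsClosed S := by
    have : S = f ⁻¹' ((fun t : ℝ => (t : ℂ)) '' Icc (-2) 2) := by
      ext z
      constructor
      · rintro ⟨t, ht, h⟩
        exact ⟨t, ht, h.symm⟩
      · rintro ⟨t, ht, h⟩
        exact ⟨t, ht, h.symm⟩
    rw [this]
    exact (isCompact_Icc.image Complex.continuous_ofReal).isClosed.preimage hf.continuous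
  have hK : IsCompact (S ∩ Metric.closedBall 0 R) :=
    (isCompact_closedBall 0 R).inter_left hSclosed
  have hloc : ∀ z₀ : ℂ, ∃ A : Set ((ℝ → ℂ) × ℝ × ℝ), z₀ ∈ S → A.Finite ∧
      (∀ α ∈ A, IsLevelArc f α.1 α.2.1 α.2.2 ∧ -2 ≤ α.2.1 ∧ α.2.2 ≤ 2) ∧
      ∀ᶠ z in 𝓝 z₀, z ∈ S → ∃ α ∈ A, z ∈ α.1 '' Icc α.2.1 α.2.2 := by
    intro z₀
    by_cases hz₀ : z₀ ∈ S
    · obtain ⟨c, hc, hz₀c⟩ := hz₀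
      obtain ⟨A, hA⟩ := exists_isLevelArc_nhds hf hc hz₀c (hf0 z₀)
      exact ⟨A, fun _ => hA⟩
    · exact ⟨∅, fun h => absurd h hz₀⟩
  choose A hA using hloc
  obtain ⟨t, htK, ht⟩ := hK.elim_nhds_subcover
    (fun z₀ => {z | z ∈ S → ∃ α ∈ A z₀, z ∈ α.1 '' Icc α.2.1 α.2.2})
    fun z₀ hz₀ => (hA z₀ hz₀.1).2.2
  set 𝒜 : Set ((ℝ → ℂ) × ℝ × ℝ) := ⋃ z₀ ∈ t, A z₀ with h𝒜
  have h𝒜fin : 𝒜.Finite := t.finite_toSet.biUnion fun z₀ hz₀ => (hA z₀ (htK z₀ hz₀).1).1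
  have h𝒜arc : ∀ α ∈ 𝒜, IsLevelArc f α.1 α.2.1 α.2.2 ∧ -2 ≤ α.2.1 ∧ α.2.2 ≤ 2 := by
    intro α hα
    obtain ⟨z₀, hz₀, hα⟩ := mem_iUnion₂.1 hα
    exact (hA z₀ (htK z₀ hz₀).1).2.1 α hα
  have hcover : ∀ z ∈ S, ‖z‖ ≤ R → ∃ α ∈ 𝒜, z ∈ α.1 '' Icc α.2.1 α.2.2 := by
    intro z hz hzR
    obtain ⟨z₀, hz₀, h⟩ := mem_iUnion₂.1 (ht ⟨hz, mem_closedBall_zero_iff.2 hzR⟩)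
    obtain ⟨α, hα, hzα⟩ := h hz
    exact ⟨α, mem_iUnion₂.2 ⟨z₀, hz₀, hα⟩, hzα⟩
  -- The level arcs are cut at the values of `f` at all of their ends.
  set Λ : Set ℝ := (fun α => α.2.1) '' 𝒜 ∪ (fun α => α.2.2) '' 𝒜 with hΛ
  have hΛfin : Λ.Finite := (h𝒜fin.image _).union (h𝒜fin.image _)
  set 𝒬 : Set (Set ℂ) := {P | ∃ α ∈ 𝒜, ∃ c ∈ Λ, ∃ d ∈ Λ, c < d ∧ α.2.1 ≤ c ∧ d ≤ α.2.2 ∧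
    (∀ e ∈ Λ, e ≤ c ∨ d ≤ e) ∧ P = α.1 '' Icc c d} with h𝒬
  have h𝒬fin : 𝒬.Finite := by
    refine ((h𝒜fin.prod (hΛfin.prod hΛfin)).image
      fun β : ((ℝ → ℂ) × ℝ × ℝ) × ℝ × ℝ => β.1.1 '' Icc β.2.1 β.2.2).subset ?_
    rintro P ⟨α, hα, c, hc, d, hd, -, -, -, -, rfl⟩
    exact ⟨(α, c, d), ⟨hα, hc, hd⟩, rfl⟩
  have h𝒬pair : ∀ P ∈ 𝒬, ∀ P' ∈ 𝒬, P ≠ P' → (P ∩ P').Finite := by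
    rintro P ⟨α, hα, c, hc, d, hd, hcd, hac, hdb, hcons, rfl⟩ P'
      ⟨α', hα', c', hc', d', hd', hcd', hac', hdb', hcons', rfl⟩ hne
    have hσ := (h𝒜arc α hα).1.mono hac hcd hdb
    have hρ := (h𝒜arc α' hα').1.mono hac' hcd' hdb'
    by_cases heq : c = c' ∧ d = d'
    · obtain ⟨rfl, rfl⟩ := heq
      exact hσ.inter_finite hf hρ hne
    · -- Different intervals between consecutive elements have at most an end in common.
      refine (toFinite {α.1 c, α.1 d}).subset ?_
      rintro z ⟨⟨s, hs, rfl⟩, s', hs', hss'⟩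
      have h1 := hσ.map_eq s hs
      rw [← hss', hρ.map_eq s' hs'] at h1
      have h2 : s' = s := by exact_mod_cast h1
      subst h2
      rcases hcons c' hc' with h | h
      · rcases hcons d' hd' with h' | h'
        · exact Or.inl (by rw [le_antisymm (hs'.2.trans h') hs.1])
        · rcases hcons' c hc with k | k
          · rcases hcons' d hd with k' | k'
            · linarith
            · exact absurd ⟨le_antisymm k h, le_antisymm h' k'⟩ heq
          · linarith
      · exact Or.inr (by rw [le_antisymm hs.2 (h.trans hs'.1)]; rfl)
  have h𝒬tail : ∀ P ∈ 𝒬, ∀ {T O}, IsTail f T O → ¬ P ⊆ T → (P ∩ T).Finite := by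
    rintro P ⟨α, hα, c, hc, d, hd, hcd, hac, hdb, -, rfl⟩ T O hT hPT
    obtain ⟨h, ha, hb⟩ := h𝒜arc α hα
    exact ((h.mono hac hcd hdb).subset_or_finite_inter (ha.trans hac) (hdb.trans hb) hT).resolve_left
      hPT
  set ℱ : Set (Set ℂ) := {P ∈ 𝒬 | ¬ P ⊆ T₁ ∧ ¬ P ⊆ T₂} ∪ {T₁, T₂} with hℱ
  have hℱfin : ℱ.Finite := (h𝒬fin.subset (sep_subset _ _)).union (toFinite _)
  have hℱarc : ∀ P ∈ ℱ, IsRegularAnalyticArc P := by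
    rintro P (⟨⟨α, hα, c, hc, d, hd, hcd, hac, hdb, -, rfl⟩, -⟩ | rfl | rfl)
    · exact (h𝒜arc α hα).1.isRegularAnalyticArc c d hac hcd hdb
    · exact h₁.isRegularAnalyticArc
    · exact h₂.isRegularAnalyticArc
  have hℱpair : ∀ P ∈ ℱ, ∀ P' ∈ ℱ, P ≠ P' → (P ∩ P').Finite := by
    rintro P (⟨hP, hP1, hP2⟩ | rfl | rfl) P' (⟨hP', hP1', hP2'⟩ | rfl | rfl) hne
    · exact h𝒬pair P hP P' hP' hne
    · exact h𝒬tail P hP h₁ hP1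
    · exact h𝒬tail P hP h₂ hP2
    · rw [inter_comm]
      exact h𝒬tail P' hP' h₁ hP1'
    · exact absurd rfl hne
    · exact h₁₂
    · rw [inter_comm]
      exact h𝒬tail P' hP' h₂ hP2'
    · rw [inter_comm]
      exact h₁₂
    · exact absurd rfl hne
  have hℱunion : S = ⋃₀ ℱ := by
    apply Subset.antisymm
    · intro z hz
      by_cases hz1 : z ∈ T₁
      · exact ⟨T₁, Or.inr (Or.inl rfl), hz1⟩
      by_cases hz2 : z ∈ T₂
      · exact ⟨T₂, Or.inr (Or.inr rfl), hz2⟩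
      obtain ⟨α, hα, s, hs, rfl⟩ := hcover z hz (hR z hz hz1 hz2)
      obtain ⟨c, hc, d, hd, hcd, hac, hdb, hscd, hcons⟩ := exists_consecutive hΛfin
        (Or.inl ⟨α, hα, rfl⟩) (Or.inr ⟨α, hα, rfl⟩) (h𝒜arc α hα).1.lt hs
      exact ⟨_, Or.inl ⟨⟨α, hα, c, hc, d, hd, hcd, hac, hdb, hcons, rfl⟩,
        fun h => hz1 (h ⟨s, hscd, rfl⟩), fun h => hz2 (h ⟨s, hscd, rfl⟩)⟩, s, hscd, rfl⟩
    · rintro z ⟨P, ⟨⟨α, hα, c, hc, d, hd, hcd, hac, hdb, -, rfl⟩, -⟩ | rfl | rfl, hz⟩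
      · obtain ⟨s, hs, rfl⟩ := hz
        obtain ⟨h, ha, hb⟩ := h𝒜arc α hα
        exact ⟨s, ⟨ha.trans (hac.trans hs.1), hs.2.trans (hdb.trans hb)⟩,
          h.map_eq s ⟨hac.trans hs.1, hs.2.trans hdb⟩⟩
      · exact h₁.exists_eq z hz
      · exact h₂.exists_eq z hz
  have : Finite ℱ := hℱfin
  let e := Finite.equivFin ℱ
  refine ⟨_, fun i => (e.symm i : Set ℂ), fun i => hℱarc _ (e.symm i).2, fun i j hij => ?_, ?_⟩
  · refine hℱpair _ (e.symm i).2 _ (e.symm j).2 fun h => hij ?_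
    exact e.symm.injective (Subtype.ext h)
  · rw [hℱunion, sUnion_eq_iUnion]
    exact (e.symm.surjective.iUnion_comp fun P : ℱ => (P : Set ℂ)).symm

/-! ### The tails of the stability set -/

theorem im_eq_zero_of_cos_eq {z : ℂ} {t : ℝ} (ht : t ∈ Icc (-1 : ℝ) 1) (h : Complex.cos z = t) :
    z.im = 0 := by
  rw [← Real.cos_arccos ht.1 ht.2, Complex.ofReal_cos, Complex.cos_eq_cos_iff] at h
  obtain ⟨k, h | h⟩ := h
  · have := congrArg Complex.im h
    simp at this
    exact this.symm
  · have := congrArg Complex.im h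
    simp at this
    exact this

theorem isOpen_re_gt (R : ℝ) : IsOpen {E : ℂ | R < E.re} :=
  isOpen_lt continuous_const Complex.continuous_re

/-- On a half-plane `f` is twice the cosine of a function whose derivative is close to `Ω`. The
derivative is `w = √(-v² / u)`; the function `Z = (f - i D v / w) / 2` satisfies
`f = Z + Z⁻¹` and `Z' = i w Z`. -/
theorem exists_eq_two_mul_cos {f D u v : ℂ → ℂ} {Ω : ℝ} (hΩ : 0 < Ω) (hf : Differentiable ℂ f)
    (hDd : Differentiable ℂ D) (hud : Differentiable ℂ u) (hvd : Differentiable ℂ v)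
    (hD : ∀ z, ¬ ∀ᶠ E in 𝓝 z, D E = 0)
    (hu : ∀ E, f E ^ 2 - 4 = u E * D E ^ 2) (hv : ∀ E, deriv f E = D E * v E)
    (hlim : Tendsto (fun E => v E ^ 2 / u E) (cocompact ℂ) (𝓝 (-(Ω : ℂ) ^ 2))) :
    ∃ (R : ℝ) (W w : ℂ → ℂ), 0 < R ∧ ∀ E : ℂ, R < E.re →
      HasDerivAt W (w E) E ∧ ‖w E - Ω‖ ≤ Ω / 4 ∧ f E = 2 * Complex.cos (W E) := by
  have hΩ0 : (Ω : ℂ) ≠ 0 := Complex.ofReal_ne_zero.2 hΩ.ne'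
  set r : ℂ → ℂ := fun E => -(v E ^ 2 / u E) / (Ω : ℂ) ^ 2 with hr
  have hrlim : Tendsto r (cocompact ℂ) (𝓝 1) := by
    have := (hlim.neg).div_const ((Ω : ℂ) ^ 2)
    rwa [neg_neg, div_self (pow_ne_zero 2 hΩ0)] at this
  have hsqrt : ContinuousAt (fun z : ℂ => (Ω : ℂ) * z ^ (((2 : ℕ) : ℂ)⁻¹)) 1 :=
    continuousAt_const.mul (continuousAt_id.cpow continuousAt_const
      (by simp [Complex.one_mem_slitPlane]))
  have hev : ∀ᶠ E in cocompact ℂ, r E ∈ Complex.slitPlane ∧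
      ‖(Ω : ℂ) * r E ^ (((2 : ℕ) : ℂ)⁻¹) - Ω‖ ≤ Ω / 4 := by
    refine (hrlim.eventually (Complex.isOpen_slitPlane.mem_nhds Complex.one_mem_slitPlane)).and ?_
    have h1 := (hsqrt.tendsto.comp hrlim)
    rw [Complex.one_cpow, mul_one] at h1
    filter_upwards [h1.eventually (Metric.closedBall_mem_nhds (Ω : ℂ) (by positivity : 0 < Ω / 4))]
      with E hE
    have hE' : dist _ _ ≤ _ := hE
    rwa [dist_eq_norm] at hE'
  obtain ⟨R₀, hR₀⟩ := (Metric.hasBasis_cobounded_compl_closedBall (0 : ℂ)).eventually_iff.1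
    (Metric.cobounded_eq_cocompact (α := ℂ) ▸ hev)
  set R := max R₀ 1 with hR
  have hRbig : ∀ E : ℂ, R < E.re → r E ∈ Complex.slitPlane ∧
      ‖(Ω : ℂ) * r E ^ (((2 : ℕ) : ℂ)⁻¹) - Ω‖ ≤ Ω / 4 := by
    intro E hE
    refine hR₀.2 ?_
    rw [mem_compl_iff, mem_closedBall_zero_iff, not_le]
    exact lt_of_lt_of_le (lt_of_le_of_lt (le_max_left _ _) hE)
      ((le_abs_self _).trans (Complex.abs_re_le_norm E))
  set w : ℂ → ℂ := fun E => (Ω : ℂ) * r E ^ (((2 : ℕ) : ℂ)⁻¹) with hw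
  set P := {E : ℂ | R < E.re} with hP
  have hPo : IsOpen P := isOpen_re_gt R
  have hPc : Convex ℝ P := convex_halfSpace_re_gt R
  have hu0 : ∀ E ∈ P, u E ≠ 0 := by
    intro E hE h0
    have := (hRbig E hE).1
    rw [hr] at this
    simp [h0] at this
  have hw0 : ∀ E ∈ P, w E ≠ 0 := by
    intro E hE h0
    have h1 : ‖w E - Ω‖ ≤ Ω / 4 := (hRbig E hE).2
    rw [h0, zero_sub, norm_neg, Complex.norm_real, Real.norm_of_nonneg hΩ.le] at h1
    linarith
  have hw2 : ∀ E ∈ P, w E ^ 2 * u E = -v E ^ 2 := by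
    intro E hE
    rw [hw]
    simp only [mul_pow]
    rw [Complex.cpow_nat_inv_pow _ two_ne_zero, hr]
    have := hu0 E hE
    field_simp
  have hwd : ∀ E ∈ P, DifferentiableAt ℂ w E := by
    intro E hE
    have h1 : DifferentiableAt ℂ r E :=
      ((((hvd E).pow 2).div (hud E) (hu0 E hE)).neg).div_const _
    exact (h1.cpow_const (hRbig E hE).1).const_mul _
  obtain ⟨W₀, hW₀⟩ := hPc.exists_forall_hasDerivWithinAt (𝕜 := ℂ) (f := w)
    fun E hE => (hwd E hE).differentiableWithinAt
  have hW₀' : ∀ E ∈ P, HasDerivAt W₀ (w E) E := fun E hE =>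
    (hW₀ E hE).hasDerivAt (hPo.mem_nhds hE)
  set s : ℂ → ℂ := fun E => -(v E / w E) * D E with hs
  have hsd : ∀ E ∈ P, DifferentiableAt ℂ s E := fun E hE =>
    (((hvd E).div (hwd E hE) (hw0 E hE)).neg).mul (hDd E)
  have hs2 : ∀ E ∈ P, f E ^ 2 + s E ^ 2 = 4 := by
    intro E hE
    have h1 := hw2 E hE
    have h0 := hw0 E hE
    have hgen : ∀ {a b c d : ℂ}, b ≠ 0 → b ^ 2 * c = -a ^ 2 → (-(a / b) * d) ^ 2 = -(c * d ^ 2) := by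
      intro a b c d hb h
      field_simp
      linear_combination d ^ 2 * h
    have h2 : s E ^ 2 = -(u E * D E ^ 2) := hgen h0 h1
    rw [h2, ← hu E]
    ring
  have hfs : ∀ E ∈ P, deriv f E = -w E * s E := by
    intro E hE
    rw [hv, hs]
    have h0 := hw0 E hE
    field_simp
  have hv0 : ∀ E ∈ P, v E ≠ 0 := by
    intro E hE h0
    have h1 := hw2 E hE
    rw [h0, zero_pow two_ne_zero, neg_zero] at h1
    exact mul_ne_zero (pow_ne_zero 2 (hw0 E hE)) (hu0 E hE) h1
  -- Where `s ≠ 0`, the derivative of `f² + s² = 4` gives `s' = w f`; such points are dense.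
  have hsder : ∀ E ∈ P, deriv s E = w E * f E := by
    intro E hE
    by_contra hne
    have hcont : ContinuousAt (fun E => deriv s E - w E * f E) E := by
      have h1 : AnalyticAt ℂ s E :=
        (show DifferentiableOn ℂ s P from fun E hE => (hsd E hE).differentiableWithinAt).analyticAt
          (hPo.mem_nhds hE)
      exact h1.deriv.continuousAt.sub ((hwd E hE).continuousAt.mul (hf E).continuousAt)
    refine hD E ?_
    filter_upwards [hcont.eventually_ne (sub_ne_zero.2 hne), hPo.mem_nhds hE] with E' hE' hE'P
    have hd1 : HasDerivAt (fun E => f E ^ 2 + s E ^ 2)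
        (2 * f E' * deriv f E' + 2 * s E' * deriv s E') E' := by
      refine HasDerivAt.congr_deriv (((hf E').hasDerivAt.fun_pow 2).fun_add
        ((hsd E' hE'P).hasDerivAt.fun_pow 2)) ?_
      push_cast
      ring
    have hd2 : HasDerivAt (fun E => f E ^ 2 + s E ^ 2) 0 E' := by
      refine (hasDerivAt_const E' (4 : ℂ)).congr_of_eventuallyEq ?_
      filter_upwards [hPo.mem_nhds hE'P] with E'' hE''
      exact hs2 E'' hE''
    have h := hd1.unique hd2
    rw [hfs E' hE'P] at h
    have h3 : s E' * (deriv s E' - w E' * f E') = 0 := by linear_combination h / 2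
    rcases mul_eq_zero.1 h3 with h4 | h4
    · rw [hs] at h4
      rcases mul_eq_zero.1 h4 with h5 | h5
      · exact absurd (neg_eq_zero.1 h5) (div_ne_zero (hv0 E' hE'P) (hw0 E' hE'P))
      · exact h5
    · exact absurd h4 hE'
  set Z : ℂ → ℂ := fun E => (f E + Complex.I * s E) / 2 with hZ
  have hZZ : ∀ E ∈ P, Z E * ((f E - Complex.I * s E) / 2) = 1 := by
    intro E hE
    rw [hZ]
    linear_combination hs2 E hE / 4 - s E ^ 2 / 4 * Complex.I_sq
  have hconst : ∀ E ∈ P, ∀ E' ∈ P, Z E' * Complex.exp (-(Complex.I * W₀ E')) =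
      Z E * Complex.exp (-(Complex.I * W₀ E)) := by
    intro E hE E' hE'
    have hder : ∀ x ∈ P,
        HasDerivWithinAt (fun E => Z E * Complex.exp (-(Complex.I * W₀ E))) 0 P x := by
      intro x hx
      have h1 : HasDerivAt Z ((deriv f x + Complex.I * deriv s x) / 2) x :=
        ((hf x).hasDerivAt.add ((hsd x hx).hasDerivAt.const_mul Complex.I)).div_const 2
      have h2 := (((hW₀' x hx).const_mul Complex.I).neg).cexp
      refine ((h1.mul h2).congr_deriv ?_).hasDerivWithinAt
      rw [hfs x hx, hsder x hx, hZ]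
      linear_combination (-(w x * s x * Complex.exp (-(Complex.I * W₀ x))) / 2) * Complex.I_sq
    have := hPc.norm_image_sub_le_of_norm_hasDerivWithin_le hder (C := 0)
      (fun x _ => by rw [norm_zero]) hE hE'
    rw [zero_mul] at this
    exact sub_eq_zero.1 (norm_le_zero_iff.1 this)
  have hbase : ((R + 1 : ℝ) : ℂ) ∈ P := by
    change R < ((R + 1 : ℝ) : ℂ).re
    rw [Complex.ofReal_re]
    linarith
  set c := Z ((R + 1 : ℝ) : ℂ) * Complex.exp (-(Complex.I * W₀ ((R + 1 : ℝ) : ℂ))) with hc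
  have hc0 : c ≠ 0 :=
    mul_ne_zero (left_ne_zero_of_mul_eq_one (hZZ _ hbase)) (Complex.exp_ne_zero _)
  refine ⟨R, fun E => W₀ E - Complex.I * Complex.log c, w, lt_max_of_lt_right one_pos,
    fun E hE => ⟨(hW₀' E hE).sub_const _, (hRbig E hE).2, ?_⟩⟩
  have hZE : Z E = Complex.exp ((W₀ E - Complex.I * Complex.log c) * Complex.I) := by
    have h1 := hconst _ hbase E hE
    rw [← hc] at h1
    have h2 : (W₀ E - Complex.I * Complex.log c) * Complex.I =
        Complex.I * W₀ E + Complex.log c := by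
      linear_combination (-Complex.log c) * Complex.I_sq
    rw [h2, Complex.exp_add, Complex.exp_log hc0, ← h1, mul_left_comm, ← Complex.exp_add,
      add_neg_cancel, Complex.exp_zero, mul_one]
  have hZE' : (f E - Complex.I * s E) / 2 =
      Complex.exp (-(W₀ E - Complex.I * Complex.log c) * Complex.I) := by
    rw [neg_mul, Complex.exp_neg, ← hZE]
    exact eq_inv_of_mul_eq_one_right (hZZ E hE)
  rw [Complex.cos, ← hZE, ← hZE', hZ]
  ring

/-- The half-plane on which `f = 2 cos W` contains a tail, and it contains all points with large
real part in a strip around the real axis where `f` takes values in `[-2, 2]`. -/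
theorem exists_isTail {f : ℂ → ℂ} {Ω R K : ℝ} (hΩ : 0 < Ω) (hR : 0 < R)
    {W w : ℂ → ℂ} (hW : ∀ E : ℂ, R < E.re → HasDerivAt W (w E) E ∧ ‖w E - Ω‖ ≤ Ω / 4 ∧
      f E = 2 * Complex.cos (W E))
    (hK : ∀ E, (∃ t ∈ Icc (-2 : ℝ) 2, f E = t) → |E.im| ≤ K) :
    ∃ (T O : Set ℂ) (M : ℝ), IsTail f T O ∧ (∀ z ∈ T, 0 < z.re) ∧
      ∀ z, (∃ t ∈ Icc (-2 : ℝ) 2, f z = t) → 0 ≤ z.re → z ∉ T → ‖z‖ ≤ M := by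
  have hΩ0 : (Ω : ℂ) ≠ 0 := Complex.ofReal_ne_zero.2 hΩ.ne'
  set P := {E : ℂ | R < E.re} with hP
  have hPo : IsOpen P := isOpen_re_gt R
  have key : ∀ x ∈ P, ∀ y ∈ P, ‖W x - W y - Ω * (x - y)‖ ≤ Ω / 4 * ‖x - y‖ := by
    intro x hx y hy
    have := (convex_halfSpace_re_gt R).norm_image_sub_le_of_norm_hasDerivWithin_le (𝕜 := ℂ)
      (f := fun E => W E - Ω * E) (f' := fun E => w E - Ω * 1) (C := Ω / 4)
      (fun E hE => ((hW E hE).1.sub ((hasDerivAt_id E).const_mul (Ω : ℂ))).hasDerivWithinAt)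
      (fun E hE => by rw [mul_one]; exact (hW E hE).2.1) hy hx
    rwa [show W x - Ω * x - (W y - Ω * y) = W x - W y - Ω * (x - y) by ring] at this
  have hinj : InjOn W P := by
    intro x hx y hy hxy
    have := key x hx y hy
    rw [hxy, sub_self, zero_sub, norm_neg, norm_mul, Complex.norm_real,
      Real.norm_of_nonneg hΩ.le] at this
    have h0 : ‖x - y‖ ≤ 0 := by nlinarith [norm_nonneg (x - y)]
    exact sub_eq_zero.1 (norm_le_zero_iff.1 h0)
  set b : ℂ := ((R + 1 : ℝ) : ℂ) with hb
  have hbre : b.re = R + 1 := Complex.ofReal_re _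
  have hbP : b ∈ P := by
    change R < b.re
    linarith
  have hApprox : ApproximatesLinearOn W ((Ω : ℂ) • ContinuousLinearMap.id ℂ ℂ) P
      (Real.toNNReal (Ω / 4)) := fun x hx y hy => by
    rw [Real.coe_toNNReal _ (by positivity)]
    exact key x hx y hy
  let rinv : ((Ω : ℂ) • ContinuousLinearMap.id ℂ ℂ).NonlinearRightInverse :=
    { toFun := fun y => (Ω : ℂ)⁻¹ * y
      nnnorm := Real.toNNReal Ω⁻¹
      bound' := fun y => by
        rw [norm_mul, norm_inv, Complex.norm_real, Real.norm_of_nonneg hΩ.le,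
          Real.coe_toNNReal _ (by positivity)]
      right_inv' := fun y => by simp [hΩ0] }
  have hrad : (rinv.nnnorm : ℝ)⁻¹ - (Real.toNNReal (Ω / 4) : ℝ) = Ω - Ω / 4 := by
    rw [show rinv.nnnorm = Real.toNNReal Ω⁻¹ from rfl, Real.coe_toNNReal _ (by positivity),
      Real.coe_toNNReal _ (by positivity), inv_inv]
  -- `W` is close to the affine map with derivative `Ω` at `b`; the ball of radius `ρ / 3` about the
  -- affine preimage `c` of `t` stays in the half-plane and its image contains `t`.
  have hsurj : ∀ t : ℝ, (W b).re + |(W b).im| + 1 ≤ t → ∃ E : ℂ, R + 1 < E.re ∧ W E = t := by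
    intro t ht
    set ρ := ‖(t : ℂ) - W b‖ / Ω with hρ
    set c := b + ((t : ℂ) - W b) / Ω with hc
    have hcb : c - b = ((t : ℂ) - W b) / Ω := by rw [hc]; ring
    have hcbn : ‖c - b‖ = ρ := by
      rw [hcb, norm_div, Complex.norm_real, Real.norm_of_nonneg hΩ.le]
    have hcre : c.re = R + 1 + (t - (W b).re) / Ω := by
      rw [hc, Complex.add_re, hbre, Complex.div_ofReal_re, Complex.sub_re, Complex.ofReal_re]
    have habs : ‖(t : ℂ) - W b‖ ≤ 2 * (t - (W b).re) := by
      refine (Complex.norm_le_abs_re_add_abs_im _).trans ?_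
      rw [Complex.sub_re, Complex.sub_im, Complex.ofReal_re, Complex.ofReal_im, zero_sub, abs_neg,
        abs_of_nonneg (by linarith [abs_nonneg (W b).im])]
      linarith
    have hρle : ρ ≤ 2 * ((t - (W b).re) / Ω) := by
      rw [hρ, ← mul_div_assoc]
      gcongr
    have hd : 0 < (t - (W b).re) / Ω := div_pos (by linarith [abs_nonneg (W b).im]) hΩ
    have hρ0 : 0 ≤ ρ := by positivity
    have hball : ∀ E ∈ Metric.closedBall c (ρ / 3), R + 1 < E.re := by
      intro E hE
      rw [mem_closedBall_iff_norm] at hE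
      have h1 := (Complex.abs_re_le_norm (E - c)).trans hE
      rw [Complex.sub_re, abs_le] at h1
      linarith [h1.1]
    have hcP : c ∈ P := by
      have := hball c (Metric.mem_closedBall_self (by positivity))
      change R < c.re
      linarith
    have hs := hApprox.surjOn_closedBall_of_nonlinearRightInverse rinv (ε := ρ / 3) (b := c)
      (by positivity) fun E hE => by
        have := hball E hE
        change R < E.re
        linarith
    obtain ⟨E, hE, hEt⟩ := hs (show (t : ℂ) ∈ _ by
      rw [mem_closedBall_iff_norm', hrad]
      have h1 := key c hcP b hbP
      rw [hcbn, hcb, mul_div_cancel₀ _ hΩ0,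
        show W c - W b - ((t : ℂ) - W b) = W c - t by ring] at h1
      linarith)
    exact ⟨E, hball E hE, hEt⟩
  obtain ⟨N, hN⟩ := exists_nat_ge ((W b).re + |(W b).im| + 2)
  -- The tail starts at a multiple of `2π`, where `f = 2`.
  set t₀ : ℝ := N * (2 * Real.pi) with ht₀
  have ht₀N : (W b).re + |(W b).im| + 2 ≤ t₀ := by
    refine hN.trans ?_
    rw [ht₀]
    have : (1 : ℝ) ≤ 2 * Real.pi := by linarith [Real.two_le_pi]
    exact le_mul_of_one_le_right (Nat.cast_nonneg N) this
  have hex : ∀ t : ℝ, ∃ E : ℂ, t₀ - 1 ≤ t → R + 1 < E.re ∧ W E = t := by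
    intro t
    by_cases h : t₀ - 1 ≤ t
    · obtain ⟨E, hE⟩ := hsurj t (by linarith)
      exact ⟨E, fun _ => hE⟩
    · exact ⟨0, fun h' => absurd h' h⟩
  choose γ hγ using hex
  have hγP : ∀ t, t₀ - 1 ≤ t → γ t ∈ P := by
    intro t ht
    have := (hγ t ht).1
    change R < (γ t).re
    linarith
  have hWan : ∀ E ∈ P, AnalyticAt ℂ W E := fun E hE =>
    (show DifferentiableOn ℂ W P from fun E hE =>
      (hW E hE).1.differentiableAt.differentiableWithinAt).analyticAt (hPo.mem_nhds hE)
  have hw0 : ∀ E ∈ P, w E ≠ 0 := by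
    intro E hE h0
    have h1 : ‖w E - Ω‖ ≤ Ω / 4 := (hW E hE).2.1
    rw [h0, zero_sub, norm_neg, Complex.norm_real, Real.norm_of_nonneg hΩ.le] at h1
    linarith
  have hγan : ∀ t, t₀ - 1 < t → AnalyticAt ℝ γ t := by
    intro t ht
    have hE := hγP t ht.le
    have hWt := (hγ t ht.le).2
    have hder : deriv W (γ t) ≠ 0 := by
      rw [(hW _ hE).1.deriv]
      exact hw0 _ hE
    set ψ := (hWan _ hE).hasStrictDerivAt.localInverse _ _ _ hder with hψ
    have hψan : AnalyticAt ℂ ψ t := by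
      rw [← hWt]
      exact (hWan _ hE).analyticAt_localInverse hder
    have hψt : ψ t = γ t := by
      have := HasStrictFDerivAt.localInverse_apply_image
        ((hWan _ hE).hasStrictDerivAt.hasStrictFDerivAt_equiv hder)
      rwa [hWt] at this
    have hright : ∀ᶠ z in 𝓝 (t : ℂ), W (ψ z) = z := by
      have := HasStrictDerivAt.eventually_right_inverse (hWan _ hE).hasStrictDerivAt hder
      rwa [hWt] at this
    have hψP : ∀ᶠ z in 𝓝 (t : ℂ), ψ z ∈ P := by
      refine hψan.continuousAt.eventually (hPo.mem_nhds ?_)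
      rw [hψt]
      exact hE
    have h1 : AnalyticAt ℝ (fun s : ℝ => ψ s) t :=
      (hψan.restrictScalars (𝕜 := ℝ)).comp_of_eq (Complex.ofRealCLM.analyticAt t) rfl
    refine h1.congr ?_
    have hofReal : Tendsto (fun s : ℝ => (s : ℂ)) (𝓝 t) (𝓝 (t : ℂ)) :=
      Complex.continuous_ofReal.tendsto t
    filter_upwards [hofReal.eventually hright, hofReal.eventually hψP, Ioi_mem_nhds ht]
      with s hs hsP hst
    have hst' : t₀ - 1 ≤ s := le_of_lt hst
    exact hinj hsP (hγP s hst') (by rw [hs, (hγ s hst').2])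
  have hTeq : γ '' Ici t₀ = {E : ℂ | R + 1 ≤ E.re} ∩ W ⁻¹' {z | z.im = 0 ∧ t₀ ≤ z.re} := by
    ext E
    constructor
    · rintro ⟨t, ht, rfl⟩
      have ht' : t₀ ≤ t := ht
      obtain ⟨h1, h2⟩ := hγ t (by linarith)
      refine ⟨h1.le, ?_⟩
      rw [mem_preimage, h2]
      exact ⟨Complex.ofReal_im t, by rwa [Complex.ofReal_re]⟩
    · rintro ⟨h1, h2, h3⟩
      have h1' : R + 1 ≤ E.re := h1
      have hEP : R < E.re := by linarith
      refine ⟨(W E).re, h3, hinj (hγP _ (by linarith)) hEP ?_⟩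
      rw [(hγ _ (by linarith)).2]
      exact Complex.ext (Complex.ofReal_re _) (by rw [Complex.ofReal_im, h2])
  have hWcont : ContinuousOn W P := fun E hE => (hW E hE).1.continuousAt.continuousWithinAt
  have him : ∀ z, z ∈ P → (∃ t ∈ Icc (-2 : ℝ) 2, f z = t) → (W z).im = 0 := by
    rintro z hz ⟨t, ht, hzt⟩
    rw [(hW z hz).2.2] at hzt
    refine im_eq_zero_of_cos_eq (t := t / 2) ⟨by linarith [ht.1], by linarith [ht.2]⟩ ?_
    push_cast
    linear_combination hzt / 2
  refine ⟨γ '' Ici t₀, {E : ℂ | R + 1 < E.re} ∩ W ⁻¹' {z | t₀ < z.re},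
    max (R + 1) (R + 1 + (t₀ - (W b).re + Ω / 4 * K) * (4 / (3 * Ω))) + K,
    ⟨?_, ?_, ?_, ?_, ?_, ?_⟩, ?_, ?_⟩
  · refine ⟨Ici t₀, γ, ordConnected_Ici, isClosed_Ici, ⟨t₀, self_mem_Ici, t₀ + 1, ?_, ?_⟩,
      fun t ht => ?_, fun t ht => ?_, fun t ht t' ht' h => ?_, ?_, rfl⟩
    · exact (by linarith : t₀ ≤ t₀ + 1)
    · linarith
    · exact hγan t (by have ht' : t₀ ≤ t := ht; linarith)
    · have ht' : t₀ ≤ t := ht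
      intro h0
      have h1 := (hγan t (by linarith)).differentiableAt.hasDerivAt
      have h2 := (hW (γ t) (hγP t (by linarith))).1.scomp_of_eq t h1 rfl
      have h3 : HasDerivAt (W ∘ γ) (1 : ℂ) t := by
        refine (Complex.ofRealCLM.hasDerivAt (x := t)).congr_of_eventuallyEq ?_
        filter_upwards [Ioi_mem_nhds (show t₀ - 1 < t by linarith)] with s hs
        exact (hγ s (le_of_lt hs)).2
      have h4 := h2.unique h3
      rw [h0, zero_smul] at h4
      exact zero_ne_one h4
    · have h1 := (hγ t (by have ht2 : t₀ ≤ t := ht; linarith)).2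
      have h2 := (hγ t' (by have ht2 : t₀ ≤ t' := ht'; linarith)).2
      rw [h, h2] at h1
      exact_mod_cast h1.symm
    · rw [← Metric.cobounded_eq_cocompact (α := ℂ), ← tendsto_norm_atTop_iff_cobounded]
      have hlow : ∀ t ∈ Ici t₀, 4 / (5 * Ω) * (‖t‖ - ‖W b‖) - ‖b‖ ≤ ‖γ t‖ := by
        intro t ht
        have ht' : t₀ ≤ t := ht
        have h1 := key (γ t) (hγP t (by linarith)) b hbP
        rw [(hγ t (by linarith)).2] at h1
        have h2 : ‖(t : ℂ) - W b‖ ≤ Ω / 4 * ‖γ t - b‖ + Ω * ‖γ t - b‖ := by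
          have h3 : (t : ℂ) - W b = ((t : ℂ) - W b - Ω * (γ t - b)) + Ω * (γ t - b) := by ring
          have h4 : ‖(Ω : ℂ) * (γ t - b)‖ = Ω * ‖γ t - b‖ := by
            rw [norm_mul, Complex.norm_real, Real.norm_of_nonneg hΩ.le]
          calc ‖(t : ℂ) - W b‖ = ‖((t : ℂ) - W b - Ω * (γ t - b)) + Ω * (γ t - b)‖ := by rw [← h3]
            _ ≤ _ := norm_add_le _ _
            _ ≤ _ := by rw [h4]; linarith
        have h5 : ‖t‖ - ‖W b‖ ≤ ‖(t : ℂ) - W b‖ := by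
          rw [← Complex.norm_real t]
          exact norm_sub_norm_le _ _
        have h6 := norm_sub_le (γ t) b
        have h7 : ‖t‖ - ‖W b‖ ≤ 5 * Ω / 4 * (‖γ t‖ + ‖b‖) := by nlinarith
        have h8 : 4 / (5 * Ω) * (‖t‖ - ‖W b‖) ≤ 4 / (5 * Ω) * (5 * Ω / 4 * (‖γ t‖ + ‖b‖)) := by
          gcongr
        have h9 : 4 / (5 * Ω) * (5 * Ω / 4 * (‖γ t‖ + ‖b‖)) = ‖γ t‖ + ‖b‖ := by
          field_simp
        linarith
      refine tendsto_atTop_mono' _ (f₁ := fun t => 4 / (5 * Ω) * (‖t‖ - ‖W b‖) - ‖b‖) ?_ ?_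
      · exact (eventually_principal.2 hlow).filter_mono inf_le_right
      · refine Tendsto.mono_left ?_ inf_le_left
        have h1 : Tendsto (fun t : ℝ => ‖t‖) (cocompact ℝ) atTop := tendsto_norm_cocompact_atTop
        have h2 := (tendsto_atTop_add_const_right _ (-‖W b‖) h1).const_mul_atTop
          (show 0 < 4 / (5 * Ω) by positivity)
        exact tendsto_atTop_add_const_right _ (-‖b‖) h2
  · rw [hTeq]
    refine ContinuousOn.preimage_isClosed_of_isClosed (hWcont.mono fun E hE => ?_)
      (isClosed_le continuous_const Complex.continuous_re) ?_
    · have : R + 1 ≤ E.re := hE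
      change R < E.re
      linarith
    · exact (isClosed_eq Complex.continuous_im continuous_const).inter
        (isClosed_le continuous_const Complex.continuous_re)
  · refine ContinuousOn.isOpen_inter_preimage (hWcont.mono fun E hE => ?_) (isOpen_re_gt (R + 1))
      (isOpen_re_gt t₀)
    have : R + 1 < E.re := hE
    change R < E.re
    linarith
  · rintro _ ⟨t, ht, rfl⟩
    have ht' : t₀ ≤ t := ht
    refine ⟨2 * Real.cos t, ⟨by linarith [Real.neg_one_le_cos t], by linarith [Real.cos_le_one t]⟩,
      ?_⟩
    rw [(hW _ (hγP t (by linarith))).2.2, (hγ t (by linarith)).2]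
    push_cast
    rfl
  · rintro z ⟨hz1, hz2⟩ hzS
    have hz1' : R + 1 < z.re := hz1
    have hzP : z ∈ P := by
      change R < z.re
      linarith
    rw [hTeq]
    exact ⟨hz1'.le, him z hzP hzS, le_of_lt hz2⟩
  · rintro _ ⟨t, ht, rfl⟩ hO
    have ht' : t₀ ≤ t := ht
    obtain ⟨h1, h2⟩ := hγ t (by linarith)
    have ht'' : t = t₀ := by
      refine le_antisymm (not_lt.1 fun h => hO ⟨h1, ?_⟩) ht'
      rw [mem_preimage, h2]
      change t₀ < ((t : ℝ) : ℂ).re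
      rwa [Complex.ofReal_re]
    left
    rw [(hW _ (hγP t (by linarith))).2.2, h2, ht'', ht₀, ← Complex.ofReal_cos,
      Real.cos_nat_mul_two_pi]
    norm_num
  · rintro _ ⟨t, ht, rfl⟩
    have ht' : t₀ ≤ t := ht
    linarith [(hγ t (by linarith)).1]
  · intro z hzS hz0 hzT
    have hzK := hK z hzS
    have hre : z.re ≤ max (R + 1) (R + 1 + (t₀ - (W b).re + Ω / 4 * K) * (4 / (3 * Ω))) := by
      rcases le_or_gt z.re (R + 1) with h | h
      · exact h.trans (le_max_left _ _)
      refine le_trans ?_ (le_max_right _ _)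
      have hzP : z ∈ P := by
        change R < z.re
        linarith
      have hlt : (W z).re < t₀ := by
        by_contra! h'
        refine hzT ?_
        rw [hTeq]
        exact ⟨h.le, him z hzP hzS, h'⟩
      have h1 := (Complex.abs_re_le_norm _).trans (key z hzP b hbP)
      have h2 := Complex.norm_le_abs_re_add_abs_im (z - b)
      have hbim : b.im = 0 := Complex.ofReal_im _
      rw [Complex.sub_re, Complex.sub_im, hbre, hbim, sub_zero, abs_of_pos (by linarith)] at h2
      rw [Complex.sub_re, Complex.sub_re, Complex.re_ofReal_mul, Complex.sub_re, hbre, abs_le] at h1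
      have h3 : Ω / 4 * ‖z - b‖ ≤ Ω / 4 * ((z.re - (R + 1)) + K) := by
        gcongr
        linarith
      have h4 : 3 * Ω / 4 * (z.re - (R + 1)) ≤ t₀ - (W b).re + Ω / 4 * K := by
        nlinarith [h1.1]
      have h5 : 4 / (3 * Ω) * (3 * Ω / 4 * (z.re - (R + 1))) ≤
          4 / (3 * Ω) * (t₀ - (W b).re + Ω / 4 * K) := by gcongr
      have h6 : 4 / (3 * Ω) * (3 * Ω / 4 * (z.re - (R + 1))) = z.re - (R + 1) := by
        field_simp
      linarith
    refine (Complex.norm_le_abs_re_add_abs_im z).trans ?_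
    rw [abs_of_nonneg hz0]
    linarith

/-! ### The trace at infinity -/

theorem tendsto_eval_div_pow {P : ℂ[X]} {N : ℕ} (hP : P.natDegree ≤ N) :
    Tendsto (fun E => P.eval E / E ^ N) (cocompact ℂ) (𝓝 (P.coeff N)) := by
  have hinv : Tendsto (fun E : ℂ => E⁻¹) (cocompact ℂ) (𝓝 0) := by
    rw [← Metric.cobounded_eq_cocompact]
    exact tendsto_inv₀_cobounded
  have h1 : Tendsto (fun E : ℂ => ∑ i ∈ Finset.range (N + 1), P.coeff i * E⁻¹ ^ (N - i))
      (cocompact ℂ) (𝓝 (∑ i ∈ Finset.range (N + 1), P.coeff i * 0 ^ (N - i))) :=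
    tendsto_finsetSum _ fun i _ => (hinv.pow (N - i)).const_mul _
  rw [Finset.sum_range_succ, Nat.sub_self, pow_zero, mul_one, Finset.sum_eq_zero, zero_add] at h1
  · refine h1.congr' ?_
    have hne : ∀ᶠ E : ℂ in cocompact ℂ, E ≠ 0 := by
      have := (isCompact_singleton (x := (0 : ℂ))).compl_mem_cocompact
      filter_upwards [this] with E hE
      exact hE
    filter_upwards [hne] with E hE
    rw [eval_eq_sum_range' (Nat.lt_succ_of_le hP), Finset.sum_div]
    refine Finset.sum_congr rfl fun i hi => ?_
    have hi' : i ≤ N := Nat.lt_succ_iff.1 (Finset.mem_range.1 hi)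
    rw [inv_pow, mul_div_assoc]
    congr 1
    rw [eq_div_iff (pow_ne_zero _ hE), inv_mul_eq_div, div_eq_iff (pow_ne_zero _ hE), ← pow_add,
      Nat.add_sub_cancel' hi']
  · intro i hi
    rw [zero_pow (by have := Finset.mem_range.1 hi; omega), mul_zero]

section

variable {τ D : ℂ → ℂ} {U : ℂ[X]} {Ω C R : ℝ} (hΩ : 0 < Ω) (hC : 0 < C)
  (hτ : ∀ E : ℂ, R ≤ ‖E‖ → ‖τ E - 2 * Complex.cos (E * Ω)‖ ≤ C / ‖E‖ * Real.exp (|E.im| * Ω))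
  (hτd : Differentiable ℂ τ)

include hΩ hC hτ hτd in
/-- Cauchy's estimate on circles of radius one. -/
theorem norm_deriv_add_le {E : ℂ} (hE : max R 1 + 1 ≤ ‖E‖) :
    ‖deriv τ E + 2 * Ω * Complex.sin (E * Ω)‖ ≤
      C * Real.exp Ω / (‖E‖ - 1) * Real.exp (|E.im| * Ω) := by
  have hd : ∀ E, HasDerivAt (fun E => τ E - 2 * Complex.cos (E * Ω))
      (deriv τ E + 2 * Ω * Complex.sin (E * Ω)) E := by
    intro E
    have h1 := ((hasDerivAt_id E).mul_const (Ω : ℂ)).ccos.const_mul 2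
    refine ((hτd E).hasDerivAt.sub h1).congr_deriv ?_
    simp only [id]
    ring
  have hE1 : 0 < ‖E‖ - 1 := by linarith [le_max_right R 1]
  have hsphere : ∀ z ∈ Metric.sphere E 1, ‖τ z - 2 * Complex.cos (z * Ω)‖ ≤
      C * Real.exp Ω / (‖E‖ - 1) * Real.exp (|E.im| * Ω) := by
    intro z hz
    have hzE : ‖z - E‖ = 1 := mem_sphere_iff_norm.1 hz
    have h1 : ‖E‖ - 1 ≤ ‖z‖ := by
      have := norm_sub_norm_le E z
      rw [norm_sub_rev, hzE] at this
      linarith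
    refine (hτ z (by linarith [le_max_left R 1])).trans ?_
    have him : |z.im| ≤ |E.im| + 1 := by
      have h2 := Complex.abs_im_le_norm (z - E)
      rw [hzE, Complex.sub_im] at h2
      have h3 := abs_sub_abs_le_abs_sub z.im E.im
      linarith
    have hexp : Real.exp (|z.im| * Ω) ≤ Real.exp Ω * Real.exp (|E.im| * Ω) := by
      rw [← Real.exp_add]
      refine Real.exp_le_exp.2 ?_
      nlinarith
    calc C / ‖z‖ * Real.exp (|z.im| * Ω)
        ≤ C / (‖E‖ - 1) * (Real.exp Ω * Real.exp (|E.im| * Ω)) := by gcongr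
      _ = _ := by ring
  have hdiff : Differentiable ℂ fun E => τ E - 2 * Complex.cos (E * Ω) := fun E =>
    (hd E).differentiableAt
  have := Complex.norm_deriv_le_of_forall_mem_sphere_norm_le one_pos hdiff.diffContOnCl hsphere
  rwa [(hd E).deriv, div_one] at this

include hΩ hτ in
/-- The preimage of `[-2, 2]` lies in a horizontal strip, since `2 cos (Ω E)` dominates the error
term far from the real axis. -/
theorem exists_abs_im_le : ∃ K : ℝ, ∀ E, (∃ t ∈ Icc (-2 : ℝ) 2, τ E = t) → |E.im| ≤ K := by
  refine ⟨max (max (max R 1) (2 * C)) (6 / Ω), fun E ⟨t, ht, hEt⟩ => ?_⟩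
  rcases lt_or_ge ‖E‖ (max (max R 1) (2 * C)) with h | h
  · exact (Complex.abs_im_le_norm E).trans (h.le.trans (le_max_left _ _))
  refine le_trans ?_ (le_max_right _ _)
  have h1 : R ≤ ‖E‖ := ((le_max_left _ _).trans (le_max_left _ _)).trans h
  have h2 : 1 ≤ ‖E‖ := ((le_max_right _ _).trans (le_max_left _ _)).trans h
  have h3 : C / ‖E‖ ≤ 1 / 2 := by
    rw [div_le_iff₀ (by linarith)]
    linarith [(le_max_right _ _).trans h]
  have h4 := hτ E h1
  have h5 : ‖τ E‖ ≤ 2 := by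
    rw [hEt, Complex.norm_real, Real.norm_eq_abs, abs_le]
    exact ht
  set x := |E.im| * Ω with hx
  have hx0 : 0 ≤ x := by positivity
  have hcos : Real.exp x - 1 ≤ ‖2 * Complex.cos (E * Ω)‖ := by
    rw [Complex.two_cos]
    have e1 : ‖Complex.exp (E * Ω * Complex.I)‖ = Real.exp (-(E.im * Ω)) := by
      rw [Complex.norm_exp]
      simp
    have e2 : ‖Complex.exp (-(E * Ω) * Complex.I)‖ = Real.exp (E.im * Ω) := by
      rw [Complex.norm_exp]
      simp
    rcases le_total 0 E.im with h | h
    · have := norm_sub_le_norm_add (Complex.exp (-(E * Ω) * Complex.I))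
        (Complex.exp (E * Ω * Complex.I))
      rw [e1, e2, add_comm] at this
      rw [hx, abs_of_nonneg h]
      have : Real.exp (-(E.im * Ω)) ≤ 1 := Real.exp_le_one_iff.2 (by nlinarith)
      linarith
    · have := norm_sub_le_norm_add (Complex.exp (E * Ω * Complex.I))
        (Complex.exp (-(E * Ω) * Complex.I))
      rw [e1, e2] at this
      rw [hx, abs_of_nonpos h, neg_mul]
      have : Real.exp (E.im * Ω) ≤ 1 := Real.exp_le_one_iff.2 (by nlinarith)
      linarith
  have h6 : ‖2 * Complex.cos (E * Ω)‖ ≤ ‖τ E‖ + ‖τ E - 2 * Complex.cos (E * Ω)‖ := by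
    have := norm_sub_le (τ E) (τ E - 2 * Complex.cos (E * Ω))
    rwa [sub_sub_cancel] at this
  have h7 : C / ‖E‖ * Real.exp x ≤ 1 / 2 * Real.exp x := by gcongr
  have h8 : Real.exp x ≤ 6 := by linarith
  rw [le_div_iff₀ hΩ]
  linarith [Real.add_one_le_exp x]

include hΩ hC hτ hτd in
/-- On the positive imaginary axis `τ` and `τ'` are asymptotic to `exp (Ω y)` and
`-i Ω exp (Ω y)`. -/
theorem tendsto_mul_exp_imaginary_axis :
    Tendsto (fun y : ℝ => τ (y * Complex.I) * Complex.exp (-(y * Ω))) atTop (𝓝 1) ∧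
      Tendsto (fun y : ℝ => deriv τ (y * Complex.I) * Complex.exp (-(y * Ω))) atTop
        (𝓝 (-(Complex.I * Ω))) := by
  have hnorm : ∀ y : ℝ, 0 ≤ y → ‖(y : ℂ) * Complex.I‖ = y := fun y hy => by
    rw [norm_mul, Complex.norm_I, mul_one, Complex.norm_real, Real.norm_of_nonneg hy]
  have hnexp : ∀ y : ℝ, ‖Complex.exp (-(y * Ω))‖ = Real.exp (-(y * Ω)) := fun y => by
    rw [Complex.norm_exp]
    simp
  have him : ∀ y : ℝ, 0 ≤ y → |((y : ℂ) * Complex.I).im| = y := fun y hy => by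
    simp [abs_of_nonneg hy]
  have hexp1 : ∀ y : ℝ, Complex.exp (-(y * Complex.I * Ω) * Complex.I) * Complex.exp (-(y * Ω)) =
      1 := fun y => by
    rw [← Complex.exp_add, ← Complex.exp_zero]
    congr 1
    linear_combination (-(y : ℂ) * Ω) * Complex.I_sq
  have hexp2 : ∀ y : ℝ, Complex.exp (y * Complex.I * Ω * Complex.I) * Complex.exp (-(y * Ω)) =
      Complex.exp (-(y * Ω)) ^ 2 := fun y => by
    rw [← Complex.exp_add, ← Complex.exp_nat_mul]
    congr 1
    push_cast
    linear_combination (y : ℂ) * Ω * Complex.I_sq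
  have hdecay : Tendsto (fun y : ℝ => Complex.exp (-(y * Ω))) atTop (𝓝 0) := by
    rw [tendsto_zero_iff_norm_tendsto_zero]
    simp only [hnexp]
    exact Real.tendsto_exp_neg_atTop_nhds_zero.comp (tendsto_id.atTop_mul_const hΩ)
  have hinv : Tendsto (fun y : ℝ => C / y) atTop (𝓝 0) := tendsto_const_nhds.div_atTop tendsto_id
  have hinv' : Tendsto (fun y : ℝ => C * Real.exp Ω / (y - 1)) atTop (𝓝 0) :=
    tendsto_const_nhds.div_atTop (tendsto_atTop_add_const_right _ _ tendsto_id)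
  constructor
  · have h1 : Tendsto (fun y : ℝ => (τ (y * Complex.I) - 2 * Complex.cos (y * Complex.I * Ω)) *
        Complex.exp (-(y * Ω))) atTop (𝓝 0) := by
      refine squeeze_zero_norm' ?_ hinv
      filter_upwards [eventually_ge_atTop R, eventually_ge_atTop 0] with y hyR hy0
      have := hτ (y * Complex.I) (by rwa [hnorm y hy0])
      rw [hnorm y hy0, him y hy0] at this
      rw [norm_mul, hnexp]
      calc _ ≤ C / y * Real.exp (y * Ω) * Real.exp (-(y * Ω)) := by gcongr
        _ = C / y := by rw [mul_assoc, ← Real.exp_add, add_neg_cancel, Real.exp_zero, mul_one]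
    have h2 : Tendsto (fun y : ℝ => Complex.exp (-(y * Ω)) ^ 2 + 1) atTop (𝓝 (0 ^ 2 + 1)) :=
      (hdecay.pow 2).add_const 1
    have h3 := h1.add h2
    rw [zero_pow two_ne_zero, zero_add, zero_add] at h3
    refine h3.congr fun y => ?_
    rw [Complex.two_cos, ← hexp1 y, ← hexp2 y]
    ring
  · have h1 : Tendsto (fun y : ℝ => (deriv τ (y * Complex.I) +
        2 * Ω * Complex.sin (y * Complex.I * Ω)) * Complex.exp (-(y * Ω))) atTop (𝓝 0) := by
      refine squeeze_zero_norm' ?_ hinv'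
      filter_upwards [eventually_ge_atTop (max R 1 + 1), eventually_ge_atTop 0] with y hyR hy0
      have := norm_deriv_add_le hΩ hC hτ hτd (E := y * Complex.I) (by rwa [hnorm y hy0])
      rw [hnorm y hy0, him y hy0] at this
      rw [norm_mul, hnexp]
      calc _ ≤ C * Real.exp Ω / (y - 1) * Real.exp (y * Ω) * Real.exp (-(y * Ω)) := by gcongr
        _ = C * Real.exp Ω / (y - 1) := by
          rw [mul_assoc, ← Real.exp_add, add_neg_cancel, Real.exp_zero, mul_one]
    have h2 : Tendsto (fun y : ℝ => Complex.I * Ω * Complex.exp (-(y * Ω)) ^ 2 - Complex.I * Ω)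
        atTop (𝓝 (Complex.I * Ω * 0 ^ 2 - Complex.I * Ω)) :=
      ((hdecay.pow 2).const_mul _).sub_const _
    have h3 := h1.add h2
    rw [zero_pow two_ne_zero, mul_zero, zero_add, zero_sub] at h3
    refine h3.congr fun y => ?_
    have h4 : 2 * Complex.sin (y * Complex.I * Ω) * Complex.exp (-(y * Ω)) =
        (1 - Complex.exp (-(y * Ω)) ^ 2) * Complex.I := by
      rw [Complex.two_sin, ← hexp2 y]
      linear_combination Complex.I * hexp1 y
    linear_combination Ω * h4

include hΩ hC hτ hτd in
/-- The derivative of the trace is a polynomial multiple of `D`. -/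
theorem exists_deriv_eq_eval_mul (hD : Differentiable ℂ D)
    (hU : ∀ E, τ E ^ 2 - 4 = U.eval E * D E ^ 2) :
    ∃ V : ℂ[X], V.natDegree ≤ U.natDegree / 2 ∧ ∀ E, deriv τ E = V.eval E * D E := by
  obtain ⟨-, hD0⟩ := ne_zero_of_sq_sub_four hΩ hC hτ hU hD
  obtain ⟨v, hv, hτv⟩ := exists_entire_quotient hD hτd.deriv hD0
    fun E => le_analyticOrderAt_deriv_of_sq hτd hD hU E
  obtain ⟨V, hVd, hV⟩ := exists_polynomial_of_mul_eq hΩ hC hτ hU hv hτv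
    (C' := C * Real.exp Ω + 2 * Ω) (R' := max R 1 + 1) fun E hE => by
      have h1 := norm_deriv_add_le hΩ hC hτ hτd hE
      have hE1 : 1 ≤ ‖E‖ - 1 := by linarith [le_max_right R 1]
      have h2 : C * Real.exp Ω / (‖E‖ - 1) ≤ C * Real.exp Ω :=
        div_le_self (by positivity) hE1
      have h3 : ‖Complex.sin (E * Ω)‖ ≤ Real.exp (|E.im| * Ω) := by
        have := norm_cos_le_exp_abs_im (E * Ω - Real.pi / 2)
        rw [Complex.cos_sub_pi_div_two] at this
        refine this.trans_eq ?_
        congr 1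
        rw [show (E * Ω - Real.pi / 2 : ℂ) = E * Ω - ((Real.pi / 2 : ℝ) : ℂ) by push_cast; ring,
          Complex.sub_im, Complex.ofReal_im, sub_zero, Complex.im_mul_ofReal, abs_mul,
          abs_of_pos hΩ]
      have h4 : ‖(2 * Ω : ℂ) * Complex.sin (E * Ω)‖ ≤ 2 * Ω * Real.exp (|E.im| * Ω) := by
        rw [norm_mul, norm_mul, Complex.norm_ofNat, Complex.norm_real, Real.norm_of_nonneg hΩ.le]
        gcongr
      have h5 := norm_sub_le (deriv τ E + 2 * Ω * Complex.sin (E * Ω))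
        (2 * Ω * Complex.sin (E * Ω))
      rw [add_sub_cancel_right] at h5
      have h6 : C * Real.exp Ω / (‖E‖ - 1) * Real.exp (|E.im| * Ω) ≤
        C * Real.exp Ω * Real.exp (|E.im| * Ω) := by gcongr
      linarith
  exact ⟨V, hVd, fun E => by rw [hτv, hV]⟩

include hΩ hC hτ hτd in
/-- The limit exists by comparison of degrees and is that of the model case `τ = 2 cos (Ω E)`, where
`τ' ^ 2 = -Ω ^ 2 (τ ^ 2 - 4)`. -/
theorem tendsto_sq_div (hU : ∀ E, τ E ^ 2 - 4 = U.eval E * D E ^ 2) (hU0 : U ≠ 0) {V : ℂ[X]}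
    (hVd : V.natDegree ≤ U.natDegree / 2) (hV : ∀ E, deriv τ E = V.eval E * D E) :
    Tendsto (fun E => V.eval E ^ 2 / U.eval E) (cocompact ℂ) (𝓝 (-(Ω : ℂ) ^ 2)) := by
  have hV2 : (V ^ 2).natDegree ≤ U.natDegree := natDegree_pow_le.trans (by omega)
  have h1 := (tendsto_eval_div_pow hV2).div (tendsto_eval_div_pow (le_refl U.natDegree))
    (by rwa [coeff_natDegree, Ne, leadingCoeff_eq_zero])
  have hne : ∀ᶠ E : ℂ in cocompact ℂ, E ≠ 0 := by
    filter_upwards [(isCompact_singleton (x := (0 : ℂ))).compl_mem_cocompact] with E hE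
    exact hE
  have h2 : Tendsto (fun E => V.eval E ^ 2 / U.eval E) (cocompact ℂ)
      (𝓝 ((V ^ 2).coeff U.natDegree / U.coeff U.natDegree)) := by
    refine h1.congr' ?_
    filter_upwards [hne] with E hE
    rw [Pi.div_apply, div_div_div_cancel_right₀ (pow_ne_zero _ hE), eval_pow]
  -- The limit is determined along the positive imaginary axis.
  obtain ⟨h3, h4⟩ := tendsto_mul_exp_imaginary_axis hΩ hC hτ hτd
  have hdecay : Tendsto (fun y : ℝ => Complex.exp (-(y * Ω))) atTop (𝓝 0) := by
    rw [tendsto_zero_iff_norm_tendsto_zero]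
    have : ∀ y : ℝ, ‖Complex.exp (-(y * Ω))‖ = Real.exp (-(y * Ω)) := fun y => by
      rw [Complex.norm_exp]
      simp
    simp only [this]
    exact Real.tendsto_exp_neg_atTop_nhds_zero.comp (tendsto_id.atTop_mul_const hΩ)
  have h5 : Tendsto (fun y : ℝ => (τ (y * Complex.I) * Complex.exp (-(y * Ω))) ^ 2 -
      4 * Complex.exp (-(y * Ω)) ^ 2) atTop (𝓝 1) := by
    have := (h3.pow 2).sub ((hdecay.pow 2).const_mul 4)
    simpa using this
  have h6 := (h4.pow 2).div h5 one_ne_zero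
  have hlim : (-(Complex.I * Ω)) ^ 2 / 1 = -(Ω : ℂ) ^ 2 := by
    rw [div_one, neg_sq, mul_pow, Complex.I_sq, neg_one_mul]
  rw [hlim] at h6
  have hpath : Tendsto (fun y : ℝ => (y : ℂ) * Complex.I) atTop (cocompact ℂ) := by
    rw [← Metric.cobounded_eq_cocompact, ← tendsto_norm_atTop_iff_cobounded]
    simp only [norm_mul, Complex.norm_I, mul_one, Complex.norm_real]
    exact tendsto_norm_atTop_atTop
  have h7 : Tendsto (fun y : ℝ => V.eval (y * Complex.I) ^ 2 / U.eval (y * Complex.I)) atTop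
      (𝓝 (-(Ω : ℂ) ^ 2)) := by
    refine h6.congr' ?_
    filter_upwards [h5.eventually_ne one_ne_zero] with y hy
    have hy' : (τ (y * Complex.I) * Complex.exp (-(y * Ω))) ^ 2 - 4 * Complex.exp (-(y * Ω)) ^ 2 =
        U.eval (y * Complex.I) * D (y * Complex.I) ^ 2 * Complex.exp (-(y * Ω)) ^ 2 := by
      rw [← hU]
      ring
    rw [Pi.div_apply, hy', hV]
    rw [hy'] at hy
    have hD : D (y * Complex.I) ^ 2 * Complex.exp (-(y * Ω)) ^ 2 ≠ 0 := by
      rw [mul_assoc] at hy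
      exact right_ne_zero_of_mul hy
    rw [show (V.eval (y * Complex.I) * D (y * Complex.I) * Complex.exp (-(y * Ω))) ^ 2 =
      V.eval (y * Complex.I) ^ 2 * (D (y * Complex.I) ^ 2 * Complex.exp (-(y * Ω)) ^ 2) by ring,
      mul_assoc (U.eval _), mul_div_mul_right _ _ hD]
  rwa [tendsto_nhds_unique (h2.comp hpath) h7] at h2

end

theorem IsRegularAnalyticArc.neg {A : Set ℂ} (h : IsRegularAnalyticArc A) :
    IsRegularAnalyticArc (Neg.neg ⁻¹' A) := by
  obtain ⟨I, γ, hI, hIc, hIn, hγ, hγd, hγi, hγt, rfl⟩ := h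
  refine ⟨I, fun t => -γ t, hI, hIc, hIn, fun t ht => (hγ t ht).neg, fun t ht => ?_,
    fun t ht t' ht' h => hγi ht ht' (neg_injective h),
    (Homeomorph.neg ℂ).isClosedEmbedding.tendsto_cocompact.comp hγt, ?_⟩
  · rw [show (fun t => -γ t) = -γ from rfl, deriv.neg]
    exact neg_ne_zero.2 (hγd t ht)
  · rw [Set.neg_preimage, ← Set.image_neg_eq_neg, image_image]

theorem IsTail.neg {f : ℂ → ℂ} {T O : Set ℂ} (h : IsTail (fun E => f (-E)) T O) :
    IsTail f (Neg.neg ⁻¹' T) (Neg.neg ⁻¹' O) where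
  isRegularAnalyticArc := h.isRegularAnalyticArc.neg
  isClosed := h.isClosed.preimage continuous_neg
  isOpen := h.isOpen.preimage continuous_neg
  exists_eq z hz := by simpa only [neg_neg] using h.exists_eq (-z) hz
  mem z hz hzS := h.mem (-z) hz (by simpa only [neg_neg] using hzS)
  eq_or_eq z hz hzO := by simpa only [neg_neg] using h.eq_or_eq (-z) hz hzO

/-- An entire function asymptotic to `2 cos (Ω E)`, whose ramification over `±2` is described by a
polynomial up to a square, takes values in `[-2, 2]` on a finite union of regular analytic
arcs. -/
theorem exists_regularAnalyticArcs_of_asymptotics {τ D : ℂ → ℂ} {U : ℂ[X]} {Ω C R : ℝ} (hΩ : 0 < Ω)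
    (hC : 0 < C) (hτ : ∀ E : ℂ, R ≤ ‖E‖ →
      ‖τ E - 2 * Complex.cos (E * Ω)‖ ≤ C / ‖E‖ * Real.exp (|E.im| * Ω))
    (hτd : Differentiable ℂ τ) (hD : Differentiable ℂ D)
    (hU : ∀ E, τ E ^ 2 - 4 = U.eval E * D E ^ 2) :
    ∃ (N : ℕ) (A : Fin N → Set ℂ), (∀ i, IsRegularAnalyticArc (A i)) ∧
      (∀ i j, i ≠ j → (A i ∩ A j).Finite) ∧ {E | ∃ t ∈ Icc (-2 : ℝ) 2, τ E = t} = ⋃ i, A i := by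
  obtain ⟨hU0, hD0⟩ := ne_zero_of_sq_sub_four hΩ hC hτ hU hD
  obtain ⟨V, hVd, hV⟩ := exists_deriv_eq_eval_mul hΩ hC hτ hτd hD hU
  have hlim := tendsto_sq_div hΩ hC hτ hτd hU hU0 hVd hV
  obtain ⟨K, hK⟩ := exists_abs_im_le hΩ hτ
  have hV0 : V ≠ 0 := by
    rintro rfl
    simp only [eval_zero, zero_pow two_ne_zero, zero_div] at hlim
    have := tendsto_nhds_unique hlim tendsto_const_nhds
    exact pow_ne_zero 2 (Complex.ofReal_ne_zero.2 hΩ.ne') (neg_eq_zero.1 this)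
  have hD0' : ∀ z, ¬ ∀ᶠ E in 𝓝 z, D E = 0 := fun z h => hD0 z (analyticOrderAt_eq_top.2 h)
  have hloc : ∀ z₀, ¬ ∀ᶠ z in 𝓝 z₀, τ z = τ z₀ := by
    intro z₀ h
    have h1 : ∀ᶠ z in 𝓝 z₀, V.eval z * D z = 0 := by
      filter_upwards [eventually_eventually_nhds.2 h] with z hz
      have hz' : τ =ᶠ[𝓝 z] fun _ => τ z₀ := hz
      rw [← hV, hz'.deriv_eq, deriv_const]
    have h2 := analyticOrderAt_eq_top.2 h1
    rw [analyticOrderAt_eval_mul hV0 hD, ENat.add_eq_top] at h2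
    exact h2.elim (ENat.natCast_ne_top _) (hD0 z₀)
  obtain ⟨R₁, W₁, w₁, hR₁, hW₁⟩ := exists_eq_two_mul_cos hΩ hτd hD U.differentiable
    V.differentiable hD0' hU (fun E => by rw [hV, mul_comm]) hlim
  obtain ⟨T₁, O₁, M₁, hT₁, hre₁, hM₁⟩ := exists_isTail hΩ hR₁ hW₁ hK
  have hnegt : Tendsto (fun E : ℂ => -E) (cocompact ℂ) (cocompact ℂ) :=
    (Homeomorph.neg ℂ).isClosedEmbedding.tendsto_cocompact
  obtain ⟨R₂, W₂, w₂, hR₂, hW₂⟩ := exists_eq_two_mul_cos (f := fun E => τ (-E))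
    (D := fun E => D (-E)) (u := fun E => U.eval (-E)) (v := fun E => -V.eval (-E)) hΩ
    (hτd.comp differentiable_neg) (hD.comp differentiable_neg)
    (U.differentiable.comp differentiable_neg) (V.differentiable.comp differentiable_neg).fun_neg
    (fun z h => hD0' (-z) (by
      have h' := (continuous_neg (G := ℂ)).tendsto (-z)
      rw [neg_neg] at h'
      simpa only [neg_neg] using h'.eventually h))
    (fun E => hU (-E)) (fun E => by
      rw [deriv_comp_neg, hV]
      ring) (by
      have := hlim.comp hnegt
      refine this.congr fun E => ?_
      simp only [Function.comp_apply, neg_sq])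
  obtain ⟨T₂, O₂, M₂, hT₂, hre₂, hM₂⟩ := exists_isTail (K := K) hΩ hR₂ hW₂ fun E hE => by
    have := hK (-E) hE
    rwa [Complex.neg_im, abs_neg] at this
  refine exists_regularAnalyticArcs hτd hloc hT₁ hT₂.neg ?_ (R := max M₁ M₂) ?_
  · refine Set.finite_empty.subset ?_
    rintro z ⟨h1, h2⟩
    have h3 := hre₂ (-z) h2
    rw [Complex.neg_re] at h3
    linarith [hre₁ z h1]
  · intro z hz h1 h2
    rcases le_total 0 z.re with h | h
    · exact (hM₁ z hz h h1).trans (le_max_left _ _)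
    · have := hM₂ (-z) (by simpa only [neg_neg] using hz) (by rw [Complex.neg_re]; linarith) h2
      rw [norm_neg] at this
      exact this.trans (le_max_right _ _)

end AKNS

theorem theoremt4p1 (p q : ℝ → ℂ) (Ω : ℝ) (hΩ : 0 < Ω)
    (hp : Function.Periodic p Ω) (hq : Function.Periodic q Ω)
    (hpC : ContDiff ℝ 2 p) (hqC : ContDiff ℝ 2 q)
    (D : ℂ → ℂ) (hD : AKNS.IsImmovableFactor p q Ω D)
    (U : Polynomial ℂ) (hU : ∀ E : ℂ, AKNS.discr hp hq E = U.eval E * D E ^ 2) :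
    ∃ n : ℕ,
      -- the degree of U is even and at least two
      U.natDegree = 2 * n + 2 ∧
      -- the number of movable Dirichlet eigenvalues
      (∀ x : ℝ, q x ≠ 0 → HasSum (fun E : ℂ => AKNS.deltaMov p q Ω E x) (n : ℕ∞)) ∧
      -- the conditional stability set
      (∃ (N : ℕ) (A : Fin N → Set ℂ), (∀ i, AKNS.IsRegularAnalyticArc (A i)) ∧
        (∀ i j, i ≠ j → (A i ∩ A j).Finite) ∧ AKNS.stabilitySet p q = ⋃ i, A i) ∧
      -- smoothness
      ContDiff ℝ ∞ p ∧ ContDiff ℝ ∞ q ∧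
      -- the commuting differential expression of order n + 1
      (AKNS.branchSet hp hq).Finite ∧
      ∃ B : ℕ → ℝ → Matrix (Fin 2) (Fin 2) ℂ,
        (∀ j a b, ContDiff ℝ ∞ (fun x => B j x a b)) ∧
        (∀ x, B (n + 1) x = AKNS.J ^ (n + 2)) ∧
        (∀ y : ℝ → Fin 2 → ℂ, ContDiff ℝ ∞ y →
          AKNS.diffExpr (n + 1) B (AKNS.L p q y) = AKNS.L p q (AKNS.diffExpr (n + 1) B y)) ∧
        (∀ y : ℝ → Fin 2 → ℂ, ContDiff ℝ ∞ y →
          AKNS.diffExpr (n + 1) B (AKNS.diffExpr (n + 1) B y) =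
            -AKNS.polyL p q (AKNS.curvePoly hp hq) y) := by
  have hpC1 : ContDiff ℝ 1 p := hpC.of_le (by norm_num)
  have hqC1 : ContDiff ℝ 1 q := hqC.of_le (by norm_num)
  obtain ⟨Y, hY⟩ := AKNS.exists_isFundamental hpC.continuous hqC.continuous
  obtain ⟨n, g, F, G, H, hdeg, hM, hF⟩ := hY.exists_isPolynomialMonodromy hpC1 hqC1 hΩ hp hq hD hU
  obtain ⟨C, R, hC, -, hasymp⟩ := hY.exists_monodromy_asymptotics hpC1 hqC1 hΩ hp hq 0
  have hτU : ∀ E, (Y E Ω).trace ^ 2 - 4 = U.eval E * D E ^ 2 := by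
    intro E
    rw [← hU, AKNS.discr, hY.trace_floquetOperator hp hq]
  have hτ := fun E hE => (hasymp E hE).2
  obtain ⟨hU0, hD0⟩ := AKNS.ne_zero_of_sq_sub_four hΩ hC hτ hτU hD.1
  refine ⟨n, by omega, fun x hx => ?_, ?_, hM.contDiff_p, hM.contDiff_q, ?_, ?_⟩
  · have hcoeff : (F x).coeff n ≠ 0 := by
      rw [hM.coeff_F_eq]
      exact mul_ne_zero (mul_ne_zero Complex.I_ne_zero hM.ne_zero) hx
    have hF0 : F x ≠ 0 := fun h => hcoeff (by rw [h, coeff_zero])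
    have hFdeg : (F x).natDegree = n := by
      refine le_antisymm ?_ (le_natDegree_of_ne_zero hcoeff)
      by_contra! hlt
      have h1 : (F x).natDegree = n + 1 := le_antisymm (hM.natDegree_F x) hlt
      have h2 := hM.coeff_F x
      rw [← h1, coeff_natDegree, leadingCoeff_eq_zero] at h2
      exact hF0 h2
    have hmov : ∀ E, AKNS.deltaMov p q Ω E x = (((F x).rootMultiplicity E : ℕ) : ℕ∞) := by
      intro E
      have hfin := hD0 E
      rw [hD.2] at hfin
      rw [AKNS.deltaMov, hY.delta_eq hpC.continuous hqC.continuous hΩ hp hq]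
      simp only [hF]
      rw [AKNS.analyticOrderAt_eval_mul hF0 hD.1, hD.2]
      obtain ⟨d, hd⟩ := ENat.ne_top_iff_exists.1 hfin
      rw [← hd]
      norm_cast
      omega
    simp only [hmov]
    have := AKNS.hasSum_rootMultiplicity hF0
    rwa [hFdeg] at this
  · rw [show AKNS.stabilitySet p q = {E | ∃ t ∈ Icc (-2 : ℝ) 2, (Y E Ω).trace = t} from
      Set.ext fun E => hY.mem_stabilitySet_iff hΩ hp hq]
    exact AKNS.exists_regularAnalyticArcs_of_asymptotics hΩ hC hτ (hY.trace_entire Ω) hD.1 hτU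
  · rw [AKNS.branchSet_eq hp hq hD hU hU0 hD0]
    exact Finset.finite_toSet _
  · -- Scaling the monodromy polynomials by `i / g` turns `U / 4` into `-curvePoly`.
    have hg := hM.ne_zero
    have hlead : U.leadingCoeff = 4 * g ^ 2 := by
      rw [leadingCoeff, hdeg, hM.leadingCoeff]
    have hscale := hM.const_mul (div_ne_zero Complex.I_ne_zero hg)
    rw [div_mul_cancel₀ _ hg] at hscale
    obtain ⟨B, hB, hBn, hBL, hBB⟩ := hscale.exists_diffExpr
    refine ⟨B, hB, hBn, hBL, fun y hy => ?_⟩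
    rw [hBB y hy, AKNS.eq_C_mul_curvePoly hp hq hD hU hU0 hD0, ← mul_assoc, ← C_mul,
      AKNS.polyL_C_mul, smul_smul, hlead, div_pow, Complex.I_sq]
    rw [show (4⁻¹ : ℂ) * (-1 / g ^ 2 * (4 * g ^ 2)) = -1 by field_simp, neg_one_smul]
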